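/- All vector spaces, algebras and tensor products are over $\mathbb{C}$; super means $\mathbb{Z}/2$-graded. Let $n\ge 2$. Let $\hat{\mathfrak q}(n)$ be the Lie superalgebra of block matrices $\begin{pmatrix} X & Y\\ Y & X\end{pmatrix}$ with $X,Y\in M_{n+1}(\mathbb{C})$ ($X$ being the even and $Y$ the odd part) with the supercommutator, let $\tilde{\mathfrak q}(n)=[\hat{\mathfrak q}(n),\hat{\mathfrak q}(n)]$, and let $\mathfrak q=\tilde{\mathfrak q}(n)/\mathbb{C}I$ be the queer Lie superalgebra. Let $A$ be a finitely generated commutative associative unital algebra, let $\operatorname{MaxSpec}(A)$ be its set of maximal ideals, and let $\mathfrak q\otimes A$ be the Lie superalgebra with bracket $[x\otimes a,y\otimes b]=[x,y]\otimes ab$ and grading $(\mathfrak q\otimes A)_i=\mathfrak q_i\otimes A$. Modules over a Lie superalgebra are $\mathbb{Z}/2$-graded. Isomorphisms of modules are linear bijections commuting with the action and need not be homogeneous. Irreducible means nonzero and without nonzero proper graded submodules. For a Lie superalgebra $\mathfrak g$, let $\mathcal R(\mathfrak g)$ be the set of isomorphism classes of irreducible finite-dimensional $\mathfrak g$-modules.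 For irreducible finite-dimensional modules $V^1$, $V^2$ over Lie superalgebras $\mathfrak g^1$, $\mathfrak g^2$, define the $\mathfrak g^1\oplus\mathfrak g^2$-module $V^1\widehat\otimes V^2$ to be $V^1\otimes V^2$ if this is irreducible, and otherwise $\{v\in V^1\otimes V^2 : (\sqrt{-1}\,\varphi_1\otimes\varphi_2)v=v\}$, where $\varphi_i$ is an odd endomorphism of $V^i$ that supercommutes with $\mathfrak g^i$ and satisfies $\varphi_i^2=-1$ (it exists in this case and is unique up to sign), and where $(\varphi\otimes\varphi')(v\otimes w)=(-1)^{|\varphi'||v|}\varphi v\otimes\varphi' w$. Put $V^1\widehat\otimes\cdots\widehat\otimes V^k=(V^1\widehat\otimes\cdots\widehat\otimes V^{k-1})\widehat\otimes V^k$. Let $\mathcal E(\mathfrak q,A)$ be the set of maps $\Psi:\operatorname{MaxSpec}(A)\to\mathcal R(\mathfrak q)$ with finite support, where the support of $\Psi$ is the set of those $\mathsf m$ for which $\Psi(\mathsf m)$ is not the class of the trivial one-dimensional module. Given $\Psi$ with support $\{\mathsf m_1,\dots,\mathsf m_k\}$ (the $\mathsf m_i$ distinct), choose $V_i$ in the class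 $\Psi(\mathsf m_i)$, regard it as a $\mathfrak q\otimes A/\mathsf m_i$-module through $A/\mathsf m_i\cong\mathbb{C}$, and let $\widehat{\mathrm{ev}}_\Psi$ be the isomorphism class of the pullback of $V_1\widehat\otimes\cdots\widehat\otimes V_k$ along the evaluation map $\mathfrak q\otimes A\to\bigoplus_{i=1}^k \mathfrak q\otimes A/\mathsf m_i$. If the support is empty, $\widehat{\mathrm{ev}}_\Psi$ is the class of the trivial one-dimensional module. **Proposition.** The class $\widehat{\mathrm{ev}}_\Psi$ is well defined (it does not depend on the order of the $\mathsf m_i$ nor on the choice of the $V_i$), it is the class of an irreducible finite-dimensional $\mathfrak q\otimes A$-module, and the map $$\mathcal E(\mathfrak q,A)\longrightarrow\mathcal R(\mathfrak q\otimes A),\qquad \Psi\longmapsto\widehat{\mathrm{ev}}_\Psi,$$ is injective. -/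

import Mathlib

open scoped TensorProduct

noncomputable section

universe u v

namespace Queer

/-! ### Super vector spaces over the complex numbers -/

/-- A complex super vector space: a vector space with a decomposition `V = V₀ ⊕ V₁`
indexed by `ZMod 2` (`gr 0` is the even part, `gr 1` the odd part). -/
structure SuperSpace : Type (u + 1) where
  carrier : Type u
  [acg : AddCommGroup carrier]
  [mod : Module ℂ carrier]
  gr : ZMod 2 → Submodule ℂ carrier
  isCompl : IsCompl (gr 0) (gr 1)

attribute [instance] SuperSpace.acg SuperSpace.mod

instance : CoeSort SuperSpace.{u} (Type u) := ⟨SuperSpace.carrier⟩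

/-- The Koszul sign `(-1)^(i j)`. -/
def sgn (i j : ZMod 2) : ℂ := (-1) ^ (i.val * j.val)

@[simp] lemma sgn_zero_left (j : ZMod 2) : sgn 0 j = 1 := by simp [sgn]
@[simp] lemma sgn_zero_right (i : ZMod 2) : sgn i 0 = 1 := by simp [sgn]
@[simp] lemma sgn_one_one : sgn 1 1 = -1 := by simp [sgn, ZMod.val_one]

lemma parity_cases (i : ZMod 2) : i = 0 ∨ i = 1 := by
  revert i; decide

@[simp] lemma one_add_one_zmod : (1 + 1 : ZMod 2) = 0 := by decide

lemma eq_zero_of_eq_neg {M : Type u} [AddCommGroup M] [Module ℂ M] {t : M} (h : t = -t) :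
    t = 0 := by
  have h2 : (2 : ℂ) • t = 0 := by
    rw [two_smul]
    nth_rewrite 2 [h]
    exact add_neg_cancel t
  exact (smul_eq_zero.1 h2).resolve_left two_ne_zero

namespace SuperSpace

/-- The projection of a super vector space onto its component of degree `i`. -/
def comp (V : SuperSpace.{u}) (i : ZMod 2) : V →ₗ[ℂ] V :=
  if i = 0 then (V.gr 0).projection (V.gr 1) V.isCompl
  else (V.gr 1).projection (V.gr 0) V.isCompl.symm

/-- The parity involution `v ↦ (-1)^|v| v`. -/
def parity (V : SuperSpace.{u}) : V →ₗ[ℂ] V := V.comp 0 - V.comp 1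

lemma comp_mem (V : SuperSpace.{u}) (i : ZMod 2) (v : V) : V.comp i v ∈ V.gr i := by
  rcases parity_cases i with rfl | rfl <;> simp [comp]

lemma comp_self (V : SuperSpace.{u}) {i : ZMod 2} {v : V} (hv : v ∈ V.gr i) :
    V.comp i v = v := by
  rcases parity_cases i with rfl | rfl
  · exact Submodule.projection_apply_of_mem_left V.isCompl hv
  · exact Submodule.projection_apply_of_mem_left V.isCompl.symm hv

lemma comp_other (V : SuperSpace.{u}) {i j : ZMod 2} (hij : i ≠ j) {v : V} (hv : v ∈ V.gr j) :
    V.comp i v = 0 := by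
  rcases parity_cases i with rfl | rfl <;> rcases parity_cases j with rfl | rfl
  · exact absurd rfl hij
  · simpa [comp] using hv
  · simpa [comp] using hv
  · exact absurd rfl hij

lemma comp_add_comp (V : SuperSpace.{u}) (v : V) : V.comp 0 v + V.comp 1 v = v := by
  obtain ⟨a, ha, b, hb, rfl⟩ := Submodule.mem_sup.1
    (show v ∈ V.gr 0 ⊔ V.gr 1 by rw [V.isCompl.sup_eq_top]; trivial)
  rw [map_add, map_add, V.comp_self ha, V.comp_self hb, V.comp_other (by decide) ha,
    V.comp_other (by decide) hb]
  simp

lemma parity_of_mem (V : SuperSpace.{u}) {i : ZMod 2} {v : V} (hv : v ∈ V.gr i) :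
    V.parity v = sgn 1 i • v := by
  rcases parity_cases i with rfl | rfl
  · simp [parity, V.comp_self hv, V.comp_other (show (1 : ZMod 2) ≠ 0 by decide) hv]
  · simp [parity, V.comp_self hv, V.comp_other (show (0 : ZMod 2) ≠ 1 by decide) hv]

lemma hom_induction (V : SuperSpace.{u}) {p : V → Prop} (v : V)
    (hom : ∀ i, ∀ v ∈ V.gr i, p v) (add : ∀ v w, p v → p w → p (v + w)) : p v := by
  rw [← V.comp_add_comp v]
  exact (add _ _ (hom 0 _ (V.comp_mem 0 v)) (hom 1 _ (V.comp_mem 1 v)))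

/-- A (graded) subspace: `W = (W ∩ V₀) ⊕ (W ∩ V₁)`. -/
def IsGraded (V : SuperSpace.{u}) (W : Submodule ℂ V) : Prop :=
  (W ⊓ V.gr 0) ⊔ (W ⊓ V.gr 1) = W

lemma IsGraded.comp_mem {V : SuperSpace.{u}} {W : Submodule ℂ V} (hW : V.IsGraded W)
    (i : ZMod 2) {v : V} (hv : v ∈ W) : V.comp i v ∈ W := by
  rw [IsGraded] at hW
  rw [← hW] at hv
  obtain ⟨a, ha, b, hb, rfl⟩ := Submodule.mem_sup.1 hv
  rw [map_add]
  rcases parity_cases i with rfl | rfl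
  · rw [V.comp_self ha.2, V.comp_other (by decide) hb.2, add_zero]; exact ha.1
  · rw [V.comp_self hb.2, V.comp_other (by decide) ha.2, zero_add]; exact hb.1

lemma isGraded_of_comp_mem {V : SuperSpace.{u}} {W : Submodule ℂ V}
    (h : ∀ i, ∀ v ∈ W, V.comp i v ∈ W) : V.IsGraded W := by
  refine le_antisymm (sup_le inf_le_left inf_le_left) fun v hv => ?_
  rw [← V.comp_add_comp v]
  exact Submodule.add_mem_sup ⟨h 0 v hv, V.comp_mem 0 v⟩ ⟨h 1 v hv, V.comp_mem 1 v⟩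

/-- A graded subspace as a super vector space. -/
@[reducible] def sub (V : SuperSpace.{u}) (W : Submodule ℂ V) (hW : V.IsGraded W) : SuperSpace.{u} where
  carrier := W
  gr i := (V.gr i).comap W.subtype
  isCompl := by
    constructor
    · rw [Submodule.disjoint_def]
      intro x h0 h1
      exact Subtype.ext (Submodule.disjoint_def.1 V.isCompl.disjoint x.1 h0 h1)
    · rw [codisjoint_iff, eq_top_iff]
      intro x _
      have : x = (⟨V.comp 0 x.1, hW.comp_mem 0 x.2⟩ : W) + ⟨V.comp 1 x.1, hW.comp_mem 1 x.2⟩ :=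
        Subtype.ext (V.comp_add_comp x.1).symm
      rw [this]
      exact Submodule.add_mem_sup (V.comp_mem 0 x.1) (V.comp_mem 1 x.1)

/-- The quotient of a super vector space by a graded subspace. -/
@[reducible] def quot (V : SuperSpace.{u}) (W : Submodule ℂ V) (hW : V.IsGraded W) : SuperSpace.{u} where
  carrier := V ⧸ W
  gr i := (V.gr i).map W.mkQ
  isCompl := by
    constructor
    · rw [Submodule.disjoint_def]
      rintro _ ⟨a, ha, rfl⟩ ⟨b, hb, hab⟩
      have h1 : b - a ∈ W := by
        rw [← Submodule.ker_mkQ W, LinearMap.mem_ker, map_sub, hab, sub_self]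
      have h2 := hW.comp_mem 0 h1
      rw [map_sub, V.comp_self ha, V.comp_other (by decide) hb, zero_sub] at h2
      have h3 : a ∈ W := by simpa using h2
      simpa using h3
    · rw [codisjoint_iff, ← Submodule.map_sup, V.isCompl.sup_eq_top, Submodule.map_top,
        Submodule.range_mkQ]

/-- The direct sum of two super vector spaces. -/
@[reducible] def prod (V W : SuperSpace.{u}) : SuperSpace.{u} where
  carrier := V × W
  gr i := (V.gr i).prod (W.gr i)
  isCompl := by
    constructor
    · rw [Submodule.disjoint_def]
      intro x h0 h1
      exact Prod.ext (Submodule.disjoint_def.1 V.isCompl.disjoint x.1 h0.1 h1.1)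
        (Submodule.disjoint_def.1 W.isCompl.disjoint x.2 h0.2 h1.2)
    · rw [codisjoint_iff, Submodule.prod_sup_prod, V.isCompl.sup_eq_top, W.isCompl.sup_eq_top,
        Submodule.prod_top]

/-- The zero super vector space. -/
def zero : SuperSpace.{u} where
  carrier := PUnit
  gr _ := ⊤
  isCompl := ⟨by rw [Submodule.disjoint_def]; intros; rfl, by rw [codisjoint_iff]; simp⟩

/-- The degree `k` part of `V ⊗ W` is `⨁_{i + j = k} V_i ⊗ W_j`. -/
def tensorGr (V : SuperSpace.{u}) (W : SuperSpace.{v}) (k : ZMod 2) : Submodule ℂ (V ⊗[ℂ] W) :=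
  Submodule.span ℂ {t | ∃ i j, i + j = k ∧ ∃ x ∈ V.gr i, ∃ y ∈ W.gr j, x ⊗ₜ[ℂ] y = t}

lemma tmul_mem_tensorGr {V : SuperSpace.{u}} {W : SuperSpace.{v}} {i j : ZMod 2} {x : V} {y : W}
    (hx : x ∈ V.gr i) (hy : y ∈ W.gr j) : x ⊗ₜ[ℂ] y ∈ tensorGr V W (i + j) :=
  Submodule.subset_span ⟨i, j, rfl, x, hx, y, hy, rfl⟩

lemma parity_tensor {V : SuperSpace.{u}} {W : SuperSpace.{v}} (k : ZMod 2) {t : V ⊗[ℂ] W}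
    (ht : t ∈ tensorGr V W k) : TensorProduct.map V.parity W.parity t = sgn 1 k • t := by
  induction ht using Submodule.span_induction with
  | mem t ht =>
    obtain ⟨i, j, rfl, x, hx, y, hy, rfl⟩ := ht
    rw [TensorProduct.map_tmul, V.parity_of_mem hx, W.parity_of_mem hy, TensorProduct.smul_tmul_smul]
    congr 1
    rcases parity_cases i with rfl | rfl <;> rcases parity_cases j with rfl | rfl <;> simp
  | zero => simp
  | add a b _ _ ha hb => rw [map_add, ha, hb, smul_add]
  | smul c a _ ha => rw [map_smul, ha, smul_comm]

/-- The tensor product of two super vector spaces. -/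
@[reducible] def tensor (V : SuperSpace.{u}) (W : SuperSpace.{v}) : SuperSpace.{max u v} where
  carrier := V ⊗[ℂ] W
  gr := tensorGr V W
  isCompl := by
    constructor
    · rw [Submodule.disjoint_def]
      intro t h0 h1
      have e0 := parity_tensor 0 h0
      have e1 := parity_tensor 1 h1
      rw [e0] at e1
      simp only [sgn_zero_right, one_smul, sgn_one_one, neg_smul] at e1
      exact eq_zero_of_eq_neg e1
    · rw [codisjoint_iff, eq_top_iff]
      intro t _
      induction t using TensorProduct.induction_on with
      | zero => exact zero_mem _
      | add a b ha hb => exact add_mem (ha trivial) (hb trivial)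
      | tmul x y =>
        have key : ∀ k, tensorGr V W k ≤ tensorGr V W 0 ⊔ tensorGr V W 1 := by
          intro k
          rcases parity_cases k with rfl | rfl
          · exact le_sup_left
          · exact le_sup_right
        rw [← V.comp_add_comp x, ← W.comp_add_comp y, TensorProduct.add_tmul,
          TensorProduct.tmul_add, TensorProduct.tmul_add]
        refine add_mem (add_mem ?_ ?_) (add_mem ?_ ?_) <;>
          exact key _ (tmul_mem_tensorGr (comp_mem _ _ _) (comp_mem _ _ _))

end SuperSpace

/-! ### Lie superalgebras -/

/-- A complex Lie superalgebra. -/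
structure LieSuperalgebra : Type (u + 1) extends SuperSpace.{u} where
  bracket : carrier →ₗ[ℂ] carrier →ₗ[ℂ] carrier
  bracket_mem : ∀ i j, ∀ x ∈ gr i, ∀ y ∈ gr j, bracket x y ∈ gr (i + j)
  skew : ∀ i j, ∀ x ∈ gr i, ∀ y ∈ gr j, bracket x y = -(sgn i j • bracket y x)
  jacobi : ∀ i j k, ∀ x ∈ gr i, ∀ y ∈ gr j, ∀ z ∈ gr k,
    bracket x (bracket y z) = bracket (bracket x y) z + sgn i j • bracket y (bracket x z)

instance : CoeSort LieSuperalgebra.{u} (Type u) := ⟨fun L => L.carrier⟩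

namespace LieSuperalgebra

/-- The bilinear extension of `[x, y] = x y - (-1)^(|x| |y|) y x` to an associative algebra
with a `ZMod 2`-grading. -/
def assocBracket (R : Type u) [Ring R] [Algebra ℂ R] (g : ZMod 2 → Submodule ℂ R)
    (hg : IsCompl (g 0) (g 1)) : R →ₗ[ℂ] R →ₗ[ℂ] R :=
  let S : SuperSpace.{u} := { carrier := R, gr := g, isCompl := hg }
  LinearMap.mul ℂ R - ∑ i : ZMod 2, ∑ j : ZMod 2,
    sgn i j • (LinearMap.mul ℂ R).flip.compl₁₂ (S.comp i) (S.comp j)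

lemma assocBracket_of_mem (R : Type u) [Ring R] [Algebra ℂ R] (g : ZMod 2 → Submodule ℂ R)
    (hg : IsCompl (g 0) (g 1)) (i j : ZMod 2) {x y : R} (hx : x ∈ g i) (hy : y ∈ g j) :
    assocBracket R g hg x y = x * y - sgn i j • (y * x) := by
  let S : SuperSpace.{u} := { carrier := R, gr := g, isCompl := hg }
  have h1 : ∀ a : ZMod 2, S.comp a x = if a = i then x else 0 := by
    intro a
    split_ifs with h
    · subst h; exact S.comp_self hx
    · exact S.comp_other h hx
  have h2 : ∀ a : ZMod 2, S.comp a y = if a = j then y else 0 := by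
    intro a
    split_ifs with h
    · subst h; exact S.comp_self hy
    · exact S.comp_other h hy
  have h3 : assocBracket R g hg x y = x * y - ∑ a : ZMod 2, ∑ c : ZMod 2,
      sgn a c • (S.comp c y * S.comp a x : R) := by
    simp [assocBracket, S, LinearMap.sum_apply]
  rw [h3]
  simp [h1, h2]

/-- The Lie superalgebra attached to an associative algebra `R` with a `ZMod 2`-grading compatible
with multiplication: `[x, y] = x y - (-1)^(|x| |y|) y x` on homogeneous elements. -/
def ofAssoc (R : Type u) [Ring R] [Algebra ℂ R] (g : ZMod 2 → Submodule ℂ R)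
    (hg : IsCompl (g 0) (g 1)) (hmul : ∀ i j, ∀ x ∈ g i, ∀ y ∈ g j, x * y ∈ g (i + j)) :
    LieSuperalgebra.{u} :=
  have hb : ∀ i j, ∀ x ∈ g i, ∀ y ∈ g j,
      assocBracket R g hg x y = x * y - sgn i j • (y * x) :=
    fun i j _ hx _ hy => assocBracket_of_mem R g hg i j hx hy
  have mem : ∀ i j, ∀ x ∈ g i, ∀ y ∈ g j, assocBracket R g hg x y ∈ g (i + j) := by
    intro i j x hx y hy
    rw [hb i j x hx y hy]
    refine sub_mem (hmul i j x hx y hy) (Submodule.smul_mem _ _ ?_)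
    rw [add_comm]
    exact hmul j i y hy x hx
  { carrier := R
    gr := g
    isCompl := hg
    bracket := assocBracket R g hg
    bracket_mem := mem
    skew := by
      intro i j x hx y hy
      rw [hb i j x hx y hy, hb j i y hy x hx]
      rcases parity_cases i with rfl | rfl <;> rcases parity_cases j with rfl | rfl <;>
        simp [add_comm]
    jacobi := by
      intro i j k x hx y hy z hz
      rw [hb i (j + k) x hx _ (mem j k y hy z hz), hb (i + j) k _ (mem i j x hx y hy) z hz,
        hb j (i + k) y hy _ (mem i k x hx z hz), hb i j x hx y hy, hb j k y hy z hz,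
        hb i k x hx z hz]
      rcases parity_cases i with rfl | rfl <;> rcases parity_cases j with rfl | rfl <;>
        rcases parity_cases k with rfl | rfl <;> simp <;> noncomm_ring }

/-- A graded subspace is closed under the bracket if this holds for homogeneous elements. -/
lemma bracket_closed_of_hom (L : LieSuperalgebra.{u}) {W : Submodule ℂ L} (hW : L.IsGraded W)
    (h : ∀ i j, ∀ x ∈ L.gr i, ∀ y ∈ L.gr j, x ∈ W → y ∈ W → L.bracket x y ∈ W) :
    ∀ x ∈ W, ∀ y ∈ W, L.bracket x y ∈ W := by
  intro x hx y hy
  rw [← L.comp_add_comp x, ← L.comp_add_comp y]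
  simp only [map_add, LinearMap.add_apply]
  have key : ∀ i j, L.bracket (L.comp i x) (L.comp j y) ∈ W := fun i j =>
    h i j _ (L.comp_mem i x) _ (L.comp_mem j y) (hW.comp_mem i hx) (hW.comp_mem j hy)
  exact add_mem (add_mem (key _ _) (key _ _)) (add_mem (key _ _) (key _ _))

/-- The bracket restricted to a subspace closed under it. -/
def subBracket (L : LieSuperalgebra.{u}) (W : Submodule ℂ L)
    (hc : ∀ x ∈ W, ∀ y ∈ W, L.bracket x y ∈ W) : W →ₗ[ℂ] W →ₗ[ℂ] W :=
  LinearMap.mk₂ ℂ (fun x y : W => (⟨L.bracket x.1 y.1, hc _ x.2 _ y.2⟩ : W))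
    (fun _ _ _ => Subtype.ext (by simp)) (fun _ _ _ => Subtype.ext (by simp))
    (fun _ _ _ => Subtype.ext (by simp)) (fun _ _ _ => Subtype.ext (by simp))

/-- The subalgebra of a Lie superalgebra on a graded subspace closed under the bracket. -/
@[reducible] def sub (L : LieSuperalgebra.{u}) (W : Submodule ℂ L) (hW : L.IsGraded W)
    (hc : ∀ x ∈ W, ∀ y ∈ W, L.bracket x y ∈ W) : LieSuperalgebra.{u} :=
  { L.toSuperSpace.sub W hW with
    bracket := L.subBracket W hc
    bracket_mem := fun i j x hx y hy => L.bracket_mem i j x.1 hx y.1 hy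
    skew := fun i j x hx y hy => Subtype.ext (L.skew i j x.1 hx y.1 hy)
    jacobi := fun i j k x hx y hy z hz => Subtype.ext (L.jacobi i j k x.1 hx y.1 hy z.1 hz) }

lemma bracket_mem_right_of_left (L : LieSuperalgebra.{u}) {I : Submodule ℂ L} (hI : L.IsGraded I)
    (hid : ∀ x, ∀ y ∈ I, L.bracket x y ∈ I) (x : L) (hx : x ∈ I) (y : L) : L.bracket x y ∈ I := by
  have hom : ∀ i, ∀ a ∈ L.gr i, a ∈ I → L.bracket a y ∈ I := by
    intro i a ha haI
    refine L.hom_induction (p := fun y => L.bracket a y ∈ I) y (fun j b hb => ?_)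
      (fun b c hb hc => ?_)
    · rw [L.skew i j a ha b hb]
      exact neg_mem (Submodule.smul_mem _ _ (hid b a haI))
    · rw [map_add]; exact add_mem hb hc
  rw [← L.comp_add_comp x, map_add, LinearMap.add_apply]
  exact add_mem (hom 0 _ (L.comp_mem 0 x) (hI.comp_mem 0 hx))
    (hom 1 _ (L.comp_mem 1 x) (hI.comp_mem 1 hx))

/-- The bracket `[x + I, y + I] = [x, y] + I` on the quotient by a graded ideal. -/
def quotBracket (L : LieSuperalgebra.{u}) (I : Submodule ℂ L) (hI : L.IsGraded I)
    (hid : ∀ x, ∀ y ∈ I, L.bracket x y ∈ I) : (L ⧸ I) →ₗ[ℂ] (L ⧸ I) →ₗ[ℂ] (L ⧸ I) :=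
  I.liftQ
    ({ toFun := fun x => I.mapQ I (L.bracket x) (fun y hy => hid x y hy)
       map_add' := fun x x' => by
        refine Submodule.linearMap_qext _ (LinearMap.ext fun y => ?_)
        simp
       map_smul' := fun c x => by
        refine Submodule.linearMap_qext _ (LinearMap.ext fun y => ?_)
        simp } : L →ₗ[ℂ] (L ⧸ I) →ₗ[ℂ] (L ⧸ I))
    (fun x hx => by
      rw [LinearMap.mem_ker]
      refine Submodule.linearMap_qext _ (LinearMap.ext fun y => ?_)
      simpa using L.bracket_mem_right_of_left hI hid x hx y)

/-- The quotient of a Lie superalgebra by a graded ideal. -/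
@[reducible] def quot (L : LieSuperalgebra.{u}) (I : Submodule ℂ L) (hI : L.IsGraded I)
    (hid : ∀ x, ∀ y ∈ I, L.bracket x y ∈ I) : LieSuperalgebra.{u} :=
  { L.toSuperSpace.quot I hI with
    bracket := L.quotBracket I hI hid
    bracket_mem := by
      rintro i j _ ⟨x, hx, rfl⟩ _ ⟨y, hy, rfl⟩
      exact ⟨L.bracket x y, L.bracket_mem i j x hx y hy, rfl⟩
    skew := by
      rintro i j _ ⟨x, hx, rfl⟩ _ ⟨y, hy, rfl⟩
      exact congrArg I.mkQ (L.skew i j x hx y hy)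
    jacobi := by
      rintro i j k _ ⟨x, hx, rfl⟩ _ ⟨y, hy, rfl⟩ _ ⟨z, hz, rfl⟩
      exact congrArg I.mkQ (L.jacobi i j k x hx y hy z hz) }

/-- The derived subspace `[L, L]`: the span of all brackets. -/
def derivedSpace (L : LieSuperalgebra.{u}) : Submodule ℂ L :=
  Submodule.span ℂ {z | ∃ x y, L.bracket x y = z}

lemma bracket_mem_derivedSpace (L : LieSuperalgebra.{u}) (x y : L) :
    L.bracket x y ∈ L.derivedSpace := Submodule.subset_span ⟨x, y, rfl⟩

lemma derivedSpace_isGraded (L : LieSuperalgebra.{u}) : L.IsGraded L.derivedSpace := by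
  refine SuperSpace.isGraded_of_comp_mem fun i z hz => ?_
  induction hz using Submodule.span_induction with
  | zero => simp
  | add a b _ _ ha hb => rw [map_add]; exact add_mem ha hb
  | smul c a _ ha => rw [map_smul]; exact Submodule.smul_mem _ _ ha
  | mem z hz =>
    obtain ⟨x, y, rfl⟩ := hz
    refine L.hom_induction (p := fun x => L.comp i (L.bracket x y) ∈ L.derivedSpace) x
      (fun j a ha => ?_) (fun a b ha hb => ?_)
    · refine L.hom_induction (p := fun y => L.comp i (L.bracket a y) ∈ L.derivedSpace) y
        (fun k b hb => ?_) (fun b c hb hc => ?_)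
      · have hab := L.bracket_mem j k a ha b hb
        by_cases h : i = j + k
        · subst h
          rw [L.comp_self hab]
          exact L.bracket_mem_derivedSpace a b
        · rw [L.comp_other h hab]
          exact zero_mem _
      · rw [map_add, map_add]; exact add_mem hb hc
    · rw [map_add, LinearMap.add_apply, map_add]; exact add_mem ha hb

/-- The derived subalgebra `[L, L]`. -/
def derived (L : LieSuperalgebra.{u}) : LieSuperalgebra.{u} :=
  L.sub L.derivedSpace L.derivedSpace_isGraded (fun x _ y _ => L.bracket_mem_derivedSpace x y)

/-- The componentwise bracket on a direct sum. -/
def prodBracket (L M : LieSuperalgebra.{u}) : (L × M) →ₗ[ℂ] (L × M) →ₗ[ℂ] (L × M) :=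
  LinearMap.mk₂ ℂ
    (fun x y : L × M => ((L.bracket x.1 y.1, M.bracket x.2 y.2) : L × M))
    (fun _ _ _ => by simp) (fun _ _ _ => by simp)
    (fun _ _ _ => by simp) (fun _ _ _ => by simp)

/-- The direct sum of two Lie superalgebras. -/
@[reducible] def prod (L M : LieSuperalgebra.{u}) : LieSuperalgebra.{u} :=
  { L.toSuperSpace.prod M.toSuperSpace with
    bracket := L.prodBracket M
    bracket_mem := fun i j x hx y hy =>
      ⟨L.bracket_mem i j x.1 hx.1 y.1 hy.1, M.bracket_mem i j x.2 hx.2 y.2 hy.2⟩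
    skew := fun i j x hx y hy =>
      Prod.ext (L.skew i j x.1 hx.1 y.1 hy.1) (M.skew i j x.2 hx.2 y.2 hy.2)
    jacobi := fun i j k x hx y hy z hz =>
      Prod.ext (L.jacobi i j k x.1 hx.1 y.1 hy.1 z.1 hz.1)
        (M.jacobi i j k x.2 hx.2 y.2 hy.2 z.2 hz.2) }

/-- The zero Lie superalgebra. -/
def zero : LieSuperalgebra.{u} :=
  { SuperSpace.zero.{u} with
    bracket := 0
    bracket_mem := fun _ _ _ _ _ _ => trivial
    skew := fun _ _ _ _ _ _ => rfl
    jacobi := fun _ _ _ _ _ _ _ _ _ => rfl }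

/-- The degree `i` part `L_i ⊗ A` of `L ⊗ A`. -/
def mapGr (L : LieSuperalgebra.{u}) (A : Type v) [CommRing A] [Algebra ℂ A] (i : ZMod 2) :
    Submodule ℂ (L ⊗[ℂ] A) :=
  Submodule.span ℂ {t | ∃ x ∈ L.gr i, ∃ a : A, x ⊗ₜ[ℂ] a = t}

/-- The map superalgebra `L ⊗ A` for a commutative algebra `A`:
`[x ⊗ a, y ⊗ b] = [x, y] ⊗ a b`, with degree `i` part `L_i ⊗ A`. -/
@[reducible] def mapAlg (L : LieSuperalgebra.{u}) (A : Type v) [CommRing A] [Algebra ℂ A] :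
    LieSuperalgebra.{max u v} where
  carrier := L ⊗[ℂ] A
  gr := L.mapGr A
  isCompl := by
    have hp : ∀ i, ∀ t ∈ L.mapGr A i,
        TensorProduct.map L.parity (LinearMap.id : A →ₗ[ℂ] A) t = sgn 1 i • t := by
      intro i t ht
      induction ht using Submodule.span_induction with
      | zero => simp
      | add a b _ _ ha hb => rw [map_add, ha, hb, smul_add]
      | smul c a _ ha => rw [map_smul, ha, smul_comm]
      | mem t ht =>
        obtain ⟨x, hx, a, rfl⟩ := ht
        rw [TensorProduct.map_tmul, L.parity_of_mem hx, LinearMap.id_apply,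
          TensorProduct.smul_tmul']
    constructor
    · rw [Submodule.disjoint_def]
      intro t h0 h1
      have e0 := hp 0 t h0
      have e1 := hp 1 t h1
      rw [e0] at e1
      simp only [sgn_zero_right, one_smul, sgn_one_one, neg_smul] at e1
      exact eq_zero_of_eq_neg e1
    · rw [codisjoint_iff, eq_top_iff]
      intro t _
      induction t using TensorProduct.induction_on with
      | zero => exact zero_mem _
      | add a b ha hb => exact add_mem (ha trivial) (hb trivial)
      | tmul x a =>
        rw [← L.comp_add_comp x, TensorProduct.add_tmul]
        exact Submodule.add_mem_sup (Submodule.subset_span ⟨_, L.comp_mem 0 x, a, rfl⟩)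
          (Submodule.subset_span ⟨_, L.comp_mem 1 x, a, rfl⟩)
  bracket := TensorProduct.map₂ L.bracket (LinearMap.mul ℂ A)
  bracket_mem := by
    intro i j x hx y hy
    induction hx using Submodule.span_induction with
    | zero => simp
    | add a b _ _ ha hb => rw [map_add, LinearMap.add_apply]; exact add_mem ha hb
    | smul c a _ ha => rw [map_smul, LinearMap.smul_apply]; exact Submodule.smul_mem _ _ ha
    | mem t ht =>
      obtain ⟨x, hx, a, rfl⟩ := ht
      induction hy using Submodule.span_induction with
      | zero => simp
      | add a b _ _ ha hb => rw [map_add]; exact add_mem ha hb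
      | smul c a _ ha => rw [map_smul]; exact Submodule.smul_mem _ _ ha
      | mem t ht =>
        obtain ⟨y, hy, b, rfl⟩ := ht
        exact Submodule.subset_span ⟨_, L.bracket_mem i j x hx y hy, a * b, by simp⟩
  skew := by
    intro i j x hx y hy
    induction hx using Submodule.span_induction with
    | zero => simp
    | add a b _ _ ha hb => simp only [map_add, LinearMap.add_apply, ha, hb, smul_add, neg_add]
    | smul c a _ ha => simp only [map_smul, LinearMap.smul_apply, ha, smul_neg, smul_comm c]
    | mem t ht =>
      obtain ⟨x, hx, a, rfl⟩ := ht
      induction hy using Submodule.span_induction with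
      | zero => simp
      | add a b _ _ ha hb => simp only [map_add, LinearMap.add_apply, ha, hb, smul_add, neg_add]
      | smul c a _ ha => simp only [map_smul, LinearMap.smul_apply, ha, smul_neg, smul_comm c]
      | mem t ht =>
        obtain ⟨y, hy, b, rfl⟩ := ht
        simp only [TensorProduct.map₂_apply_tmul, TensorProduct.map_tmul, LinearMap.mul_apply',
          L.skew i j x hx y hy, mul_comm b a, TensorProduct.neg_tmul, TensorProduct.smul_tmul']
  jacobi := by
    intro i j k x hx y hy z hz
    induction hx using Submodule.span_induction with
    | zero => simp
    | add a b _ _ ha hb => simp only [map_add, LinearMap.add_apply, ha, hb, smul_add]; abel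
    | smul c a _ ha =>
      simp only [map_smul, LinearMap.smul_apply, ha, smul_add, smul_comm c]
    | mem t ht =>
      obtain ⟨x, hx, a, rfl⟩ := ht
      induction hy using Submodule.span_induction with
      | zero => simp
      | add a b _ _ ha hb => simp only [map_add, LinearMap.add_apply, ha, hb, smul_add]; abel
      | smul c a _ ha =>
        simp only [map_smul, LinearMap.smul_apply, ha, smul_add, smul_comm c]
      | mem t ht =>
        obtain ⟨y, hy, b, rfl⟩ := ht
        induction hz using Submodule.span_induction with
        | zero => simp
        | add a b _ _ ha hb => simp only [map_add, ha, hb, smul_add]; abel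
        | smul c a _ ha => simp only [map_smul, ha, smul_add, smul_comm c]
        | mem t ht =>
          obtain ⟨z, hz, c, rfl⟩ := ht
          simp only [TensorProduct.map₂_apply_tmul, TensorProduct.map_tmul, LinearMap.mul_apply',
            L.jacobi i j k x hx y hy z hz, TensorProduct.add_tmul, TensorProduct.smul_tmul',
            mul_assoc, mul_left_comm b a c]

/-- Homomorphisms of Lie superalgebras. -/
structure Hom (L : LieSuperalgebra.{u}) (M : LieSuperalgebra.{v}) where
  toLin : L →ₗ[ℂ] M
  map_mem : ∀ i, ∀ x ∈ L.gr i, toLin x ∈ M.gr i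
  map_bracket : ∀ x y, toLin (L.bracket x y) = M.bracket (toLin x) (toLin y)

/-- The zero homomorphism. -/
def Hom.zero (L : LieSuperalgebra.{u}) (M : LieSuperalgebra.{v}) : Hom L M where
  toLin := 0
  map_mem := fun _ _ _ => zero_mem _
  map_bracket := fun _ _ => by simp

/-- `x ↦ (f x, g x)`. -/
def Hom.pair {L : LieSuperalgebra.{u}} {M N : LieSuperalgebra.{v}} (f : Hom L M) (g : Hom L N) :
    Hom L (M.prod N) where
  toLin := f.toLin.prod g.toLin
  map_mem := fun i x hx => ⟨f.map_mem i x hx, g.map_mem i x hx⟩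
  map_bracket := fun x y => Prod.ext (f.map_bracket x y) (g.map_bracket x y)

lemma map_mem_mapGr (L : LieSuperalgebra.{u}) {A B : Type v} [CommRing A] [Algebra ℂ A]
    [CommRing B] [Algebra ℂ B] (f : A →ₐ[ℂ] B) (i : ZMod 2) {t : L ⊗[ℂ] A}
    (ht : t ∈ L.mapGr A i) :
    TensorProduct.map LinearMap.id f.toLinearMap t ∈ L.mapGr B i := by
  induction ht using Submodule.span_induction with
  | zero => rw [map_zero]; exact zero_mem _
  | add a b _ _ ha hb => rw [map_add]; exact add_mem ha hb
  | smul c a _ ha => rw [map_smul]; exact Submodule.smul_mem _ _ ha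
  | mem t ht =>
    obtain ⟨x, hx, a, rfl⟩ := ht
    exact Submodule.subset_span ⟨x, hx, f a, by simp⟩

/-- The homomorphism `L ⊗ A → L ⊗ B` induced by an algebra homomorphism `A → B`. -/
def Hom.mapAlg (L : LieSuperalgebra.{u}) {A B : Type v} [CommRing A] [Algebra ℂ A] [CommRing B]
    [Algebra ℂ B] (f : A →ₐ[ℂ] B) : Hom (L.mapAlg A) (L.mapAlg B) where
  toLin := TensorProduct.map LinearMap.id f.toLinearMap
  map_mem := fun i _ hx => L.map_mem_mapGr f i hx
  map_bracket := by
    intro x y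
    change L ⊗[ℂ] A at x y
    change TensorProduct.map LinearMap.id f.toLinearMap
        (TensorProduct.map₂ L.bracket (LinearMap.mul ℂ A) x y) =
      TensorProduct.map₂ L.bracket (LinearMap.mul ℂ B)
        (TensorProduct.map LinearMap.id f.toLinearMap x)
        (TensorProduct.map LinearMap.id f.toLinearMap y)
    induction x using TensorProduct.induction_on with
    | zero => simp
    | add a b ha hb => simp only [map_add, LinearMap.add_apply, ha, hb]
    | tmul x a =>
      induction y using TensorProduct.induction_on with
      | zero => simp
      | add a b ha hb => simp only [map_add, ha, hb]
      | tmul y b => simp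

lemma contract_mem (L : LieSuperalgebra.{u}) {A : Type v} [CommRing A] [Algebra ℂ A]
    (χ : A →ₐ[ℂ] ℂ) (i : ZMod 2) {t : L ⊗[ℂ] A} (ht : t ∈ L.mapGr A i) :
    TensorProduct.rid ℂ L (TensorProduct.map LinearMap.id χ.toLinearMap t) ∈ L.gr i := by
  induction ht using Submodule.span_induction with
  | zero => rw [map_zero, map_zero]; exact zero_mem _
  | add a b _ _ ha hb => rw [map_add, map_add]; exact add_mem ha hb
  | smul c a _ ha => rw [map_smul, map_smul]; exact Submodule.smul_mem _ _ ha
  | mem t ht =>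
    obtain ⟨x, hx, a, rfl⟩ := ht
    simpa using Submodule.smul_mem _ (χ a) hx

/-- For an algebra homomorphism `χ : A → ℂ`, the homomorphism `L ⊗ A → L`, `x ⊗ a ↦ χ(a) x`. -/
def Hom.contract (L : LieSuperalgebra.{u}) {A : Type v} [CommRing A] [Algebra ℂ A]
    (χ : A →ₐ[ℂ] ℂ) : Hom (L.mapAlg A) L where
  toLin := (TensorProduct.rid ℂ L).toLinearMap ∘ₗ TensorProduct.map LinearMap.id χ.toLinearMap
  map_mem := fun i _ hx => L.contract_mem χ i hx
  map_bracket := by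
    intro x y
    change L ⊗[ℂ] A at x y
    change TensorProduct.rid ℂ L (TensorProduct.map LinearMap.id χ.toLinearMap
        (TensorProduct.map₂ L.bracket (LinearMap.mul ℂ A) x y)) =
      L.bracket (TensorProduct.rid ℂ L (TensorProduct.map LinearMap.id χ.toLinearMap x))
        (TensorProduct.rid ℂ L (TensorProduct.map LinearMap.id χ.toLinearMap y))
    induction x using TensorProduct.induction_on with
    | zero => simp
    | add a b ha hb => simp only [map_add, LinearMap.add_apply, ha, hb]
    | tmul x a =>
      induction y using TensorProduct.induction_on with
      | zero => simp
      | add a b ha hb => simp only [map_add, ha, hb]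
      | tmul y b => simp [smul_smul, mul_comm]

end LieSuperalgebra

/-! ### The queer Lie superalgebra -/

/-- The parity of an index of an `m|m` block matrix. -/
def idxParity {m : ℕ} : Fin m ⊕ Fin m → ZMod 2
  | Sum.inl _ => 0
  | Sum.inr _ => 1

/-- The grading of the block matrices `M(m|m)`: the diagonal blocks are even and the off-diagonal
blocks are odd. -/
def matGr (m : ℕ) (i : ZMod 2) : Submodule ℂ (Matrix (Fin m ⊕ Fin m) (Fin m ⊕ Fin m) ℂ) where
  carrier := {X | ∀ a b, idxParity a + idxParity b ≠ i → X a b = 0}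
  zero_mem' := fun _ _ _ => rfl
  add_mem' := fun hX hY a b h => by simp [hX a b h, hY a b h]
  smul_mem' := fun c X hX a b h => by simp [hX a b h]

lemma matGr_isCompl (m : ℕ) : IsCompl (matGr m 0) (matGr m 1) := by
  constructor
  · rw [Submodule.disjoint_def]
    intro X h0 h1
    ext a b
    rcases parity_cases (idxParity a + idxParity b) with h | h
    · exact h1 a b (by rw [h]; decide)
    · exact h0 a b (by rw [h]; decide)
  · rw [codisjoint_iff, eq_top_iff]
    intro X _
    refine Submodule.mem_sup.2
      ⟨Matrix.of fun a b => if idxParity a + idxParity b = 0 then X a b else 0, ?_,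
        Matrix.of fun a b => if idxParity a + idxParity b = 0 then 0 else X a b, ?_, ?_⟩
    · intro a b h; simp [h]
    · intro a b h
      have : idxParity a + idxParity b = 0 := (parity_cases _).resolve_right h
      simp [this]
    · ext a b
      by_cases h : idxParity a + idxParity b = 0 <;> simp [h]

/-- The general linear Lie superalgebra `gl(m|m)`. -/
def gl (m : ℕ) : LieSuperalgebra.{0} :=
  LieSuperalgebra.ofAssoc (Matrix (Fin m ⊕ Fin m) (Fin m ⊕ Fin m) ℂ) (matGr m) (matGr_isCompl m)
    (by
      intro i j X hX Y hY a c h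
      rw [Matrix.mul_apply]
      refine Finset.sum_eq_zero fun b _ => ?_
      by_cases h1 : idxParity a + idxParity b = i
      · by_cases h2 : idxParity b + idxParity c = j
        · refine absurd ?_ h
          rw [← h1, ← h2]
          generalize idxParity a = p
          generalize idxParity b = q
          generalize idxParity c = r
          revert p q r
          decide
        · rw [hY b c h2, mul_zero]
      · rw [hX a b h1, zero_mul])

/-- The block matrices of the form `[[X, Y], [Y, X]]`, that is, the subspace `Q(m)` of `M(m|m)`. -/
def queerSpace (m : ℕ) : Submodule ℂ (Matrix (Fin m ⊕ Fin m) (Fin m ⊕ Fin m) ℂ) where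
  carrier := {Z | ∃ X Y, Z = Matrix.fromBlocks X Y Y X}
  zero_mem' := ⟨0, 0, by simp⟩
  add_mem' := by
    rintro _ _ ⟨X, Y, rfl⟩ ⟨X', Y', rfl⟩
    exact ⟨X + X', Y + Y', by rw [Matrix.fromBlocks_add]⟩
  smul_mem' := by
    rintro c _ ⟨X, Y, rfl⟩
    exact ⟨c • X, c • Y, by rw [Matrix.fromBlocks_smul]⟩


lemma queerSpace_isGraded (m : ℕ) : (gl m).IsGraded (queerSpace m) := by
  refine le_antisymm (sup_le inf_le_left inf_le_left) ?_
  rintro _ ⟨X, Y, rfl⟩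
  refine Submodule.mem_sup.2 ⟨Matrix.fromBlocks X 0 0 X, ⟨⟨X, 0, rfl⟩, ?_⟩,
    Matrix.fromBlocks 0 Y Y 0, ⟨⟨0, Y, rfl⟩, ?_⟩, ?_⟩
  · rintro (a | a) (b | b) h <;> simp_all [idxParity]
  · rintro (a | a) (b | b) h <;> simp_all [idxParity]
  · exact (Matrix.fromBlocks_add _ _ _ _ _ _ _ _).trans (by simp)

lemma queerSpace_closed (m : ℕ) :
    ∀ x ∈ queerSpace m, ∀ y ∈ queerSpace m, (gl m).bracket x y ∈ queerSpace m := by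
  have hmul : ∀ x ∈ queerSpace m, ∀ y ∈ queerSpace m, x * y ∈ queerSpace m := by
    rintro _ ⟨X, Y, rfl⟩ _ ⟨X', Y', rfl⟩
    exact ⟨X * X' + Y * Y', X * Y' + Y * X', by
      rw [Matrix.fromBlocks_multiply, add_comm (Y * X'), add_comm (Y * Y')]⟩
  refine (gl m).bracket_closed_of_hom (queerSpace_isGraded m) ?_
  intro i j x hx y hy hxq hyq
  have e := LieSuperalgebra.assocBracket_of_mem _ (matGr m) (matGr_isCompl m) i j hx hy
  change LieSuperalgebra.assocBracket _ (matGr m) (matGr_isCompl m) x y ∈ queerSpace m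
  rw [e]
  exact sub_mem (hmul x hxq y hyq) (Submodule.smul_mem _ _ (hmul y hyq x hxq))

/-- The Lie superalgebra `q̂(n)` attached to the associative superalgebra `Q(n+1)`. -/
def qhat (n : ℕ) : LieSuperalgebra.{0} :=
  (gl (n + 1)).sub (queerSpace (n + 1)) (queerSpace_isGraded _) (queerSpace_closed _)

/-- The derived subalgebra `q̃(n) = [q̂(n), q̂(n)]`. -/
def qtilde (n : ℕ) : LieSuperalgebra.{0} := (qhat n).derived

/-- The underlying block matrix of an element of `q̃(n)`. -/
def qtildeMatrix (n : ℕ) :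
    qtilde n →ₗ[ℂ] Matrix (Fin (n + 1) ⊕ Fin (n + 1)) (Fin (n + 1) ⊕ Fin (n + 1)) ℂ :=
  (queerSpace (n + 1)).subtype ∘ₗ (qhat n).derivedSpace.subtype

/-- The subspace of `q̃(n)` of the scalar multiples of the identity matrix. -/
def scalars (n : ℕ) : Submodule ℂ (qtilde n) := (Submodule.span ℂ {1}).comap (qtildeMatrix n)

lemma mem_gr_zero_of_mem_scalars {n : ℕ} {z : qtilde n} (hz : z ∈ scalars n) :
    z ∈ (qtilde n).gr 0 := by
  obtain ⟨c, hc⟩ := Submodule.mem_span_singleton.1 (show qtildeMatrix n z ∈ _ from hz)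
  change qtildeMatrix n z ∈ matGr (n + 1) 0
  rw [← hc]
  intro a b h
  have hab : a ≠ b := by
    rintro rfl
    refine h ?_
    rcases parity_cases (idxParity a) with h | h <;> rw [h] <;> decide
  simp [Matrix.one_apply_ne hab]

lemma scalars_isGraded (n : ℕ) : (qtilde n).IsGraded (scalars n) := by
  refine SuperSpace.isGraded_of_comp_mem fun i z hz => ?_
  rcases parity_cases i with rfl | rfl
  · rw [(qtilde n).comp_self (mem_gr_zero_of_mem_scalars hz)]; exact hz
  · rw [(qtilde n).comp_other (by decide) (mem_gr_zero_of_mem_scalars hz)]; exact zero_mem _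

lemma scalars_ideal (n : ℕ) :
    ∀ x, ∀ y ∈ scalars n, (qtilde n).bracket x y ∈ scalars n := by
  intro x y hy
  refine (qtilde n).hom_induction (p := fun x => (qtilde n).bracket x y ∈ scalars n) x
    (fun i x hx => ?_) (fun a b ha hb => ?_)
  · have hy0 := mem_gr_zero_of_mem_scalars hy
    obtain ⟨c, hc⟩ := Submodule.mem_span_singleton.1 (show qtildeMatrix n y ∈ _ from hy)
    have e := LieSuperalgebra.assocBracket_of_mem _ (matGr (n + 1)) (matGr_isCompl (n + 1)) i 0
      (x := qtildeMatrix n x) (y := qtildeMatrix n y) hx hy0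
    change LieSuperalgebra.assocBracket _ (matGr (n + 1)) (matGr_isCompl (n + 1))
      (qtildeMatrix n x) (qtildeMatrix n y) ∈ Submodule.span ℂ {1}
    rw [e, ← hc]
    simp
  · rw [map_add, LinearMap.add_apply]; exact add_mem ha hb

/-- The queer Lie superalgebra `q(n) = q̃(n) / ℂ I`. -/
def q (n : ℕ) : LieSuperalgebra.{0} :=
  (qtilde n).quot (scalars n) (scalars_isGraded n) (scalars_ideal n)

/-! ### Representations -/

/-- A representation of a Lie superalgebra `L`, that is, an `L`-module: a super vector space with
an action such that `L_i V_j ⊆ V_{i+j}` and `[x, y] v = x (y v) - (-1)^(|x| |y|) y (x v)`. -/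
structure SuperRep (L : LieSuperalgebra.{u}) extends SuperSpace.{0} where
  act : L →ₗ[ℂ] Module.End ℂ carrier
  act_mem : ∀ i j, ∀ x ∈ L.gr i, ∀ v ∈ gr j, act x v ∈ gr (i + j)
  act_bracket : ∀ i j, ∀ x ∈ L.gr i, ∀ y ∈ L.gr j, ∀ v,
    act (L.bracket x y) v = act x (act y v) - sgn i j • act y (act x v)

instance (L : LieSuperalgebra.{u}) : CoeSort (SuperRep L) Type := ⟨fun V => V.carrier⟩

namespace SuperRep

variable {L : LieSuperalgebra.{u}}

/-- A submodule: a graded subspace stable under the action. -/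
def IsSubmodule (V : SuperRep L) (W : Submodule ℂ V) : Prop :=
  V.IsGraded W ∧ ∀ x : L, ∀ v ∈ W, V.act x v ∈ W

/-- Irreducibility: nonzero and without nonzero proper (graded) submodules. -/
def IsIrreducible (V : SuperRep L) : Prop :=
  Nontrivial V ∧ ∀ W : Submodule ℂ V, V.IsSubmodule W → W = ⊥ ∨ W = ⊤

/-- Isomorphism of modules: a linear bijection commuting with the action. It need not
be homogeneous. -/
def Iso (V W : SuperRep L) : Prop :=
  ∃ f : V ≃ₗ[ℂ] W, ∀ (x : L) (v : V), f (V.act x v) = W.act x (f v)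

instance isoSetoid (L : LieSuperalgebra.{u}) : Setoid (SuperRep L) where
  r := Iso
  iseqv :=
    { refl := fun V => ⟨LinearEquiv.refl ℂ V, fun _ _ => rfl⟩
      symm := fun {V W} ⟨f, hf⟩ => ⟨f.symm, fun x v => by
        rw [LinearEquiv.symm_apply_eq, hf, LinearEquiv.apply_symm_apply]⟩
      trans := fun {U V W} ⟨f, hf⟩ ⟨g, hg⟩ => ⟨f.trans g, fun x v => by
        rw [LinearEquiv.trans_apply, hf, hg, LinearEquiv.trans_apply]⟩ }

/-- A submodule as a representation. -/
@[reducible] def sub (V : SuperRep L) (W : Submodule ℂ V) (hW : V.IsSubmodule W) : SuperRep L :=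
  { V.toSuperSpace.sub W hW.1 with
    act :=
      { toFun := fun x => (V.act x).restrict (hW.2 x)
        map_add' := fun x y => LinearMap.ext fun v => Subtype.ext (by
          change V.act (x + y) v.1 = V.act x v.1 + V.act y v.1
          rw [map_add, LinearMap.add_apply])
        map_smul' := fun c x => LinearMap.ext fun v => Subtype.ext (by
          change V.act (c • x) v.1 = c • V.act x v.1
          rw [map_smul, LinearMap.smul_apply]) }
    act_mem := fun i j x hx v hv => V.act_mem i j x hx v.1 hv
    act_bracket := fun i j x hx y hy v => Subtype.ext (V.act_bracket i j x hx y hy v.1) }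

/-- The pullback of a representation along a homomorphism of Lie superalgebras. -/
@[reducible] def pullback {M : LieSuperalgebra.{v}} (V : SuperRep M) (f : LieSuperalgebra.Hom L M) :
    SuperRep L :=
  { V.toSuperSpace with
    act := V.act ∘ₗ f.toLin
    act_mem := fun i j x hx v hv => V.act_mem i j _ (f.map_mem i x hx) v hv
    act_bracket := fun i j x hx y hy v => by
      rw [LinearMap.comp_apply, f.map_bracket]
      exact V.act_bracket i j _ (f.map_mem i x hx) _ (f.map_mem j y hy) v }

/-- The trivial one-dimensional representation (with even underlying space). -/
@[reducible] def triv (L : LieSuperalgebra.{u}) : SuperRep L where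
  carrier := ℂ
  gr i := if i = 0 then ⊤ else ⊥
  isCompl := by simpa using isCompl_top_bot
  act := 0
  act_mem := fun _ _ _ _ _ _ => zero_mem _
  act_bracket := fun _ _ _ _ _ _ _ => by simp

section Tensor

variable {M : LieSuperalgebra.{u}}

/-- The action of `(x, y) ∈ L ⊕ M` on `V ⊗ W`:
`(x, y) (v ⊗ w) = x v ⊗ w + (-1)^(|y| |v|) v ⊗ y w` for homogeneous `y` and `v`. -/
def tensorAct (V : SuperRep L) (W : SuperRep M) :
    (L × M) →ₗ[ℂ] Module.End ℂ (V ⊗[ℂ] W) where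
  toFun x := TensorProduct.map (V.act x.1) LinearMap.id +
    TensorProduct.map LinearMap.id (W.act (M.comp 0 x.2)) +
    TensorProduct.map V.parity (W.act (M.comp 1 x.2))
  map_add' x y := by
    simp only [Prod.fst_add, Prod.snd_add, map_add, TensorProduct.map_add_left,
      TensorProduct.map_add_right]
    abel
  map_smul' c x := by
    simp only [Prod.smul_fst, Prod.smul_snd, map_smul, TensorProduct.map_smul_left,
      TensorProduct.map_smul_right, smul_add, RingHom.id_apply]

lemma tensorAct_tmul (V : SuperRep L) (W : SuperRep M) {i a : ZMod 2} {x : L × M} {v : V} {w : W}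
    (hx : x.2 ∈ M.gr i) (hv : v ∈ V.gr a) :
    tensorAct V W x (v ⊗ₜ w) = V.act x.1 v ⊗ₜ w + sgn i a • (v ⊗ₜ W.act x.2 w) := by
  change V.act x.1 v ⊗ₜ w + v ⊗ₜ W.act (M.comp 0 x.2) w + V.parity v ⊗ₜ W.act (M.comp 1 x.2) w = _
  rcases parity_cases i with rfl | rfl
  · rw [M.comp_self hx, M.comp_other (by decide) hx]
    simp
  · rw [M.comp_self hx, M.comp_other (by decide) hx, V.parity_of_mem hv]
    simp [TensorProduct.smul_tmul']

lemma tensor_ext (V W : SuperSpace.{0}) {P : Type} [AddCommGroup P] [Module ℂ P]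
    {f g : V ⊗[ℂ] W →ₗ[ℂ] P}
    (h : ∀ a, ∀ v ∈ V.gr a, ∀ w : W, f (v ⊗ₜ w) = g (v ⊗ₜ w)) : f = g := by
  refine TensorProduct.ext' fun v w => ?_
  refine V.hom_induction (p := fun v => f (v ⊗ₜ w) = g (v ⊗ₜ w)) v (fun a v hv => h a v hv w)
    (fun v v' hv hv' => ?_)
  rw [TensorProduct.add_tmul, map_add, map_add, hv, hv']

/-- The outer tensor product `V ⊗ W`, a module over `L ⊕ M`. -/
@[reducible] def tensor (V : SuperRep L) (W : SuperRep M) : SuperRep (L.prod M) :=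
  { V.toSuperSpace.tensor W.toSuperSpace with
    act := tensorAct V W
    act_mem := by
      intro i j x hx t ht
      change t ∈ SuperSpace.tensorGr V.toSuperSpace W.toSuperSpace j at ht
      change tensorAct V W x t ∈ SuperSpace.tensorGr V.toSuperSpace W.toSuperSpace (i + j)
      induction ht using Submodule.span_induction with
      | zero => rw [map_zero]; exact zero_mem _
      | add a b _ _ ha hb => rw [map_add]; exact add_mem ha hb
      | smul c a _ ha => rw [map_smul]; exact Submodule.smul_mem _ _ ha
      | mem t ht =>
        obtain ⟨a, b, rfl, v, hv, w, hw, rfl⟩ := ht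
        rw [tensorAct_tmul V W hx.2 hv]
        refine add_mem ?_ (Submodule.smul_mem _ _ ?_)
        · rw [← add_assoc]
          exact SuperSpace.tmul_mem_tensorGr (V.act_mem i a _ hx.1 v hv) hw
        · rw [add_left_comm]
          exact SuperSpace.tmul_mem_tensorGr hv (W.act_mem i b _ hx.2 w hw)
    act_bracket := by
      intro i j x hx y hy t
      have key : tensorAct V W ((L.prod M).bracket x y) =
          tensorAct V W x * tensorAct V W y - sgn i j • (tensorAct V W y * tensorAct V W x) := by
        refine tensor_ext V.toSuperSpace W.toSuperSpace fun a v hv w => ?_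
        rw [LinearMap.sub_apply, LinearMap.smul_apply, Module.End.mul_apply, Module.End.mul_apply,
          tensorAct_tmul V W hy.2 hv, tensorAct_tmul V W hx.2 hv,
          tensorAct_tmul V W ((L.prod M).bracket_mem i j x hx y hy).2 hv]
        change (V.act (L.bracket x.1 y.1) v) ⊗ₜ w +
          sgn (i + j) a • (v ⊗ₜ W.act (M.bracket x.2 y.2) w) = _
        rw [V.act_bracket i j _ hx.1 _ hy.1, W.act_bracket i j _ hx.2 _ hy.2]
        simp only [map_add, map_smul]
        rw [tensorAct_tmul V W hx.2 hv, tensorAct_tmul V W hy.2 hv,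
          tensorAct_tmul V W hx.2 (V.act_mem j a _ hy.1 v hv),
          tensorAct_tmul V W hy.2 (V.act_mem i a _ hx.1 v hv)]
        simp only [TensorProduct.sub_tmul, TensorProduct.tmul_sub, smul_add, smul_sub, smul_smul,
          TensorProduct.tmul_smul, ← TensorProduct.smul_tmul']
        rcases parity_cases i with rfl | rfl <;> rcases parity_cases j with rfl | rfl <;>
          rcases parity_cases a with rfl | rfl <;> simp <;> abel
      exact LinearMap.congr_fun key t }

/-- `φ` is an odd endomorphism of `V` that supercommutes with the action (`[φ, L] = 0`) and
satisfies `φ² = -1`. -/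
def IsOddSchur (V : SuperRep L) (φ : Module.End ℂ V) : Prop :=
  (∀ i, ∀ v ∈ V.gr i, φ v ∈ V.gr (i + 1)) ∧
  (∀ i, ∀ x ∈ L.gr i, ∀ v, φ (V.act x v) = sgn 1 i • V.act x (φ v)) ∧
  ∀ v, φ (φ v) = -v

/-- The endomorphism `(√-1 φ₁) ⊗ φ₂` of `V ⊗ W` for odd `φ₁`, `φ₂`; by the sign rule
`(f ⊗ g) (v ⊗ w) = (-1)^(|g| |v|) f v ⊗ g w`. -/
def twist (V : SuperRep L) (W : SuperRep M) (φ₁ : Module.End ℂ V) (φ₂ : Module.End ℂ W) :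
    Module.End ℂ (V ⊗[ℂ] W) :=
  TensorProduct.map (Complex.I • (φ₁ ∘ₗ V.parity)) φ₂

/-- The subspace of the `t ∈ V ⊗ W` with `((√-1 φ₁) ⊗ φ₂) t = t`. -/
def fixedSpace (V : SuperRep L) (W : SuperRep M) (φ₁ : Module.End ℂ V) (φ₂ : Module.End ℂ W) :
    Submodule ℂ (V ⊗[ℂ] W) :=
  LinearMap.eqLocus (twist V W φ₁ φ₂) LinearMap.id

lemma twist_tmul (V : SuperRep L) (W : SuperRep M) (φ₁ : Module.End ℂ V) (φ₂ : Module.End ℂ W)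
    {a : ZMod 2} {v : V} (hv : v ∈ V.gr a) (w : W) :
    twist V W φ₁ φ₂ (v ⊗ₜ w) = (Complex.I * sgn 1 a) • (φ₁ v ⊗ₜ φ₂ w) := by
  change (Complex.I • φ₁ (V.parity v)) ⊗ₜ φ₂ w = _
  rw [V.parity_of_mem hv, map_smul, smul_smul, TensorProduct.smul_tmul']

lemma isSubmodule_top (V : SuperRep L) : V.IsSubmodule ⊤ :=
  ⟨SuperSpace.isGraded_of_comp_mem fun _ _ _ => trivial, fun _ _ _ => trivial⟩

lemma fixedSpace_isSubmodule (V : SuperRep L) (W : SuperRep M) {φ₁ : Module.End ℂ V}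
    {φ₂ : Module.End ℂ W} (h₁ : V.IsOddSchur φ₁) (h₂ : W.IsOddSchur φ₂) :
    (V.tensor W).IsSubmodule (fixedSpace V W φ₁ φ₂) := by
  constructor
  · have hgr : ∀ k, ∀ t ∈ SuperSpace.tensorGr V.toSuperSpace W.toSuperSpace k,
        twist V W φ₁ φ₂ t ∈ SuperSpace.tensorGr V.toSuperSpace W.toSuperSpace k := by
      intro k t ht
      induction ht using Submodule.span_induction with
      | zero => rw [map_zero]; exact zero_mem _
      | add a b _ _ ha hb => rw [map_add]; exact add_mem ha hb
      | smul c a _ ha => rw [map_smul]; exact Submodule.smul_mem _ _ ha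
      | mem t ht =>
        obtain ⟨a, b, rfl, v, hv, w, hw, rfl⟩ := ht
        rw [twist_tmul V W φ₁ φ₂ hv]
        refine Submodule.smul_mem _ _ ?_
        have e : a + b = (a + 1) + (b + 1) := by
          rw [add_add_add_comm, one_add_one_zmod, add_zero]
        rw [e]
        exact SuperSpace.tmul_mem_tensorGr (h₁.1 a v hv) (h₂.1 b w hw)
    refine SuperSpace.isGraded_of_comp_mem fun i t ht => ?_
    have hc : twist V W φ₁ φ₂ ((V.tensor W).comp i t) =
        (V.tensor W).comp i (twist V W φ₁ φ₂ t) := by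
      refine (V.tensor W).hom_induction (p := fun t => twist V W φ₁ φ₂ ((V.tensor W).comp i t) =
        (V.tensor W).comp i (twist V W φ₁ φ₂ t)) t (fun j s hs => ?_) (fun s s' hs hs' => ?_)
      · by_cases hij : i = j
        · subst hij
          rw [(V.tensor W).comp_self hs, (V.tensor W).comp_self (hgr i s hs)]
        · rw [(V.tensor W).comp_other hij hs, (V.tensor W).comp_other hij (hgr j s hs)]
          exact map_zero _
      · rw [map_add]
        refine (map_add (twist V W φ₁ φ₂) _ _).trans ?_
        rw [hs, hs', ← map_add]
        exact congrArg _ (map_add (twist V W φ₁ φ₂) _ _).symm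
    have ht' : twist V W φ₁ φ₂ t = t := ht
    change twist V W φ₁ φ₂ ((V.tensor W).comp i t) = (V.tensor W).comp i t
    rw [hc, ht']
  · have key : ∀ i, ∀ x ∈ (L.prod M).gr i, twist V W φ₁ φ₂ * tensorAct V W x =
        tensorAct V W x * twist V W φ₁ φ₂ := by
      intro i x hx
      refine tensor_ext V.toSuperSpace W.toSuperSpace fun a v hv w => ?_
      rw [Module.End.mul_apply, Module.End.mul_apply, twist_tmul V W φ₁ φ₂ hv,
        tensorAct_tmul V W hx.2 hv, map_add, map_smul, map_smul,
        twist_tmul V W φ₁ φ₂ (V.act_mem i a _ hx.1 v hv), twist_tmul V W φ₁ φ₂ hv,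
        tensorAct_tmul V W hx.2 (h₁.1 a v hv), h₁.2.1 i _ hx.1, h₂.2.1 i _ hx.2]
      simp only [smul_add, smul_smul, TensorProduct.tmul_smul, ← TensorProduct.smul_tmul']
      rcases parity_cases i with rfl | rfl <;> rcases parity_cases a with rfl | rfl <;> simp
    intro x t ht
    have ht' : twist V W φ₁ φ₂ t = t := ht
    change twist V W φ₁ φ₂ (tensorAct V W x t) = tensorAct V W x t
    refine (L.prod M).hom_induction (p := fun x => twist V W φ₁ φ₂ (tensorAct V W x t) =
      tensorAct V W x t) x (fun i x hx => ?_) (fun x y hx hy => ?_)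
    · have := LinearMap.congr_fun (key i x hx) t
      rw [Module.End.mul_apply, Module.End.mul_apply, ht'] at this
      exact this
    · have e : tensorAct V W (x + y) = tensorAct V W x + tensorAct V W y := map_add _ _ _
      rw [e, LinearMap.add_apply, map_add, hx, hy]

open Classical in
/-- The subspace of `V ⊗ W` underlying the irreducible product: everything if `V ⊗ W` is
irreducible, and otherwise the fixed space of `(√-1 φ₁) ⊗ φ₂`, where `φ₁`, `φ₂` are odd
supercommuting endomorphisms of `V`, `W` of square `-1`. (For irreducible finite-dimensional
`V`, `W` with `V ⊗ W` not irreducible such `φ₁`, `φ₂` exist and are unique up to sign; in the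
remaining case the value is irrelevant.) -/
def irrProdSpace (V : SuperRep L) (W : SuperRep M) : Submodule ℂ (V ⊗[ℂ] W) :=
  if (V.tensor W).IsIrreducible then ⊤
  else if h : (∃ φ, V.IsOddSchur φ) ∧ ∃ φ, W.IsOddSchur φ then
    fixedSpace V W h.1.choose h.2.choose
  else ⊤

lemma irrProdSpace_isSubmodule (V : SuperRep L) (W : SuperRep M) :
    (V.tensor W).IsSubmodule (irrProdSpace V W) := by
  unfold irrProdSpace
  split_ifs with h1 h2
  · exact isSubmodule_top _
  · exact fixedSpace_isSubmodule V W h2.1.choose_spec h2.2.choose_spec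
  · exact isSubmodule_top _

/-- The irreducible product `V ⊗̂ W`, a module over `L ⊕ M`. -/
@[reducible] def irrProd (V : SuperRep L) (W : SuperRep M) : SuperRep (L.prod M) :=
  (V.tensor W).sub (irrProdSpace V W) (irrProdSpace_isSubmodule V W)

end Tensor

end SuperRep

/-- Isomorphism classes of representations of `L`. -/
def RepClass (L : LieSuperalgebra.{u}) : Type (max u 1) := Quotient (SuperRep.isoSetoid L)

/-- The isomorphism class of a representation. -/
def SuperRep.cls {L : LieSuperalgebra.{u}} (V : SuperRep L) : RepClass L := Quotient.mk _ V

/-- `V` is an irreducible finite-dimensional representation. -/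
def SuperRep.IsIrredFD {L : LieSuperalgebra.{u}} (V : SuperRep L) : Prop :=
  V.IsIrreducible ∧ FiniteDimensional ℂ V

/-- `R(L)`: isomorphism classes of irreducible finite-dimensional representations of `L`. -/
def IrrClass (L : LieSuperalgebra.{u}) : Type (max u 1) :=
  {c : RepClass L // ∃ V : SuperRep L, V.IsIrredFD ∧ V.cls = c}

/-- A representative of a class in `R(L)`. -/
def IrrClass.rep {L : LieSuperalgebra.{u}} (c : IrrClass L) : SuperRep L := c.2.choose

/-! ### Evaluation representations -/

section Evaluation

variable {A : Type v} [CommRing A] [Algebra ℂ A]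

lemma residue_bijective [Algebra.FiniteType ℂ A] (m : MaximalSpectrum A) :
    Function.Bijective (algebraMap ℂ (A ⧸ m.asIdeal)) := by
  let := Ideal.Quotient.field m.asIdeal
  have := finite_of_finite_type_of_isJacobsonRing ℂ (A ⧸ m.asIdeal)
  exact IsAlgClosed.algebraMap_bijective_of_isIntegral

/-- The isomorphism `A ⧸ m ≅ ℂ` for a maximal ideal `m` of a finitely generated algebra `A`. -/
def residueEquiv [Algebra.FiniteType ℂ A] (m : MaximalSpectrum A) : (A ⧸ m.asIdeal) ≃ₐ[ℂ] ℂ :=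
  (AlgEquiv.ofBijective (Algebra.ofId ℂ (A ⧸ m.asIdeal)) (residue_bijective m)).symm

variable (L : LieSuperalgebra.{0})

/-- The direct sum of the Lie superalgebras `L ⊗ A ⧸ m`, for `m` in the list. The list is read
from its end: the list `[m_k, …, m_1]` gives `(L ⊗ A/m_1 ⊕ ⋯) ⊕ L ⊗ A/m_k`. -/
def pointsAlg : List (MaximalSpectrum A) → LieSuperalgebra.{v}
  | [] => LieSuperalgebra.zero
  | [m] => L.mapAlg (A ⧸ m.asIdeal)
  | m :: m' :: l => (pointsAlg (m' :: l)).prod (L.mapAlg (A ⧸ m.asIdeal))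

/-- The evaluation map `L ⊗ A → ⨁ L ⊗ A ⧸ m`, `x ⊗ a ↦ (x ⊗ (a mod m))_m`. -/
def evHom : (l : List (MaximalSpectrum A)) → LieSuperalgebra.Hom (L.mapAlg A) (pointsAlg L l)
  | [] => LieSuperalgebra.Hom.zero _ _
  | [m] => LieSuperalgebra.Hom.mapAlg L (Ideal.Quotient.mkₐ ℂ m.asIdeal)
  | m :: m' :: l => (evHom (m' :: l)).pair
      (LieSuperalgebra.Hom.mapAlg L (Ideal.Quotient.mkₐ ℂ m.asIdeal))

variable {L} [Algebra.FiniteType ℂ A]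

/-- A representation of `L` as a representation of `L ⊗ A ⧸ m ≅ L`. -/
def pointRep (m : MaximalSpectrum A) (V : SuperRep L) : SuperRep (L.mapAlg (A ⧸ m.asIdeal)) :=
  V.pullback (LieSuperalgebra.Hom.contract L (residueEquiv m : (A ⧸ m.asIdeal) →ₐ[ℂ] ℂ))

/-- The iterated irreducible product of the modules `ρ m` over `L ⊗ A ⧸ m`: for the list
`[m_k, …, m_1]` it is `(ρ m_1 ⊗̂ ⋯ ⊗̂ ρ m_{k-1}) ⊗̂ ρ m_k`. -/
def pointsRep (ρ : MaximalSpectrum A → SuperRep L) :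
    (l : List (MaximalSpectrum A)) → SuperRep (pointsAlg L l)
  | [] => SuperRep.triv _
  | [m] => pointRep m (ρ m)
  | m :: m' :: l => (pointsRep ρ (m' :: l)).irrProd (pointRep m (ρ m))

/-- The module `êv_{m_1, …, m_k}(ρ m_1, …, ρ m_k)` over `L ⊗ A` (the trivial one-dimensional
module for the empty list). -/
def evModule (ρ : MaximalSpectrum A → SuperRep L) (l : List (MaximalSpectrum A)) :
    SuperRep (L.mapAlg A) :=
  (pointsRep ρ l).pullback (evHom L l)

end Evaluation

section FinSupp

/-- The support of a map `MaxSpec(A) → R(L)`: the points whose class is not that of the trivial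
one-dimensional representation. -/
def suppSet {L : LieSuperalgebra.{0}} {A : Type v} [CommRing A]
    (Ψ : MaximalSpectrum A → IrrClass L) : Set (MaximalSpectrum A) :=
  {m | (Ψ m).1 ≠ (SuperRep.triv L).cls}

/-- The set `E(L, A)` of finitely supported maps `MaxSpec(A) → R(L)`. -/
def FinSuppMap (L : LieSuperalgebra.{0}) (A : Type v) [CommRing A] : Type (max 1 v) :=
  {Ψ : MaximalSpectrum A → IrrClass L // (suppSet Ψ).Finite}

/-- The isomorphism class `êv_Ψ` of representations of `L ⊗ A`, formed with some enumeration of the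
support of `Ψ` and some representatives of the classes `Ψ m`. -/
def evHat {L : LieSuperalgebra.{0}} {A : Type v} [CommRing A] [Algebra ℂ A]
    [Algebra.FiniteType ℂ A] (Ψ : FinSuppMap L A) : RepClass (L.mapAlg A) :=
  (evModule (fun m => (Ψ.1 m).rep) Ψ.2.toFinset.toList).cls

end FinSupp

end Queer

end

/-! Well-definedness and irreducibility come from one description of the irreducible product,
injectivity from the Chinese remainder theorem.

Call an irreducible module of type Q if it has an odd supercommuting endomorphism of square -1, and
of type M otherwise. A subspace stable under the action, but not assumed graded, can fail to be
trivial only because of such an endomorphism (`IsIrreducible.eq_bot_or_eq_top_of_stable`). By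
Burnside's theorem the operators of the action generate `End V` in type M, and they do so in type Q
once the odd endomorphism is added. Hence V ⊗ W is irreducible as soon as one factor has type M. If
both have type Q, then V ⊗ W is the sum of the two eigenspaces of an involution; both are
irreducible, and an odd automorphism of the module V ⊗ W exchanges them. In every case V ⊗̂ W is an
irreducible direct summand of V ⊗ W, and V ⊗ W is generated by images of it. This is `IsIrrPart`,
established in `IsIrredFD.isIrrPart_irrProd`, and everything afterwards uses only this property.

By Schur's lemma an irreducible module receiving a nonzero homomorphism from V ⊗ W is then
isomorphic to V ⊗̂ W (`IsIrrPart.iso_of_ne_zero`). So the product depends only on the classes of its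
factors (`IsIrrPart.iso_congr`), and two consecutive factors may be exchanged
(`IsIrrPart.iso_swap`). Evaluation at distinct points is surjective (`evHom_surjective`), so these
facts pass to modules over L ⊗ A, and induction on the list of points (`isIrrPart_evModule_cons`)
gives irreducibility, independence of the representatives and independence of the order.

For injectivity, fix a point m and choose a in A congruent to 1 modulo m and lying in the other
relevant maximal ideals. The operators x ⊗ a see only the factor at m, so through them the
evaluation module is isotypic of type Ψ(m) (`isIsotypic_evHat`). Outside the support they act by
zero, which is isotypic of trivial type. Isomorphic modules have the same isotypic type
(`IsIsotypic.iso`), so the class of the module determines Ψ(m). -/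

namespace Queer

universe u v

/-! ### Linear algebra -/

/-- Burnside's theorem: a set of operators without common invariant subspaces generates the whole
endomorphism algebra. -/
lemma adjoin_eq_top_of_irreducible {V : Type*} [AddCommGroup V] [Module ℂ V] [FiniteDimensional ℂ V]
    [Nontrivial V] (s : Set (Module.End ℂ V))
    (h : ∀ U : Submodule ℂ V, (∀ f ∈ s, ∀ v ∈ U, f v ∈ U) → U = ⊥ ∨ U = ⊤) :
    Algebra.adjoin ℂ s = ⊤ := by
  set B := Algebra.adjoin ℂ s with hB
  have : IsSimpleModule B V := by
    refine { toIsSimpleOrder := { eq_bot_or_eq_top := fun W => ?_ } }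
    have hW := h (W.restrictScalars ℂ) fun f hf v hv =>
      W.smul_mem (⟨f, Algebra.subset_adjoin hf⟩ : B) hv
    rcases hW with hW | hW
    · left
      exact (Submodule.restrictScalars_eq_bot_iff ℂ _ _).1 hW
    · right
      exact (Submodule.restrictScalars_eq_top_iff ℂ _ _).1 hW
  have schur := (IsSimpleModule.algebraMap_end_bijective_of_isAlgClosed (A := B) (V := V) ℂ).2
  obtain ⟨t, ht⟩ := (inferInstance : Module.Finite ℂ V)
  rw [eq_top_iff]
  intro f _
  -- Density applies to maps linear over `Module.End B V`. By Schur's lemma that algebra consists of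
  -- scalars, so every complex-linear `f` qualifies.
  let F : Module.End (Module.End B V) V :=
    { toFun := f
      map_add' := map_add f
      map_smul' := fun g v => by
        obtain ⟨c, rfl⟩ := schur g
        exact map_smul f c v }
  obtain ⟨r, hr⟩ := jacobson_density F t
  have : f = r.1 := LinearMap.ext_on ht fun v hv => hr v hv
  rw [this]
  exact r.2

/-! ### Subspaces of a tensor product stable under endomorphisms of the first factor -/

section TensorStable

variable {V W : Type*} [AddCommGroup V] [Module ℂ V] [AddCommGroup W] [Module ℂ W]

/-- An element of `V ⊗ W` killed by all functionals on `W` is zero. -/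
lemma eq_zero_of_forall_dual_right {t : V ⊗[ℂ] W}
    (h : ∀ g : Module.Dual ℂ W, TensorProduct.rid ℂ V (TensorProduct.map LinearMap.id g t) = 0) :
    t = 0 := by
  classical
  let b := Module.Basis.ofVectorSpace ℂ W
  apply (TensorProduct.equivFinsuppOfBasisRight (M := V) b).injective
  rw [map_zero]
  ext i
  rw [Finsupp.zero_apply, ← h (b.coord i)]
  clear h
  induction t using TensorProduct.induction_on with
  | zero => simp
  | add a b ha hb => simp only [map_add, Finsupp.add_apply, ha, hb]
  | tmul x y => simp

/-- An element of `V ⊗ W` killed by all functionals on `V` is zero. -/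
lemma eq_zero_of_forall_dual_left {t : V ⊗[ℂ] W}
    (h : ∀ g : Module.Dual ℂ V, TensorProduct.lid ℂ W (TensorProduct.map g LinearMap.id t) = 0) :
    t = 0 := by
  apply (TensorProduct.comm ℂ V W).injective
  rw [map_zero]
  refine eq_zero_of_forall_dual_right fun g => ?_
  rw [← h g]
  clear h
  induction t using TensorProduct.induction_on with
  | zero => simp
  | add a b ha hb => simp only [map_add, ha, hb]
  | tmul x y => simp

/-- The subspace of the `w` with `V ⊗ w ⊆ S`. -/
def rightCore (S : Submodule ℂ (V ⊗[ℂ] W)) : Submodule ℂ W where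
  carrier := {w | ∀ v, v ⊗ₜ w ∈ S}
  zero_mem' v := by simp
  add_mem' ha hb v := by rw [TensorProduct.tmul_add]; exact add_mem (ha v) (hb v)
  smul_mem' c w hw v := by rw [TensorProduct.tmul_smul]; exact S.smul_mem c (hw v)

lemma eq_top_of_rightCore_eq_top {S : Submodule ℂ (V ⊗[ℂ] W)} (h : rightCore S = ⊤) : S = ⊤ := by
  rw [eq_top_iff]
  intro t _
  induction t using TensorProduct.induction_on with
  | zero => exact zero_mem _
  | add a b ha hb => exact add_mem (ha trivial) (hb trivial)
  | tmul x y => exact (show y ∈ rightCore S by rw [h]; trivial) x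

/-- A nonzero subspace of `V ⊗ W` stable under `End V` contains some `V ⊗ w` with `w ≠ 0`. -/
lemma rightCore_ne_bot {S : Submodule ℂ (V ⊗[ℂ] W)}
    (hS : ∀ f : Module.End ℂ V, ∀ t ∈ S, TensorProduct.map f LinearMap.id t ∈ S) (hne : S ≠ ⊥) :
    rightCore S ≠ ⊥ := by
  obtain ⟨t, ht, ht0⟩ := S.ne_bot_iff.1 hne
  obtain ⟨g, hg⟩ : ∃ g : Module.Dual ℂ V,
      TensorProduct.lid ℂ W (TensorProduct.map g LinearMap.id t) ≠ 0 := by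
    by_contra! hc
    exact ht0 (eq_zero_of_forall_dual_left hc)
  refine (Submodule.ne_bot_iff _).2 ⟨_, fun v => ?_, hg⟩
  -- The rank-one endomorphism `u ↦ g u • v` of the first factor turns `t` into a pure tensor with
  -- the prescribed left entry `v`.
  have e : v ⊗ₜ TensorProduct.lid ℂ W (TensorProduct.map g LinearMap.id t) =
      TensorProduct.map (g.smulRight v) LinearMap.id t := by
    clear ht ht0 hg
    induction t using TensorProduct.induction_on with
    | zero => simp
    | add a b ha hb => simp only [map_add, TensorProduct.tmul_add, ha, hb]
    | tmul x y => simp [TensorProduct.smul_tmul]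
  rw [e]
  exact hS _ t ht

/-- Stability under a generating set of operators on the first factor. -/
lemma stable_map_left_of_adjoin {S : Submodule ℂ (V ⊗[ℂ] W)} {s : Set (Module.End ℂ V)}
    (hs : Algebra.adjoin ℂ s = ⊤)
    (h : ∀ f ∈ s, ∀ t ∈ S, TensorProduct.map f LinearMap.id t ∈ S) (f : Module.End ℂ V) :
    ∀ t ∈ S, TensorProduct.map f LinearMap.id t ∈ S := by
  have hf : f ∈ Algebra.adjoin ℂ s := by rw [hs]; trivial
  induction hf using Algebra.adjoin_induction with
  | mem f hf => exact h f hf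
  | algebraMap c =>
    intro t ht
    have : TensorProduct.map (algebraMap ℂ (Module.End ℂ V) c) (LinearMap.id : W →ₗ[ℂ] W) =
        c • LinearMap.id := TensorProduct.ext' fun v w => by simp [TensorProduct.smul_tmul']
    rw [this]
    exact S.smul_mem c ht
  | add f g _ _ hf hg =>
    intro t ht
    rw [TensorProduct.map_add_left]
    exact add_mem (hf t ht) (hg t ht)
  | mul f g _ _ hf hg =>
    intro t ht
    have : TensorProduct.map (f * g) (LinearMap.id : W →ₗ[ℂ] W) t =
        TensorProduct.map f LinearMap.id (TensorProduct.map g LinearMap.id t) := by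
      rw [← LinearMap.comp_apply, ← TensorProduct.map_comp]
      rfl
    rw [this]
    exact hf _ (hg t ht)

end TensorStable

/-! ### The parity operator -/

lemma sgn_mul_sgn_self (i j : ZMod 2) : sgn i j * sgn i j = 1 := by
  rcases parity_cases i with rfl | rfl <;> rcases parity_cases j with rfl | rfl <;> simp

lemma sgn_add_right (i j k : ZMod 2) : sgn i (j + k) = sgn i j * sgn i k := by
  rcases parity_cases i with rfl | rfl <;> rcases parity_cases j with rfl | rfl <;>
    rcases parity_cases k with rfl | rfl <;> simp

lemma sgn_comm (i j : ZMod 2) : sgn i j = sgn j i := by simp [sgn, mul_comm]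

lemma sgn_add_left (i j k : ZMod 2) : sgn (i + j) k = sgn i k * sgn j k := by
  rw [sgn_comm, sgn_add_right, sgn_comm k i, sgn_comm k j]

namespace SuperSpace

variable (V : SuperSpace.{u})

lemma parity_parity (v : V) : V.parity (V.parity v) = v := by
  refine V.hom_induction (p := fun v => V.parity (V.parity v) = v) v (fun i v hv => ?_)
    (fun v w hv hw => by rw [map_add, map_add, hv, hw])
  rw [V.parity_of_mem hv, map_smul, V.parity_of_mem hv, smul_smul, sgn_mul_sgn_self, one_smul]

variable {V}

lemma comp_zero_eq (v : V) : V.comp 0 v = (2 : ℂ)⁻¹ • (v + V.parity v) := by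
  have hp : V.parity v = V.comp 0 v - V.comp 1 v := rfl
  nth_rewrite 2 [← V.comp_add_comp v]
  rw [hp, add_add_sub_cancel, ← two_smul ℂ, smul_smul]
  simp

lemma comp_one_eq (v : V) : V.comp 1 v = (2 : ℂ)⁻¹ • (v - V.parity v) := by
  have hp : V.parity v = V.comp 0 v - V.comp 1 v := rfl
  nth_rewrite 2 [← V.comp_add_comp v]
  rw [hp, add_sub_sub_cancel, ← two_smul ℂ, smul_smul]
  simp

/-- The grading is the eigenspace decomposition of the parity involution. Gradedness and homogeneity
can therefore be checked as relations with this one operator. -/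
lemma mem_gr_iff_parity {i : ZMod 2} {v : V} : v ∈ V.gr i ↔ V.parity v = sgn 1 i • v := by
  refine ⟨V.parity_of_mem, fun h => ?_⟩
  have hs := V.comp_add_comp v
  rcases parity_cases i with rfl | rfl
  · rw [comp_one_eq, h] at hs
    simp only [sgn_zero_right, one_smul, sub_self, smul_zero, add_zero] at hs
    rw [← hs]; exact V.comp_mem 0 v
  · rw [comp_zero_eq, h] at hs
    simp only [sgn_one_one, neg_smul, one_smul, add_neg_cancel, smul_zero, zero_add] at hs
    rw [← hs]; exact V.comp_mem 1 v

lemma isGraded_iff_parity {W : Submodule ℂ V} : V.IsGraded W ↔ ∀ v ∈ W, V.parity v ∈ W := by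
  constructor
  · intro hW v hv
    exact sub_mem (hW.comp_mem 0 hv) (hW.comp_mem 1 hv)
  · intro h
    refine isGraded_of_comp_mem fun i v hv => ?_
    rcases parity_cases i with rfl | rfl
    · rw [comp_zero_eq]; exact W.smul_mem _ (add_mem hv (h v hv))
    · rw [comp_one_eq]; exact W.smul_mem _ (sub_mem hv (h v hv))

lemma parity_tensor_eq (V : SuperSpace.{u}) (W : SuperSpace.{v}) :
    (V.tensor W).parity = TensorProduct.map V.parity W.parity := by
  refine LinearMap.ext fun t => ?_
  refine (V.tensor W).hom_induction
    (p := fun t => (V.tensor W).parity t = TensorProduct.map V.parity W.parity t) t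
    (fun i t ht => ?_) (fun s t hs ht => ?_)
  · rw [(V.tensor W).parity_of_mem ht, parity_tensor i ht]
  · rw [map_add, hs, ht]; exact (map_add (TensorProduct.map V.parity W.parity) s t).symm

lemma parity_sub (V : SuperSpace.{u}) (W : Submodule ℂ V) (hW : V.IsGraded W) (w : W) :
    ((V.sub W hW).parity w).1 = V.parity w.1 := by
  refine (V.sub W hW).hom_induction (p := fun w => ((V.sub W hW).parity w).1 = V.parity w.1) w
    (fun i w hw => ?_) (fun s t hs ht => ?_)
  · rw [(V.sub W hW).parity_of_mem hw, V.parity_of_mem (v := w.1) hw]; rfl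
  · rw [map_add]
    refine Eq.trans ?_ (map_add V.parity s.1 t.1).symm
    rw [← hs, ← ht]; rfl

end SuperSpace

/-! ### Homomorphisms and Schur's lemma -/

namespace SuperRep

variable {L : LieSuperalgebra.{u}}

/-- A linear map, not necessarily homogeneous, that commutes with the action. -/
def IsHom (V W : SuperRep L) (f : V →ₗ[ℂ] W) : Prop :=
  ∀ (x : L) (v : V), f (V.act x v) = W.act x (f v)

/-- `f` commutes with the parity operators up to the factor `ε`. -/
def IsHomog (V W : SuperSpace.{0}) (ε : ℂ) (f : V →ₗ[ℂ] W) : Prop :=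
  ∀ v, W.parity (f v) = ε • f (V.parity v)

lemma isHom_of_homogeneous {V W : SuperRep L} {f : V →ₗ[ℂ] W}
    (h : ∀ i, ∀ x ∈ L.gr i, ∀ v, f (V.act x v) = W.act x (f v)) : V.IsHom W f := fun x v => by
  refine L.hom_induction (p := fun x => f (V.act x v) = W.act x (f v)) x
    (fun i x hx => h i x hx v) (fun x y hx hy => ?_)
  rw [map_add, map_add, LinearMap.add_apply, LinearMap.add_apply, map_add, hx, hy]

lemma IsHom.comp {U V W : SuperRep L} {g : V →ₗ[ℂ] W} {f : U →ₗ[ℂ] V} (hg : V.IsHom W g)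
    (hf : U.IsHom V f) : U.IsHom W (g ∘ₗ f) := fun x v => by
  rw [LinearMap.comp_apply, hf, hg, LinearMap.comp_apply]

lemma IsHom.symm {V W : SuperRep L} {e : V ≃ₗ[ℂ] W} (h : V.IsHom W e) :
    W.IsHom V (e.symm : W →ₗ[ℂ] V) := fun x w => by
  have := h x (e.symm w)
  rw [LinearEquiv.coe_coe, e.apply_symm_apply] at this
  rw [LinearEquiv.coe_coe, ← this, e.symm_apply_apply]

lemma parity_act (V : SuperRep L) {i : ZMod 2} {x : L} (hx : x ∈ L.gr i) (v : V) :
    V.parity (V.act x v) = sgn 1 i • V.act x (V.parity v) := by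
  refine V.hom_induction (p := fun v => V.parity (V.act x v) = sgn 1 i • V.act x (V.parity v)) v
    (fun j v hv => ?_) (fun v w hv hw => ?_)
  · rw [V.parity_of_mem (V.act_mem i j x hx v hv), V.parity_of_mem hv, map_smul, smul_smul,
      sgn_add_right]
  · simp only [map_add, smul_add, hv, hw]

lemma isSubmodule_of {V : SuperRep L} {W : Submodule ℂ V} (hp : ∀ v ∈ W, V.parity v ∈ W)
    (h : ∀ i, ∀ x ∈ L.gr i, ∀ v ∈ W, V.act x v ∈ W) : V.IsSubmodule W := by
  refine ⟨SuperSpace.isGraded_iff_parity.2 hp, fun x v hv => ?_⟩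
  refine L.hom_induction (p := fun x => V.act x v ∈ W) x
    (fun i x hx => h i x hx v hv) (fun x y hx hy => ?_)
  rw [map_add]
  exact add_mem hx hy

/-- Parity commutes with the action of `x` up to a sign, and the two signs cancel. The even and odd
parts of a homomorphism are therefore again homomorphisms, commuting with the action without signs.
-/
lemma IsHom.conj_parity {V W : SuperRep L} {f : V →ₗ[ℂ] W} (hf : V.IsHom W f) :
    V.IsHom W (W.parity ∘ₗ f ∘ₗ V.parity) := by
  refine isHom_of_homogeneous fun i x hx v => ?_
  simp only [LinearMap.comp_apply]
  rw [V.parity_act hx, map_smul, map_smul, hf, W.parity_act hx, smul_smul, sgn_mul_sgn_self,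
    one_smul]

lemma IsHom.add_conj_parity {V W : SuperRep L} {f : V →ₗ[ℂ] W} (hf : V.IsHom W f) :
    V.IsHom W (f + W.parity ∘ₗ f ∘ₗ V.parity) ∧
      IsHomog V.toSuperSpace W.toSuperSpace 1 (f + W.parity ∘ₗ f ∘ₗ V.parity) := by
  refine ⟨fun x v => ?_, fun v => ?_⟩
  · rw [LinearMap.add_apply, LinearMap.add_apply, hf, hf.conj_parity, map_add]
  · simp only [LinearMap.add_apply, LinearMap.comp_apply, map_add, V.parity_parity,
      W.parity_parity]
    rw [one_smul, add_comm]

lemma IsHom.sub_conj_parity {V W : SuperRep L} {f : V →ₗ[ℂ] W} (hf : V.IsHom W f) :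
    V.IsHom W (f - W.parity ∘ₗ f ∘ₗ V.parity) ∧
      IsHomog V.toSuperSpace W.toSuperSpace (-1) (f - W.parity ∘ₗ f ∘ₗ V.parity) := by
  refine ⟨fun x v => ?_, fun v => ?_⟩
  · rw [LinearMap.sub_apply, LinearMap.sub_apply, hf, hf.conj_parity, map_sub]
  · simp only [LinearMap.sub_apply, LinearMap.comp_apply, map_sub, V.parity_parity,
      W.parity_parity]
    rw [neg_one_smul, neg_sub]

/-- A subspace containing the images of all homogeneous homomorphisms contains those of all
homomorphisms. -/
lemma IsHom.mem_of_homog {V W : SuperRep L} {U : Submodule ℂ W}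
    (h : ∀ (g : V →ₗ[ℂ] W) (ε : ℂ), (ε = 1 ∨ ε = -1) → V.IsHom W g →
      IsHomog V.toSuperSpace W.toSuperSpace ε g → ∀ v, g v ∈ U)
    {f : V →ₗ[ℂ] W} (hf : V.IsHom W f) (v : V) : f v ∈ U := by
  have e : f v = (2 : ℂ)⁻¹ • ((f + W.parity ∘ₗ f ∘ₗ V.parity) v +
      (f - W.parity ∘ₗ f ∘ₗ V.parity) v) := by
    rw [LinearMap.add_apply, LinearMap.sub_apply, add_add_sub_cancel, ← two_smul ℂ, smul_smul]
    simp
  rw [e]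
  exact U.smul_mem _ (add_mem
    (h _ 1 (Or.inl rfl) hf.add_conj_parity.1 hf.add_conj_parity.2 v)
    (h _ (-1) (Or.inr rfl) hf.sub_conj_parity.1 hf.sub_conj_parity.2 v))

/-- A nonzero homomorphism has a nonzero homogeneous component. -/
lemma IsHom.exists_homog {V W : SuperRep L} {f : V →ₗ[ℂ] W} (hf : V.IsHom W f) (h0 : f ≠ 0) :
    ∃ (g : V →ₗ[ℂ] W) (ε : ℂ), (ε = 1 ∨ ε = -1) ∧ V.IsHom W g ∧
      IsHomog V.toSuperSpace W.toSuperSpace ε g ∧ g ≠ 0 := by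
  by_contra! hc
  refine h0 (LinearMap.ext fun v => (Submodule.mem_bot ℂ).1 (hf.mem_of_homog (fun g ε hε hg hp v =>
    (Submodule.mem_bot ℂ).2 ?_) v))
  rw [hc g ε hε hg hp, LinearMap.zero_apply]

/-- Homogeneity is what makes the kernel graded; without it irreducibility, which concerns graded
submodules only, would say nothing. -/
lemma ker_isSubmodule {V W : SuperRep L} {f : V →ₗ[ℂ] W} (hf : V.IsHom W f) {ε : ℂ} (hε : ε ≠ 0)
    (hp : IsHomog V.toSuperSpace W.toSuperSpace ε f) : V.IsSubmodule (LinearMap.ker f) := by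
  refine isSubmodule_of (fun v hv => ?_) (fun _ x _ v hv => ?_)
  · rw [LinearMap.mem_ker] at hv ⊢
    have := hp v
    rw [hv, map_zero] at this
    exact (smul_eq_zero.1 this.symm).resolve_left hε
  · rw [LinearMap.mem_ker] at hv ⊢
    rw [hf, hv, map_zero]

lemma range_isSubmodule {V W : SuperRep L} {f : V →ₗ[ℂ] W} (hf : V.IsHom W f) {ε : ℂ}
    (hp : IsHomog V.toSuperSpace W.toSuperSpace ε f) : W.IsSubmodule (LinearMap.range f) := by
  refine isSubmodule_of ?_ ?_
  · rintro _ ⟨v, rfl⟩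
    exact ⟨ε • V.parity v, by rw [map_smul, hp]⟩
  · rintro _ x _ _ ⟨v, rfl⟩
    exact ⟨V.act x v, hf x v⟩

lemma ne_zero_of_sign {ε : ℂ} (h : ε = 1 ∨ ε = -1) : ε ≠ 0 := by
  rcases h with rfl | rfl <;> simp

/-- **Schur's lemma**: a nonzero homomorphism between irreducible modules gives a homogeneous
isomorphism. -/
lemma IsIrreducible.exists_equiv {V W : SuperRep L} (hV : V.IsIrreducible) (hW : W.IsIrreducible)
    {f : V →ₗ[ℂ] W} (hf : V.IsHom W f) (h0 : f ≠ 0) :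
    ∃ (e : V ≃ₗ[ℂ] W) (ε : ℂ), (ε = 1 ∨ ε = -1) ∧ V.IsHom W e ∧
      IsHomog V.toSuperSpace W.toSuperSpace ε (e : V →ₗ[ℂ] W) := by
  obtain ⟨g, ε, hε, hg, hp, hg0⟩ := hf.exists_homog h0
  have hinj : Function.Injective g := by
    rcases hV.2 _ (ker_isSubmodule hg (ne_zero_of_sign hε) hp) with h | h
    · exact LinearMap.ker_eq_bot.1 h
    · exact absurd (LinearMap.ker_eq_top.1 h) hg0
  have hsurj : Function.Surjective g := by
    rcases hW.2 _ (range_isSubmodule hg hp) with h | h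
    · exact absurd (LinearMap.range_eq_bot.1 h) hg0
    · exact LinearMap.range_eq_top.1 h
  exact ⟨LinearEquiv.ofBijective g ⟨hinj, hsurj⟩, ε, hε, hg, hp⟩

lemma IsIrreducible.iso_of_ne_zero {V W : SuperRep L} (hV : V.IsIrreducible) (hW : W.IsIrreducible)
    {f : V →ₗ[ℂ] W} (hf : V.IsHom W f) (h0 : f ≠ 0) : V.Iso W := by
  obtain ⟨e, _, _, he, _⟩ := hV.exists_equiv hW hf h0
  exact ⟨e, he⟩

/-- An even endomorphism of an irreducible module is a scalar. -/
lemma IsIrreducible.even_end_scalar {V : SuperRep L} (hV : V.IsIrreducible)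
    [FiniteDimensional ℂ V] {f : V →ₗ[ℂ] V} (hf : V.IsHom V f)
    (hp : IsHomog V.toSuperSpace V.toSuperSpace 1 f) : ∃ c : ℂ, ∀ v, f v = c • v := by
  have := hV.1
  obtain ⟨c, hc⟩ := Module.End.exists_eigenvalue (f : Module.End ℂ V)
  refine ⟨c, fun v => ?_⟩
  -- The eigenspace is graded because `f` commutes with parity.
  have hs : V.IsSubmodule (Module.End.eigenspace (f : Module.End ℂ V) c) := by
    refine isSubmodule_of (fun v hv => ?_) (fun _ x _ v hv => ?_)
    · rw [Module.End.mem_eigenspace_iff] at hv ⊢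
      have := hp v
      rw [one_smul] at this
      rw [← this, hv, map_smul]
    · rw [Module.End.mem_eigenspace_iff] at hv ⊢
      rw [hf, hv, map_smul]
  rcases hV.2 _ hs with h | h
  · exact absurd h hc
  · exact Module.End.mem_eigenspace_iff.1 (by rw [h]; trivial)

lemma IsOddSchur.parity {V : SuperRep L} {φ : Module.End ℂ V} (h : V.IsOddSchur φ) (v : V) :
    V.parity (φ v) = -φ (V.parity v) := by
  refine V.hom_induction (p := fun v => V.parity (φ v) = -φ (V.parity v)) v
    (fun i v hv => ?_) (fun v w hv hw => ?_)
  · rw [V.parity_of_mem (h.1 i v hv), V.parity_of_mem hv, map_smul, sgn_add_right, sgn_one_one]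
    simp
  · simp only [map_add, hv, hw, neg_add]

lemma isOddSchur_of {V : SuperRep L} {φ : Module.End ℂ V}
    (hp : ∀ v, V.parity (φ v) = -φ (V.parity v))
    (ha : ∀ i, ∀ x ∈ L.gr i, ∀ v, φ (V.act x v) = sgn 1 i • V.act x (φ v))
    (hs : ∀ v, φ (φ v) = -v) : V.IsOddSchur φ := by
  refine ⟨fun i v hv => SuperSpace.mem_gr_iff_parity.2 ?_, ha, hs⟩
  rw [hp, V.parity_of_mem hv, map_smul, sgn_add_right, sgn_one_one]
  simp

/-- Odd supercommuting endomorphisms of square `-1` are proportional. -/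
lemma IsIrreducible.oddSchur_unique {V : SuperRep L} (hV : V.IsIrreducible)
    [FiniteDimensional ℂ V] {φ ψ : Module.End ℂ V} (hφ : V.IsOddSchur φ) (hψ : V.IsOddSchur ψ) :
    ∃ c : ℂ, ∀ v, ψ v = c • φ v := by
  -- Two odd supercommuting maps compose to an even commuting one, hence to a scalar; `φ² = -1` then
  -- lets `φ` be cancelled.
  have hc : V.IsHom V (ψ ∘ₗ φ) := isHom_of_homogeneous fun i x hx v => by
    rw [LinearMap.comp_apply, hφ.2.1 i x hx, map_smul, hψ.2.1 i x hx, smul_smul, sgn_mul_sgn_self,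
      one_smul, LinearMap.comp_apply]
  obtain ⟨c, h⟩ := hV.even_end_scalar hc fun v => by
    rw [LinearMap.comp_apply, hψ.parity, hφ.parity, map_neg, neg_neg, one_smul,
      LinearMap.comp_apply]
  refine ⟨-c, fun v => ?_⟩
  have := h (φ v)
  rw [LinearMap.comp_apply, hφ.2.2, map_neg] at this
  rw [neg_smul, ← this, neg_neg]

/-- An irreducible module has no proper subspace that is stable under the action and under all odd
supercommuting endomorphisms of square `-1`. -/
lemma IsIrreducible.eq_bot_or_eq_top_of_stable {V : SuperRep L} (hV : V.IsIrreducible)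
    {U : Submodule ℂ V} (hU : ∀ x, ∀ v ∈ U, V.act x v ∈ U)
    (hφ : ∀ φ, V.IsOddSchur φ → ∀ v ∈ U, φ v ∈ U) : U = ⊥ ∨ U = ⊤ := by
  -- Parity is an involution, so this is the image of `U` under parity. The intersection and the sum
  -- of `U` and `U'` are graded submodules, hence trivial.
  set U' := U.comap V.parity with hU'
  have memU' : ∀ v, v ∈ U' ↔ V.parity v ∈ U := fun _ => Iff.rfl
  have hPU : ∀ v ∈ U, V.parity v ∈ U' := fun v hv => by rwa [memU', V.parity_parity]
  have hact : ∀ i, ∀ x ∈ L.gr i, ∀ v ∈ U', V.act x v ∈ U' := fun i x hx v hv => by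
    rw [memU', V.parity_act hx]
    exact U.smul_mem _ (hU x _ hv)
  have hinf : V.IsSubmodule (U ⊓ U') :=
    isSubmodule_of (fun v hv => ⟨hv.2, hPU v hv.1⟩) fun i x hx v hv =>
      ⟨hU x v hv.1, hact i x hx v hv.2⟩
  have hsup : V.IsSubmodule (U ⊔ U') := by
    refine isSubmodule_of (fun v hv => ?_) fun i x hx v hv => ?_
    · obtain ⟨a, ha, b, hb, rfl⟩ := Submodule.mem_sup.1 hv
      rw [map_add, add_comm]
      exact Submodule.add_mem_sup hb (hPU a ha)
    · obtain ⟨a, ha, b, hb, rfl⟩ := Submodule.mem_sup.1 hv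
      rw [map_add]
      exact Submodule.add_mem_sup (hU x a ha) (hact i x hx b hb)
  rcases hV.2 _ hinf with h1 | h1
  swap
  · right
    exact top_le_iff.1 (h1 ▸ inf_le_left)
  rcases hV.2 _ hsup with h2 | h2
  · left
    exact le_bot_iff.1 (h2 ▸ le_sup_left)
  left
  have hc : IsCompl U U' := ⟨disjoint_iff.2 h1, codisjoint_iff.2 h2⟩
  -- In the remaining case `V = U ⊕ U'`. The map equal to 1 on `U` and -1 on `U'` commutes with the
  -- action and anticommutes with parity, so its composite with parity is an odd supercommuting
  -- endomorphism of square -1.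
  let ψ : Module.End ℂ V := U.projection U' hc - U'.projection U hc.symm
  have ψ1 : ∀ v ∈ U, ψ v = v := fun v hv => by
    simp [ψ, Submodule.projection_apply_of_mem_left hc hv,
      (Submodule.projection_apply_eq_zero_iff hc.symm).2 hv]
  have ψ2 : ∀ v ∈ U', ψ v = -v := fun v hv => by
    simp [ψ, Submodule.projection_apply_of_mem_left hc.symm hv,
      (Submodule.projection_apply_eq_zero_iff hc).2 hv]
  have ind : ∀ {p : V → Prop}, (∀ v ∈ U, p v) → (∀ v ∈ U', p v) →
      (∀ v w, p v → p w → p (v + w)) → ∀ v, p v := fun {p} h1' h2' h3 v => by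
    obtain ⟨a, ha, b, hb, rfl⟩ := Submodule.mem_sup.1 (show v ∈ U ⊔ U' by rw [h2]; trivial)
    exact h3 _ _ (h1' a ha) (h2' b hb)
  have ψψ : ∀ v, ψ (ψ v) = v := ind (fun v hv => by rw [ψ1 v hv, ψ1 v hv])
    (fun v hv => by rw [ψ2 v hv, map_neg, ψ2 v hv, neg_neg])
    (fun v w hv hw => by rw [map_add, map_add, hv, hw])
  have ψP : ∀ v, V.parity (ψ v) = -ψ (V.parity v) := ind
    (fun v hv => by rw [ψ1 v hv, ψ2 _ (hPU v hv), neg_neg])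
    (fun v hv => by rw [ψ2 v hv, ψ1 _ hv, map_neg])
    (fun v w hv hw => by simp only [map_add, hv, hw, neg_add])
  have ψx : ∀ i, ∀ x ∈ L.gr i, ∀ v, ψ (V.act x v) = V.act x (ψ v) := fun i x hx => ind
    (fun v hv => by rw [ψ1 v hv, ψ1 _ (hU x v hv)])
    (fun v hv => by rw [ψ2 v hv, ψ2 _ (hact i x hx v hv), map_neg])
    (fun v w hv hw => by simp only [map_add, hv, hw])
  have hs : V.IsOddSchur (ψ ∘ₗ V.parity) := by
    refine isOddSchur_of (fun v => ?_) (fun i x hx v => ?_) (fun v => ?_)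
    · simp only [LinearMap.comp_apply, ψP]
    · simp only [LinearMap.comp_apply]
      rw [V.parity_act hx, map_smul, ψx i x hx]
    · simp only [LinearMap.comp_apply]
      rw [ψP, V.parity_parity, map_neg, ψψ]
  rw [eq_bot_iff, ← h1]
  intro v hv
  -- The odd endomorphism just built carries `U` into `U'`, yet by hypothesis it preserves `U`;
  -- since `U` and `U'` meet in zero, `U` vanishes.
  refine ⟨hv, ?_⟩
  have := hφ _ hs v hv
  rw [LinearMap.comp_apply, ψ2 _ (hPU v hv)] at this
  exact (memU' v).2 (by simpa using neg_mem this)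

/-- In type M the stability condition under odd endomorphisms is vacuous, so even ungraded invariant
subspaces are trivial and Burnside's theorem applies. -/
lemma IsIrreducible.adjoin_act_eq_top {V : SuperRep L} (hV : V.IsIrreducible)
    [FiniteDimensional ℂ V] (h : ¬ ∃ φ, V.IsOddSchur φ) :
    Algebra.adjoin ℂ {f | ∃ i, ∃ x ∈ L.gr i, V.act x = f} = ⊤ := by
  have := hV.1
  refine adjoin_eq_top_of_irreducible _ fun U hU => hV.eq_bot_or_eq_top_of_stable
    (fun x v hv => ?_) (fun φ hφ => absurd ⟨φ, hφ⟩ h)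
  rw [← L.comp_add_comp x, map_add]
  exact add_mem (hU _ ⟨0, _, L.comp_mem 0 x, rfl⟩ v hv) (hU _ ⟨1, _, L.comp_mem 1 x, rfl⟩ v hv)

/-- In type Q any two odd supercommuting endomorphisms of square -1 are proportional, so adding a
single one to the action rules out all proper invariant subspaces. -/
lemma IsIrreducible.adjoin_act_oddSchur_eq_top {V : SuperRep L} (hV : V.IsIrreducible)
    [FiniteDimensional ℂ V] {φ : Module.End ℂ V} (h : V.IsOddSchur φ) :
    Algebra.adjoin ℂ (insert φ {f | ∃ i, ∃ x ∈ L.gr i, V.act x = f}) = ⊤ := by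
  have := hV.1
  refine adjoin_eq_top_of_irreducible _ fun U hU => hV.eq_bot_or_eq_top_of_stable
    (fun x v hv => ?_) (fun ψ hψ v hv => ?_)
  · rw [← L.comp_add_comp x, map_add]
    exact add_mem (hU _ (Or.inr ⟨0, _, L.comp_mem 0 x, rfl⟩) v hv)
      (hU _ (Or.inr ⟨1, _, L.comp_mem 1 x, rfl⟩) v hv)
  · obtain ⟨c, hc⟩ := hV.oddSchur_unique h hψ
    rw [hc]
    exact U.smul_mem _ (hU φ (Or.inl rfl) v hv)

end SuperRep

/-! ### Irreducible constituents of outer tensor products -/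

namespace SuperRep

variable {L M : LieSuperalgebra.{u}}

lemma tensorAct_left (V : SuperRep L) (W : SuperRep M) (x : L) :
    tensorAct V W (x, 0) = TensorProduct.map (V.act x) LinearMap.id := by
  change TensorProduct.map (V.act x) LinearMap.id +
    TensorProduct.map LinearMap.id (W.act (M.comp 0 0)) +
    TensorProduct.map V.parity (W.act (M.comp 1 0)) = _
  simp

lemma tensorAct_right_even (V : SuperRep L) (W : SuperRep M) {y : M} (hy : y ∈ M.gr 0) :
    tensorAct V W (0, y) = TensorProduct.map LinearMap.id (W.act y) := by
  change TensorProduct.map (V.act 0) LinearMap.id +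
    TensorProduct.map LinearMap.id (W.act (M.comp 0 y)) +
    TensorProduct.map V.parity (W.act (M.comp 1 y)) = _
  rw [M.comp_self hy, M.comp_other (by decide) hy]
  simp

lemma tensorAct_right_odd (V : SuperRep L) (W : SuperRep M) {y : M} (hy : y ∈ M.gr 1) :
    tensorAct V W (0, y) = TensorProduct.map V.parity (W.act y) := by
  change TensorProduct.map (V.act 0) LinearMap.id +
    TensorProduct.map LinearMap.id (W.act (M.comp 0 y)) +
    TensorProduct.map V.parity (W.act (M.comp 1 y)) = _
  rw [M.comp_self hy, M.comp_other (by decide) hy]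
  simp

lemma IsSubmodule.parity_tensor_mem {V : SuperRep L} {W : SuperRep M} {S : Submodule ℂ (V ⊗[ℂ] W)}
    (hS : (V.tensor W).IsSubmodule S) {t : V ⊗[ℂ] W} (ht : t ∈ S) :
    TensorProduct.map V.parity W.parity t ∈ S := by
  have := SuperSpace.isGraded_iff_parity.1 hS.1 t ht
  rwa [SuperSpace.parity_tensor_eq] at this

/-- A nonzero submodule of `V ⊗ W` stable under all endomorphisms of `V` is everything. -/
lemma IsIrreducible.tensor_eq_top_of_stable {V : SuperRep L} {W : SuperRep M}
    (hW : W.IsIrreducible) {S : Submodule ℂ (V ⊗[ℂ] W)} (hS : (V.tensor W).IsSubmodule S)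
    (hst : ∀ f : Module.End ℂ V, ∀ t ∈ S, TensorProduct.map f LinearMap.id t ∈ S)
    (hne : S ≠ ⊥) : S = ⊤ := by
  have hc : W.IsSubmodule (rightCore S) := by
    refine isSubmodule_of (fun w hw v => ?_) (fun i y hy w hw v => ?_)
    · have := hS.parity_tensor_mem (hw (V.parity v))
      rwa [TensorProduct.map_tmul, V.parity_parity] at this
    · rcases parity_cases i with rfl | rfl
      · have h : tensorAct V W (0, y) (v ⊗ₜ w) ∈ S := hS.2 (0, y) _ (hw v)
        rwa [tensorAct_right_even V W hy] at h
      -- An odd `y` applies parity to the first factor; starting from `V.parity v` undoes this.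
      · have h : tensorAct V W (0, y) (V.parity v ⊗ₜ w) ∈ S := hS.2 (0, y) _ (hw _)
        rwa [tensorAct_right_odd V W hy, TensorProduct.map_tmul, V.parity_parity] at h
  rcases hW.2 _ hc with h | h
  · exact absurd h (rightCore_ne_bot hst hne)
  · exact eq_top_of_rightCore_eq_top h

lemma nontrivial_tensor {V : SuperRep L} {W : SuperRep M} (hV : V.IsIrreducible)
    (hW : W.IsIrreducible) : Nontrivial (V ⊗[ℂ] W) := by
  have := hV.1
  have := hW.1
  infer_instance

/-- The elements `(x, 0)` act by `x ⊗ 1`, and in type M these operators generate all `f ⊗ 1`. -/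
lemma IsIrreducible.tensor_of_left {V : SuperRep L} {W : SuperRep M} (hV : V.IsIrreducible)
    (hW : W.IsIrreducible) [FiniteDimensional ℂ V] (h : ¬ ∃ φ, V.IsOddSchur φ) :
    (V.tensor W).IsIrreducible := by
  refine ⟨nontrivial_tensor hV hW, fun S hS => or_iff_not_imp_left.2 fun hne => ?_⟩
  refine hW.tensor_eq_top_of_stable hS (stable_map_left_of_adjoin (hV.adjoin_act_eq_top h) ?_) hne
  rintro _ ⟨i, x, hx, rfl⟩ t ht
  have := hS.2 (x, 0) t ht
  rwa [← tensorAct_left]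

/-- The braiding `w ⊗ v ↦ (-1)^(|v| |w|) v ⊗ w`. -/
noncomputable def braiding (V : SuperSpace.{0}) (W : SuperSpace.{0}) : W ⊗[ℂ] V →ₗ[ℂ] V ⊗[ℂ] W :=
  (TensorProduct.map (V.comp 0) LinearMap.id + TensorProduct.map (V.comp 1) W.parity) ∘ₗ
    (TensorProduct.comm ℂ W V).toLinearMap

lemma braiding_tmul (V : SuperSpace.{0}) (W : SuperSpace.{0}) {a b : ZMod 2} {v : V} {w : W}
    (hv : v ∈ V.gr a) (hw : w ∈ W.gr b) : braiding V W (w ⊗ₜ v) = sgn a b • (v ⊗ₜ w) := by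
  change V.comp 0 v ⊗ₜ w + V.comp 1 v ⊗ₜ W.parity w = _
  rcases parity_cases a with rfl | rfl
  · rw [V.comp_self hv, V.comp_other (by decide) hv]; simp
  · rw [V.comp_self hv, V.comp_other (by decide) hv, W.parity_of_mem hw]; simp

lemma tensor_ext_homog (V W : SuperSpace.{0}) {P : Type} [AddCommGroup P] [Module ℂ P]
    {f g : V ⊗[ℂ] W →ₗ[ℂ] P}
    (h : ∀ a b, ∀ v ∈ V.gr a, ∀ w ∈ W.gr b, f (v ⊗ₜ w) = g (v ⊗ₜ w)) : f = g := by
  refine tensor_ext V W fun a v hv w => ?_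
  refine W.hom_induction (p := fun w => f (v ⊗ₜ w) = g (v ⊗ₜ w)) w (fun b w hw => h a b v hv w hw)
    (fun w w' hw hw' => ?_)
  rw [TensorProduct.tmul_add, map_add, map_add, hw, hw']

lemma braiding_parity (V W : SuperSpace.{0}) (t : W ⊗[ℂ] V) :
    TensorProduct.map V.parity W.parity (braiding V W t) =
      braiding V W (TensorProduct.map W.parity V.parity t) := by
  refine LinearMap.congr_fun (f := TensorProduct.map V.parity W.parity ∘ₗ braiding V W)
    (g := braiding V W ∘ₗ TensorProduct.map W.parity V.parity) ?_ t
  refine tensor_ext_homog _ _ fun b a w hw v hv => ?_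
  rw [LinearMap.comp_apply, LinearMap.comp_apply, TensorProduct.map_tmul, W.parity_of_mem hw,
    V.parity_of_mem hv, braiding_tmul V W hv hw, map_smul, TensorProduct.map_tmul,
    W.parity_of_mem hw, V.parity_of_mem hv, TensorProduct.smul_tmul_smul,
    TensorProduct.smul_tmul_smul, map_smul, braiding_tmul V W hv hw, smul_comm, mul_comm]

lemma braiding_braiding (V W : SuperSpace.{0}) (t : V ⊗[ℂ] W) :
    braiding V W (braiding W V t) = t := by
  refine LinearMap.congr_fun (f := braiding V W ∘ₗ braiding W V) (g := LinearMap.id) ?_ t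
  refine tensor_ext_homog _ _ fun b a w hw v hv => ?_
  rw [LinearMap.comp_apply, braiding_tmul W V hv hw, map_smul, braiding_tmul V W hw hv, smul_smul,
    sgn_comm a b, sgn_mul_sgn_self, one_smul, LinearMap.id_apply]

lemma braiding_surjective (V W : SuperSpace.{0}) : Function.Surjective (braiding V W) :=
  fun t => ⟨_, braiding_braiding V W t⟩

lemma braiding_injective (V W : SuperSpace.{0}) : Function.Injective (braiding V W) :=
  Function.LeftInverse.injective (braiding_braiding W V)

/-- The Koszul sign of the braiding compensates exactly for the sign picked up by whichever algebra
acts on the second factor. -/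
lemma braiding_act (V : SuperRep L) (W : SuperRep M) {i : ZMod 2} {x : L} {y : M} (hx : x ∈ L.gr i)
    (hy : y ∈ M.gr i) (t : W ⊗[ℂ] V) :
    braiding V.toSuperSpace W.toSuperSpace (tensorAct W V (y, x) t) =
      tensorAct V W (x, y) (braiding V.toSuperSpace W.toSuperSpace t) := by
  refine LinearMap.congr_fun
    (f := braiding V.toSuperSpace W.toSuperSpace ∘ₗ tensorAct W V (y, x))
    (g := tensorAct V W (x, y) ∘ₗ braiding V.toSuperSpace W.toSuperSpace) ?_ t
  refine tensor_ext_homog _ _ fun b a w hw v hv => ?_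
  rw [LinearMap.comp_apply, LinearMap.comp_apply, tensorAct_tmul W V (i := i) hx hw,
    braiding_tmul _ _ hv hw, map_add, map_smul, map_smul,
    braiding_tmul _ _ hv (W.act_mem i b y hy w hw), braiding_tmul _ _ (V.act_mem i a x hx v hv) hw,
    tensorAct_tmul V W (i := i) hy hv, smul_add, smul_smul, smul_smul, add_comm]
  congr 2
  · rw [sgn_add_left, ← mul_assoc, sgn_mul_sgn_self, one_mul]
  · rw [sgn_add_right, sgn_comm a i, mul_comm]

/-- The braiding carries submodules to submodules, which reduces this to the case where the first
factor has type M. -/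
lemma IsIrreducible.tensor_of_right {V : SuperRep L} {W : SuperRep M} (hV : V.IsIrreducible)
    (hW : W.IsIrreducible) [FiniteDimensional ℂ W] (h : ¬ ∃ φ, W.IsOddSchur φ) :
    (V.tensor W).IsIrreducible := by
  refine ⟨nontrivial_tensor hV hW, fun S hS => ?_⟩
  have hsurj := braiding_surjective V.toSuperSpace W.toSuperSpace
  set θ := braiding V.toSuperSpace W.toSuperSpace with hθ
  have hT : (W.tensor V).IsSubmodule (S.comap θ) := by
    refine isSubmodule_of (fun t ht => ?_) (fun i x hx t ht => ?_)
    · rw [SuperSpace.parity_tensor_eq]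
      rw [Submodule.mem_comap, hθ, ← braiding_parity]
      exact hS.parity_tensor_mem ht
    · change θ (tensorAct W V x t) ∈ S
      rw [hθ, braiding_act V W (i := i) hx.2 hx.1]
      exact hS.2 (x.2, x.1) _ ht
  rcases (hW.tensor_of_left hV h).2 _ hT with h' | h'
  · left
    rw [eq_bot_iff]
    intro s hs
    obtain ⟨t, rfl⟩ := hsurj s
    have : t ∈ (⊥ : Submodule ℂ (W ⊗[ℂ] V)) := by rw [← h']; exact hs
    rw [(Submodule.mem_bot ℂ).1 this, map_zero]
    exact zero_mem _
  · right
    rw [eq_top_iff]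
    intro s _
    obtain ⟨t, rfl⟩ := hsurj s
    exact (show t ∈ S.comap θ by rw [h']; trivial)

/-- `N` is an irreducible finite-dimensional direct summand of `T`, and `T` is a sum of
homomorphic images of `N`. -/
structure IsIrrPart (T N : SuperRep L) : Prop where
  irrFD : N.IsIrredFD
  exists_surj : ∃ p : T →ₗ[ℂ] N, T.IsHom N p ∧ Function.Surjective p
  exists_inj : ∃ i : N →ₗ[ℂ] T, N.IsHom T i ∧ Function.Injective i
  generates : ∀ U : Submodule ℂ T,
    (∀ f : N →ₗ[ℂ] T, N.IsHom T f → ∀ n, f n ∈ U) → U = ⊤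

lemma subtype_isHom (T : SuperRep L) (F : Submodule ℂ T) (hF : T.IsSubmodule F) :
    (T.sub F hF).IsHom T F.subtype := fun _ _ => rfl

lemma isIrreducible_sub {T : SuperRep L} {F : Submodule ℂ T} (hF : T.IsSubmodule F) (h0 : F ≠ ⊥)
    (h : ∀ S ≤ F, T.IsSubmodule S → S ≠ ⊥ → F ≤ S) : (T.sub F hF).IsIrreducible := by
  refine ⟨Submodule.nontrivial_iff_ne_bot.2 h0, fun S hS => or_iff_not_imp_left.2 fun hne => ?_⟩
  have hsub : T.IsSubmodule (S.map F.subtype) := by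
    refine isSubmodule_of ?_ ?_
    · rintro _ ⟨s, hs, rfl⟩
      exact ⟨_, SuperSpace.isGraded_iff_parity.1 hS.1 s hs, SuperSpace.parity_sub _ _ hF.1 s⟩
    · rintro i x _ _ ⟨s, hs, rfl⟩
      exact ⟨_, hS.2 x s hs, rfl⟩
  have hle := h _ (Submodule.map_subtype_le F S) hsub fun h' => hne
    (Submodule.map_injective_of_injective F.injective_subtype (h'.trans (Submodule.map_bot _).symm))
  rw [eq_top_iff]
  intro s _
  obtain ⟨s', hs', e⟩ := hle s.2
  rwa [← show s' = s from Subtype.ext e]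

lemma IsIrreducible.isIrrPart_sub_top {T : SuperRep L} (hT : T.IsIrreducible)
    [FiniteDimensional ℂ T] {F : Submodule ℂ T} (hF : T.IsSubmodule F) (h : F = ⊤) :
    T.IsIrrPart (T.sub F hF) where
  irrFD := by
    refine ⟨isIrreducible_sub hF ?_ fun S _ hS hne => ?_, inferInstanceAs (FiniteDimensional ℂ F)⟩
    · have := hT.1
      rw [h]
      exact top_ne_bot
    · rw [(hT.2 S hS).resolve_left hne]
      exact le_top
  exists_surj := ⟨LinearMap.codRestrict F LinearMap.id fun t => by rw [h]; trivial,
    fun _ _ => rfl, fun t => ⟨t.1, rfl⟩⟩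
  exists_inj := ⟨F.subtype, subtype_isHom T F hF, F.injective_subtype⟩
  generates U hU := by
    rw [eq_top_iff]
    intro t _
    exact hU F.subtype (subtype_isHom T F hF) ⟨t, by rw [h]; trivial⟩

/-! ### Tensor products of two modules of type Q -/

section TypeQ

variable {V : SuperRep L} {W : SuperRep M} {φ₁ : Module.End ℂ V} {φ₂ : Module.End ℂ W}

/-- The endomorphism `(φ₁ ⊗ 1) (P ⊗ P)` of `V ⊗ W`, where `P` is the parity operator. -/
noncomputable def flipEnd (V : SuperRep L) (W : SuperRep M) (φ₁ : Module.End ℂ V) : Module.End ℂ (V ⊗[ℂ] W) :=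
  TensorProduct.map (φ₁ ∘ₗ V.parity) W.parity

lemma flipEnd_flipEnd (h₁ : V.IsOddSchur φ₁) (t : V ⊗[ℂ] W) :
    flipEnd V W φ₁ (flipEnd V W φ₁ t) = t := by
  induction t using TensorProduct.induction_on with
  | zero => simp
  | add a b ha hb => rw [map_add, map_add, ha, hb]
  | tmul v w =>
    simp only [flipEnd, TensorProduct.map_tmul, LinearMap.comp_apply]
    rw [h₁.parity, map_neg, h₁.2.2, V.parity_parity, W.parity_parity, neg_neg]

lemma twist_twist (h₁ : V.IsOddSchur φ₁) (h₂ : W.IsOddSchur φ₂) (t : V ⊗[ℂ] W) :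
    twist V W φ₁ φ₂ (twist V W φ₁ φ₂ t) = t := by
  induction t using TensorProduct.induction_on with
  | zero => simp
  | add a b ha hb => rw [map_add, map_add, ha, hb]
  | tmul v w =>
    simp only [twist, TensorProduct.map_tmul, LinearMap.comp_apply, LinearMap.smul_apply]
    rw [map_smul, h₁.parity, map_smul, map_neg, h₁.2.2, V.parity_parity, h₂.2.2, smul_smul,
      Complex.I_mul_I, TensorProduct.tmul_neg]
    simp [TensorProduct.neg_tmul]

/-- Since `φ₂` is odd it anticommutes with the parity of `W`. Consequently `flipEnd` exchanges the
eigenspaces of the twist for 1 and -1. -/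
lemma twist_flipEnd (h₂ : W.IsOddSchur φ₂) (t : V ⊗[ℂ] W) :
    twist V W φ₁ φ₂ (flipEnd V W φ₁ t) = -flipEnd V W φ₁ (twist V W φ₁ φ₂ t) := by
  induction t using TensorProduct.induction_on with
  | zero => simp
  | add a b ha hb => simp only [map_add, ha, hb, neg_add]
  | tmul v w =>
    simp only [twist, flipEnd, TensorProduct.map_tmul, LinearMap.comp_apply, LinearMap.smul_apply]
    rw [map_smul, map_smul, h₂.parity, TensorProduct.tmul_neg, neg_neg]

/-- `φ₁ ⊗ 1` supercommutes with the action; composing with total parity removes the signs and leaves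
an odd map that commutes with it. -/
lemma flipEnd_isHom (h₁ : V.IsOddSchur φ₁) :
    (V.tensor W).IsHom (V.tensor W) (flipEnd V W φ₁) := by
  refine isHom_of_homogeneous fun i x hx t => ?_
  change flipEnd V W φ₁ (tensorAct V W x t) = tensorAct V W x (flipEnd V W φ₁ t)
  refine LinearMap.congr_fun (f := flipEnd V W φ₁ ∘ₗ tensorAct V W x)
    (g := tensorAct V W x ∘ₗ flipEnd V W φ₁) ?_ t
  refine tensor_ext V.toSuperSpace W.toSuperSpace fun a v hv w => ?_
  have hψ : φ₁ (V.parity v) ∈ V.gr (a + 1) := h₁.1 a _ (by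
    rw [V.parity_of_mem hv]; exact Submodule.smul_mem _ _ hv)
  rw [LinearMap.comp_apply, LinearMap.comp_apply, tensorAct_tmul V W hx.2 hv, map_add, map_smul]
  simp only [flipEnd, TensorProduct.map_tmul, LinearMap.comp_apply]
  rw [tensorAct_tmul V W hx.2 hψ, V.parity_act hx.1, map_smul, h₁.2.1 i _ hx.1,
    smul_smul, sgn_mul_sgn_self, one_smul, W.parity_act hx.2, TensorProduct.tmul_smul, smul_smul,
    sgn_add_right, sgn_comm i 1]

lemma twist_isHom (h₁ : V.IsOddSchur φ₁) (h₂ : W.IsOddSchur φ₂) :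
    (V.tensor W).IsHom (V.tensor W) (twist V W φ₁ φ₂) := by
  refine isHom_of_homogeneous fun i x hx t => ?_
  change twist V W φ₁ φ₂ (tensorAct V W x t) = tensorAct V W x (twist V W φ₁ φ₂ t)
  refine LinearMap.congr_fun (f := twist V W φ₁ φ₂ ∘ₗ tensorAct V W x)
    (g := tensorAct V W x ∘ₗ twist V W φ₁ φ₂) ?_ t
  refine tensor_ext V.toSuperSpace W.toSuperSpace fun a v hv w => ?_
  rw [LinearMap.comp_apply, LinearMap.comp_apply, tensorAct_tmul V W hx.2 hv, map_add, map_smul,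
    twist_tmul _ _ _ _ hv, twist_tmul _ _ _ _ hv, twist_tmul _ _ _ _ (V.act_mem i a _ hx.1 v hv),
    map_smul, tensorAct_tmul V W hx.2 (h₁.1 a v hv), h₁.2.1 i _ hx.1, h₂.2.1 i _ hx.2,
    TensorProduct.smul_tmul', TensorProduct.tmul_smul]
  simp only [smul_add, smul_smul, ← TensorProduct.smul_tmul']
  congr 2
  · rw [sgn_add_right, mul_assoc, mul_right_comm (sgn 1 i), sgn_mul_sgn_self, one_mul]
  · rw [sgn_add_right, sgn_comm i 1]
    ring

lemma map_left_eq_flipEnd (φ₁ : Module.End ℂ V) (t : V ⊗[ℂ] W) :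
    TensorProduct.map φ₁ LinearMap.id t =
      flipEnd V W φ₁ (TensorProduct.map V.parity W.parity t) := by
  refine LinearMap.congr_fun (f := TensorProduct.map φ₁ LinearMap.id)
    (g := flipEnd V W φ₁ ∘ₗ TensorProduct.map V.parity W.parity)
    (TensorProduct.ext' fun v w => ?_) t
  rw [LinearMap.comp_apply, TensorProduct.map_tmul, TensorProduct.map_tmul, flipEnd,
    TensorProduct.map_tmul, LinearMap.comp_apply, V.parity_parity, W.parity_parity,
    LinearMap.id_apply]

lemma parity_flipEnd (h₁ : V.IsOddSchur φ₁) (t : V ⊗[ℂ] W) :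
    TensorProduct.map V.parity W.parity (flipEnd V W φ₁ t) =
      -flipEnd V W φ₁ (TensorProduct.map V.parity W.parity t) := by
  refine LinearMap.congr_fun (f := TensorProduct.map V.parity W.parity ∘ₗ flipEnd V W φ₁)
    (g := -(flipEnd V W φ₁ ∘ₗ TensorProduct.map V.parity W.parity))
    (TensorProduct.ext' fun v w => ?_) t
  rw [LinearMap.neg_apply, LinearMap.comp_apply, LinearMap.comp_apply,
    TensorProduct.map_tmul, flipEnd, TensorProduct.map_tmul, TensorProduct.map_tmul,
    LinearMap.comp_apply, TensorProduct.map_tmul, LinearMap.comp_apply, h₁.parity,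
    TensorProduct.neg_tmul]

/-- A nonzero submodule `S` of `V ⊗ W` and its image under `(φ₁ ⊗ 1) (P ⊗ P)` span `V ⊗ W`. -/
lemma IsIrreducible.sup_map_flipEnd_eq_top (hV : V.IsIrreducible) (hW : W.IsIrreducible)
    [FiniteDimensional ℂ V] (h₁ : V.IsOddSchur φ₁) {S : Submodule ℂ (V ⊗[ℂ] W)}
    (hS : (V.tensor W).IsSubmodule S) (hne : S ≠ ⊥) : S ⊔ S.map (flipEnd V W φ₁) = ⊤ := by
  set S' := S ⊔ S.map (flipEnd V W φ₁) with hS'd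
  have memJ : ∀ t ∈ S', flipEnd V W φ₁ t ∈ S' := fun t ht => by
    obtain ⟨a, ha, _, ⟨b, hb, rfl⟩, rfl⟩ := Submodule.mem_sup.1 ht
    rw [map_add, flipEnd_flipEnd h₁, add_comm]
    exact Submodule.add_mem_sup hb ⟨a, ha, rfl⟩
  have memP : ∀ t ∈ S', TensorProduct.map V.parity W.parity t ∈ S' := fun t ht => by
    obtain ⟨a, ha, _, ⟨b, hb, rfl⟩, rfl⟩ := Submodule.mem_sup.1 ht
    rw [map_add, parity_flipEnd h₁]
    exact Submodule.add_mem_sup (hS.parity_tensor_mem ha)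
      (neg_mem ⟨_, hS.parity_tensor_mem hb, rfl⟩)
  have hS' : (V.tensor W).IsSubmodule S' := by
    refine isSubmodule_of (fun t ht => ?_) (fun i x _ t ht => ?_)
    · rw [SuperSpace.parity_tensor_eq]
      exact memP t ht
    · obtain ⟨a, ha, _, ⟨b, hb, rfl⟩, rfl⟩ := Submodule.mem_sup.1 ht
      change tensorAct V W x (a + flipEnd V W φ₁ b) ∈ S'
      rw [map_add]
      exact Submodule.add_mem_sup (hS.2 x a ha) ⟨_, hS.2 x b hb, flipEnd_isHom h₁ x b⟩
  -- The enlarged submodule is stable under `φ₁ ⊗ 1`, which is `flipEnd` composed with total parity,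
  -- and under the action of `L`. In type Q these generate `End V`.
  refine hW.tensor_eq_top_of_stable hS'
    (stable_map_left_of_adjoin (hV.adjoin_act_oddSchur_eq_top h₁) ?_)
    fun h0 => hne (le_bot_iff.1 (h0 ▸ le_sup_left))
  rintro f (rfl | ⟨i, x, hx, rfl⟩) t ht
  · rw [map_left_eq_flipEnd]
    exact memJ _ (memP t ht)
  · rw [← tensorAct_left]
    exact hS'.2 (x, 0) t ht

lemma mem_fixedSpace {t : V ⊗[ℂ] W} :
    t ∈ fixedSpace V W φ₁ φ₂ ↔ twist V W φ₁ φ₂ t = t := Iff.rfl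

/-- Any `t` is `a + flipEnd b` with `a`, `b` in `S`. As `S` is fixed by the twist, the second term
lies in the eigenspace for -1, so it vanishes when `t` is fixed. -/
lemma IsIrreducible.fixedSpace_le (hV : V.IsIrreducible) (hW : W.IsIrreducible)
    [FiniteDimensional ℂ V] (h₁ : V.IsOddSchur φ₁) (h₂ : W.IsOddSchur φ₂)
    {S : Submodule ℂ (V ⊗[ℂ] W)} (hSF : S ≤ fixedSpace V W φ₁ φ₂)
    (hS : (V.tensor W).IsSubmodule S) (hne : S ≠ ⊥) : fixedSpace V W φ₁ φ₂ ≤ S := by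
  intro t ht
  obtain ⟨a, ha, _, ⟨b, hb, rfl⟩, e⟩ := Submodule.mem_sup.1
    (show t ∈ S ⊔ S.map (flipEnd V W φ₁) by
      rw [hV.sup_map_flipEnd_eq_top hW h₁ hS hne]; trivial)
  have e1 := mem_fixedSpace.1 ht
  have e2 : twist V W φ₁ φ₂ (flipEnd V W φ₁ b) = -flipEnd V W φ₁ b := by
    rw [twist_flipEnd h₂, mem_fixedSpace.1 (hSF hb)]
  rw [← e, map_add, mem_fixedSpace.1 (hSF ha), e2] at e1
  rw [← e, eq_zero_of_eq_neg (add_left_cancel e1).symm, add_zero]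
  exact ha

lemma half_add_twist_mem (h₁ : V.IsOddSchur φ₁) (h₂ : W.IsOddSchur φ₂) (t : V ⊗[ℂ] W) :
    (2 : ℂ)⁻¹ • (t + twist V W φ₁ φ₂ t) ∈ fixedSpace V W φ₁ φ₂ := by
  rw [mem_fixedSpace, map_smul, map_add, twist_twist h₁ h₂, add_comm]

lemma flipEnd_half_sub_twist_mem (h₁ : V.IsOddSchur φ₁) (h₂ : W.IsOddSchur φ₂) (t : V ⊗[ℂ] W) :
    flipEnd V W φ₁ ((2 : ℂ)⁻¹ • (t - twist V W φ₁ φ₂ t)) ∈ fixedSpace V W φ₁ φ₂ := by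
  rw [mem_fixedSpace, twist_flipEnd h₂, map_smul, map_sub,
    twist_twist h₁ h₂, ← map_neg, ← smul_neg, neg_sub]

/-- This splits `t` into its eigenvectors for the twist, the one for -1 being written as `flipEnd`
of a fixed vector. The fixed space and its image under `flipEnd` thus exhaust the tensor product. -/
lemma eq_half_add_twist_add (h₁ : V.IsOddSchur φ₁) (φ₂ : Module.End ℂ W) (t : V ⊗[ℂ] W) :
    t = (2 : ℂ)⁻¹ • (t + twist V W φ₁ φ₂ t) +
      flipEnd V W φ₁ (flipEnd V W φ₁ ((2 : ℂ)⁻¹ • (t - twist V W φ₁ φ₂ t))) := by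
  rw [flipEnd_flipEnd h₁, ← smul_add, add_add_sub_cancel, ← two_smul ℂ, smul_smul]
  simp

lemma fixedSpace_ne_bot [Nontrivial (V ⊗[ℂ] W)] (h₁ : V.IsOddSchur φ₁) (h₂ : W.IsOddSchur φ₂) :
    fixedSpace V W φ₁ φ₂ ≠ ⊥ := by
  intro h0
  obtain ⟨t, ht⟩ := exists_ne (0 : V ⊗[ℂ] W)
  have h1 := half_add_twist_mem h₁ h₂ t
  have h2 := flipEnd_half_sub_twist_mem h₁ h₂ t
  rw [h0, Submodule.mem_bot] at h1 h2
  have := eq_half_add_twist_add h₁ φ₂ t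
  rw [h1, h2, map_zero, add_zero] at this
  exact ht this

lemma IsIrreducible.isIrrPart_sub_fixedSpace (hV : V.IsIrreducible) (hW : W.IsIrreducible)
    [FiniteDimensional ℂ V] [FiniteDimensional ℂ W] (h₁ : V.IsOddSchur φ₁) (h₂ : W.IsOddSchur φ₂)
    {F : Submodule ℂ (V ⊗[ℂ] W)} (hF : (V.tensor W).IsSubmodule F)
    (h : F = fixedSpace V W φ₁ φ₂) : (V.tensor W).IsIrrPart ((V.tensor W).sub F hF) := by
  subst h
  have := nontrivial_tensor hV hW
  have hτh := twist_isHom h₁ h₂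
  refine ⟨⟨isIrreducible_sub hF (fixedSpace_ne_bot h₁ h₂) fun S hSF hS hne =>
      hV.fixedSpace_le hW h₁ h₂ hSF hS hne,
      inferInstanceAs (FiniteDimensional ℂ (fixedSpace V W φ₁ φ₂))⟩, ?_,
    ⟨_, subtype_isHom _ _ hF, Submodule.injective_subtype _⟩, ?_⟩
  -- The surjection is the projection onto the eigenspace of the twist for 1.
  · refine ⟨LinearMap.codRestrict _ ((2 : ℂ)⁻¹ • (LinearMap.id + twist V W φ₁ φ₂))
      (half_add_twist_mem h₁ h₂), fun x t => ?_, fun t => ⟨t.1, ?_⟩⟩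
    · apply Subtype.ext
      change (2 : ℂ)⁻¹ • (tensorAct V W x t + twist V W φ₁ φ₂ (tensorAct V W x t)) =
        tensorAct V W x ((2 : ℂ)⁻¹ • (t + twist V W φ₁ φ₂ t))
      rw [map_smul, map_add]
      exact congrArg (fun z => (2 : ℂ)⁻¹ • (tensorAct V W x t + z)) (hτh x t)
    · apply Subtype.ext
      change (2 : ℂ)⁻¹ • (t.1 + twist V W φ₁ φ₂ t.1) = t.1
      rw [mem_fixedSpace.1 t.2, ← two_smul ℂ, smul_smul]
      simp
  · intro U hU
    rw [eq_top_iff]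
    intro t _
    rw [eq_half_add_twist_add h₁ φ₂ t]
    exact add_mem (hU _ (subtype_isHom _ _ hF) ⟨_, half_add_twist_mem h₁ h₂ t⟩)
      (hU (flipEnd V W φ₁ ∘ₗ Submodule.subtype _)
        ((flipEnd_isHom h₁).comp (subtype_isHom _ _ hF)) ⟨_, flipEnd_half_sub_twist_mem h₁ h₂ t⟩)

end TypeQ

/-- The irreducible product of irreducible finite-dimensional modules is irreducible, a direct
summand of the tensor product, and generates the tensor product. -/
lemma IsIrredFD.isIrrPart_irrProd {V : SuperRep L} {W : SuperRep M} (hV : V.IsIrredFD)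
    (hW : W.IsIrredFD) : (V.tensor W).IsIrrPart (V.irrProd W) := by
  have := hV.2
  have := hW.2
  by_cases h : (V.tensor W).IsIrreducible
  · have : FiniteDimensional ℂ (V.tensor W) := inferInstanceAs (FiniteDimensional ℂ (V ⊗[ℂ] W))
    exact h.isIrrPart_sub_top _ (by rw [irrProdSpace, if_pos h])
  -- A reducible product forces both factors to be of type Q. The fixed space is an irreducible part
  -- for every pair of odd endomorphisms, so the choice made in `irrProdSpace` does no harm.
  · have h' : (∃ φ, V.IsOddSchur φ) ∧ ∃ φ, W.IsOddSchur φ := by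
      constructor
      · by_contra hn
        exact h (hV.1.tensor_of_left hW.1 hn)
      · by_contra hn
        exact h (hV.1.tensor_of_right hW.1 hn)
    exact hV.1.isIrrPart_sub_fixedSpace hW.1 h'.1.choose_spec h'.2.choose_spec _
      (by rw [irrProdSpace, if_neg h, dif_pos h'])

end SuperRep

/-! ### Pullbacks and inner tensor products -/

namespace SuperRep

lemma IsIrreducible.pullback {L : LieSuperalgebra.{u}} {M : LieSuperalgebra.{v}} {V : SuperRep M}
    (hV : V.IsIrreducible) {f : LieSuperalgebra.Hom L M} (hf : Function.Surjective f.toLin) :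
    (V.pullback f).IsIrreducible := by
  refine ⟨hV.1, fun W hW => hV.2 W ⟨hW.1, fun x v hv => ?_⟩⟩
  obtain ⟨y, rfl⟩ := hf x
  exact hW.2 y v hv

lemma IsIrredFD.pullback {L : LieSuperalgebra.{u}} {M : LieSuperalgebra.{v}} {V : SuperRep M}
    (hV : V.IsIrredFD) {f : LieSuperalgebra.Hom L M} (hf : Function.Surjective f.toLin) :
    (V.pullback f).IsIrredFD := ⟨hV.1.pullback hf, hV.2⟩

lemma IsIrrPart.pullback {L : LieSuperalgebra.{u}} {M : LieSuperalgebra.{v}} {T N : SuperRep M}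
    (h : T.IsIrrPart N) {f : LieSuperalgebra.Hom L M} (hf : Function.Surjective f.toLin) :
    (T.pullback f).IsIrrPart (N.pullback f) where
  irrFD := h.irrFD.pullback hf
  exists_surj := by
    obtain ⟨p, hp, hs⟩ := h.exists_surj
    exact ⟨p, fun x v => hp (f.toLin x) v, hs⟩
  exists_inj := by
    obtain ⟨p, hp, hs⟩ := h.exists_inj
    exact ⟨p, fun x v => hp (f.toLin x) v, hs⟩
  generates U hU := h.generates U fun g hg => hU g fun x v => hg (f.toLin x) v

variable {L : LieSuperalgebra.{u}}

lemma IsIrrPart.of_equiv {T T' N : SuperRep L} (h : T.IsIrrPart N) (e : T ≃ₗ[ℂ] T')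
    (he : T.IsHom T' (e : T →ₗ[ℂ] T')) : T'.IsIrrPart N where
  irrFD := h.irrFD
  exists_surj := by
    obtain ⟨p, hp, hs⟩ := h.exists_surj
    exact ⟨p ∘ₗ (e.symm : T' →ₗ[ℂ] T), hp.comp (IsHom.symm he), hs.comp e.symm.surjective⟩
  exists_inj := by
    obtain ⟨p, hp, hs⟩ := h.exists_inj
    exact ⟨(e : T →ₗ[ℂ] T') ∘ₗ p, he.comp hp, e.injective.comp hs⟩
  generates U hU := by
    have := h.generates (U.comap (e : T →ₗ[ℂ] T')) fun g hg n =>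
      hU ((e : T →ₗ[ℂ] T') ∘ₗ g) (he.comp hg) n
    rw [eq_top_iff]
    intro t _
    have h1 : e.symm t ∈ U.comap (e : T →ₗ[ℂ] T') := by rw [this]; trivial
    simpa using h1

lemma IsIrredFD.isIrrPart_self {T : SuperRep L} (h : T.IsIrredFD) : T.IsIrrPart T where
  irrFD := h
  exists_surj := ⟨LinearMap.id, fun _ _ => rfl, Function.surjective_id⟩
  exists_inj := ⟨LinearMap.id, fun _ _ => rfl, Function.injective_id⟩
  generates U hU := by
    rw [eq_top_iff]
    intro t _
    exact hU LinearMap.id (fun _ _ => rfl) t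

/-- The diagonal homomorphism `x ↦ (x, x)`. -/
noncomputable def diagHom (L : LieSuperalgebra.{u}) : LieSuperalgebra.Hom L (L.prod L) where
  toLin := LinearMap.id.prod LinearMap.id
  map_mem _ _ hx := ⟨hx, hx⟩
  map_bracket _ _ := rfl

/-- The tensor product of two `L`-modules as an `L`-module. -/
@[reducible] noncomputable def itensor (V W : SuperRep L) : SuperRep L :=
  (V.tensor W).pullback (diagHom L)

lemma itensor_act_tmul (V W : SuperRep L) {i a : ZMod 2} {x : L} {v : V} (hx : x ∈ L.gr i)
    (hv : v ∈ V.gr a) (w : W) :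
    (V.itensor W).act x (v ⊗ₜ w) = V.act x v ⊗ₜ w + sgn i a • (v ⊗ₜ W.act x w) :=
  tensorAct_tmul V W (x := (x, x)) hx hv

lemma isHom_itensor_of {V W N : SuperRep L} {f : V ⊗[ℂ] W →ₗ[ℂ] N}
    (h : ∀ i, ∀ x ∈ L.gr i, ∀ a, ∀ v ∈ V.gr a, ∀ w,
      f (V.act x v ⊗ₜ w) + sgn i a • f (v ⊗ₜ W.act x w) = N.act x (f (v ⊗ₜ w))) :
    (V.itensor W).IsHom N f := by
  refine isHom_of_homogeneous fun i x hx t => ?_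
  refine LinearMap.congr_fun (f := f ∘ₗ (V.itensor W).act x) (g := N.act x ∘ₗ f) ?_ t
  refine tensor_ext V.toSuperSpace W.toSuperSpace fun a v hv w => ?_
  refine (congrArg f (itensor_act_tmul V W hx hv w)).trans (Eq.trans ?_ (h i x hx a v hv w))
  rw [map_add, map_smul]

/-- This links outer products over a direct sum with inner products over `L`: all evaluation modules
can then be compared over the single algebra `L ⊗ A`. -/
lemma tensor_pullback_pair_isHom {P R : LieSuperalgebra.{u}} (V : SuperRep P) (W : SuperRep R)
    (f : LieSuperalgebra.Hom L P) (h : LieSuperalgebra.Hom L R) :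
    ((V.pullback f).itensor (W.pullback h)).IsHom ((V.tensor W).pullback (f.pair h))
      (LinearMap.id : V ⊗[ℂ] W →ₗ[ℂ] V ⊗[ℂ] W) := by
  refine isHom_itensor_of (V := V.pullback f) (W := W.pullback h) fun i x hx a v hv w => ?_
  exact (tensorAct_tmul V W (x := (f.toLin x, h.toLin x)) (h.map_mem i x hx) hv).symm

lemma IsIrrPart.of_pullback_pair {P R : LieSuperalgebra.{u}} {V : SuperRep P} {W : SuperRep R}
    {f : LieSuperalgebra.Hom L P} {h : LieSuperalgebra.Hom L R} {N : SuperRep L}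
    (hN : ((V.tensor W).pullback (f.pair h)).IsIrrPart N) :
    ((V.pullback f).itensor (W.pullback h)).IsIrrPart N :=
  hN.of_equiv (LinearEquiv.refl ℂ (V ⊗[ℂ] W))
    fun x t => (tensor_pullback_pair_isHom V W f h x t).symm

/-- `id ⊗ f` is a homomorphism. -/
lemma IsHom.map_right {V W W' : SuperRep L} {f : W →ₗ[ℂ] W'} (hf : W.IsHom W' f) :
    (V.itensor W).IsHom (V.itensor W') (TensorProduct.map LinearMap.id f) := by
  refine isHom_itensor_of fun i x hx a v hv w => ?_
  simp only [TensorProduct.map_tmul, LinearMap.id_apply]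
  rw [hf]
  exact (itensor_act_tmul V W' hx hv _).symm

/-- A homogeneous homomorphism `V → V'` induces a homomorphism `V ⊗ W → V' ⊗ W` of the form
`f ⊗ 1` or `f ⊗ P`. -/
lemma IsHom.exists_map_left {V V' : SuperRep L} {f : V →ₗ[ℂ] V'} (hf : V.IsHom V' f) {ε : ℂ}
    (hε : ε = 1 ∨ ε = -1) (hp : IsHomog V.toSuperSpace V'.toSuperSpace ε f) (W : SuperRep L) :
    ∃ σ : W →ₗ[ℂ] W, Function.Surjective σ ∧
      (V.itensor W).IsHom (V'.itensor W) (TensorProduct.map f σ) := by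
  rcases hε with rfl | rfl
  · refine ⟨LinearMap.id, Function.surjective_id, isHom_itensor_of fun i x hx a v hv w => ?_⟩
    have hv' : f v ∈ V'.gr a := SuperSpace.mem_gr_iff_parity.2 (by
      rw [hp, V.parity_of_mem hv, map_smul, one_smul])
    simp only [TensorProduct.map_tmul, LinearMap.id_apply]
    rw [hf]
    exact (itensor_act_tmul V' W hx hv' _).symm
  -- An odd `f` shifts the degree that an element acting on `W` has to pass; parity on `W` supplies
  -- the missing sign.
  · refine ⟨W.parity, fun w => ⟨_, W.parity_parity w⟩,
      isHom_itensor_of fun i x hx a v hv w => ?_⟩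
    have hv' : f v ∈ V'.gr (a + 1) := SuperSpace.mem_gr_iff_parity.2 (by
      rw [hp, V.parity_of_mem hv, map_smul, sgn_add_right, sgn_one_one]; simp)
    simp only [TensorProduct.map_tmul]
    refine Eq.trans ?_ (itensor_act_tmul V' W hx hv' _).symm
    rw [hf, W.parity_act hx, TensorProduct.tmul_smul, smul_smul, sgn_add_right, sgn_comm i 1]

/-- The isomorphism `(X ⊗ E) ⊗ E' → (X ⊗ E') ⊗ E` given by the braiding of `E` and `E'`. -/
noncomputable def braidRight (X E E' : SuperSpace.{0}) : (X ⊗[ℂ] E) ⊗[ℂ] E' →ₗ[ℂ] (X ⊗[ℂ] E') ⊗[ℂ] E :=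
  (TensorProduct.assoc ℂ X E' E).symm.toLinearMap ∘ₗ
    TensorProduct.map LinearMap.id (braiding E' E) ∘ₗ (TensorProduct.assoc ℂ X E E').toLinearMap

lemma braidRight_tmul (X E E' : SuperSpace.{0}) {b c : ZMod 2} (n : X) {e : E} {e' : E'}
    (he : e ∈ E.gr b) (he' : e' ∈ E'.gr c) :
    braidRight X E E' ((n ⊗ₜ e) ⊗ₜ e') = sgn c b • ((n ⊗ₜ e') ⊗ₜ e) := by
  simp only [braidRight, LinearMap.comp_apply, LinearEquiv.coe_coe, TensorProduct.assoc_tmul,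
    TensorProduct.map_tmul, LinearMap.id_apply]
  rw [braiding_tmul E' E he' he, TensorProduct.tmul_smul, map_smul, TensorProduct.assoc_symm_tmul]

lemma braidRight_surjective (X E E' : SuperSpace.{0}) : Function.Surjective (braidRight X E E') := by
  have h := TensorProduct.map_surjective (g := (LinearMap.id : X →ₗ[ℂ] X)) Function.surjective_id
    (braiding_surjective E' E)
  exact (TensorProduct.assoc ℂ X E' E).symm.surjective.comp
    (h.comp (TensorProduct.assoc ℂ X E E').surjective)

lemma tensor_ext_homog₃ (X E E' : SuperSpace.{0}) {P : Type} [AddCommGroup P] [Module ℂ P]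
    {f g : (X ⊗[ℂ] E) ⊗[ℂ] E' →ₗ[ℂ] P}
    (h : ∀ a b c, ∀ x ∈ X.gr a, ∀ y ∈ E.gr b, ∀ z ∈ E'.gr c,
      f ((x ⊗ₜ y) ⊗ₜ z) = g ((x ⊗ₜ y) ⊗ₜ z)) : f = g := by
  refine TensorProduct.ext_threefold fun x y z => ?_
  refine X.hom_induction (p := fun x => f ((x ⊗ₜ y) ⊗ₜ z) = g ((x ⊗ₜ y) ⊗ₜ z)) x
    (fun a x hx => ?_) (fun s t hs ht => by simp only [TensorProduct.add_tmul, map_add, hs, ht])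
  refine E.hom_induction (p := fun y => f ((x ⊗ₜ y) ⊗ₜ z) = g ((x ⊗ₜ y) ⊗ₜ z)) y
    (fun b y hy => ?_) (fun s t hs ht => by
      simp only [TensorProduct.add_tmul, TensorProduct.tmul_add, map_add, hs, ht])
  refine E'.hom_induction (p := fun z => f ((x ⊗ₜ y) ⊗ₜ z) = g ((x ⊗ₜ y) ⊗ₜ z)) z
    (fun c z hz => h a b c x hx y hy z hz)
    (fun s t hs ht => by simp only [TensorProduct.tmul_add, map_add, hs, ht])

lemma braidRight_isHom (X E E' : SuperRep L) :
    ((X.itensor E).itensor E').IsHom ((X.itensor E').itensor E)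
      (braidRight X.toSuperSpace E.toSuperSpace E'.toSuperSpace) := by
  refine isHom_of_homogeneous fun i x hx t => ?_
  refine LinearMap.congr_fun
    (f := braidRight X.toSuperSpace E.toSuperSpace E'.toSuperSpace ∘ₗ
      ((X.itensor E).itensor E').act x)
    (g := ((X.itensor E').itensor E).act x ∘ₗ
      braidRight X.toSuperSpace E.toSuperSpace E'.toSuperSpace) ?_ t
  refine tensor_ext_homog₃ _ _ _ fun a b c n hn e he e' he' => ?_
  have h1 : ((X.itensor E).itensor E').act x ((n ⊗ₜ e) ⊗ₜ e') =
      (X.act x n ⊗ₜ e) ⊗ₜ e' + sgn i a • ((n ⊗ₜ E.act x e) ⊗ₜ e') +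
        sgn i (a + b) • ((n ⊗ₜ e) ⊗ₜ E'.act x e') := by
    rw [itensor_act_tmul (X.itensor E) E' hx (SuperSpace.tmul_mem_tensorGr hn he),
      itensor_act_tmul X E hx hn, TensorProduct.add_tmul, ← TensorProduct.smul_tmul']
  have h2 : ((X.itensor E').itensor E).act x ((n ⊗ₜ e') ⊗ₜ e) =
      (X.act x n ⊗ₜ e') ⊗ₜ e + sgn i a • ((n ⊗ₜ E'.act x e') ⊗ₜ e) +
        sgn i (a + c) • ((n ⊗ₜ e') ⊗ₜ E.act x e) := by
    rw [itensor_act_tmul (X.itensor E') E hx (SuperSpace.tmul_mem_tensorGr hn he'),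
      itensor_act_tmul X E' hx hn, TensorProduct.add_tmul, ← TensorProduct.smul_tmul']
  refine (congrArg (braidRight X.toSuperSpace E.toSuperSpace E'.toSuperSpace) h1).trans
    (Eq.trans ?_ (congrArg (((X.itensor E').itensor E).act x) (braidRight_tmul _ _ _ n he he')).symm)
  refine Eq.trans ?_ (map_smul (((X.itensor E').itensor E).act x) _ _).symm
  rw [h2, map_add, map_add, map_smul, map_smul, braidRight_tmul _ _ _ _ he he',
    braidRight_tmul _ _ _ _ (E.act_mem i b x hx e he) he',
    braidRight_tmul _ _ _ _ he (E'.act_mem i c x hx e' he')]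
  simp only [smul_add, smul_smul]
  have k1 : sgn i (a + b) * sgn (i + c) b = sgn c b * sgn i a := by
    rw [sgn_add_right, sgn_add_left]
    linear_combination (sgn i a * sgn c b) * sgn_mul_sgn_self i b
  have k2 : sgn i a * sgn c (i + b) = sgn c b * sgn i (a + c) := by
    rw [sgn_add_right, sgn_add_right, sgn_comm c i]
    ring
  rw [add_right_comm, k1, k2]

end SuperRep

/-! ### Evaluation modules -/

section Evaluation

variable {A : Type v} [CommRing A]

/-- Distinct maximal ideals are comaximal, so one multiplies together elements of the `m'` that are
congruent to 1 modulo `m`. Such elements give both surjectivity of evaluation and the separation of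
the factors. -/
lemma exists_sub_one_mem_of_notMem (m : MaximalSpectrum A) :
    ∀ l : List (MaximalSpectrum A), m ∉ l →
      ∃ e : A, (∀ m' ∈ l, e ∈ m'.asIdeal) ∧ e - 1 ∈ m.asIdeal
  | [], _ => ⟨1, by simp, by simp⟩
  | m' :: l, h => by
    rw [List.mem_cons, not_or] at h
    obtain ⟨e, he, he1⟩ := exists_sub_one_mem_of_notMem m l h.2
    have hne : m'.asIdeal ≠ m.asIdeal := fun h' => h.1 (MaximalSpectrum.ext h').symm
    have hc := Ideal.IsMaximal.coprime_of_ne m'.isMaximal m.isMaximal hne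
    obtain ⟨i, hi, j, hj, hij⟩ := Submodule.mem_sup.1
      (show (1 : A) ∈ m'.asIdeal ⊔ m.asIdeal by rw [hc]; trivial)
    refine ⟨e * i, ?_, ?_⟩
    · intro m'' hm''
      rcases List.mem_cons.1 hm'' with rfl | hm''
      · exact Ideal.mul_mem_left _ _ hi
      · exact Ideal.mul_mem_right _ _ (he _ hm'')
    · have : e * i - 1 = (e - 1) - e * j := by linear_combination e * hij
      rw [this]
      exact sub_mem he1 (Ideal.mul_mem_left _ _ hj)

variable [Algebra ℂ A] (L : LieSuperalgebra.{0})

/-- Multiplication by `e` on `L ⊗ A`. -/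
noncomputable def mulRight (e : A) : L ⊗[ℂ] A →ₗ[ℂ] L ⊗[ℂ] A :=
  TensorProduct.map LinearMap.id (LinearMap.mulLeft ℂ e)

lemma mapAlg_mk_mulRight_of_mem {m : MaximalSpectrum A} {e : A} (he : e ∈ m.asIdeal)
    (t : L ⊗[ℂ] A) :
    (LieSuperalgebra.Hom.mapAlg L (Ideal.Quotient.mkₐ ℂ m.asIdeal)).toLin (mulRight L e t) = 0 := by
  change TensorProduct.map LinearMap.id (Ideal.Quotient.mkₐ ℂ m.asIdeal).toLinearMap
    (mulRight L e t) = 0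
  have h0 : Ideal.Quotient.mk m.asIdeal e = 0 := Ideal.Quotient.eq_zero_iff_mem.2 he
  induction t using TensorProduct.induction_on with
  | zero => simp
  | add a b ha hb => rw [map_add, map_add, ha, hb, add_zero]
  | tmul x a => simp [mulRight, h0]

lemma mapAlg_mk_mulRight_of_sub_one_mem {m : MaximalSpectrum A} {e : A} (he : e - 1 ∈ m.asIdeal)
    (t : L ⊗[ℂ] A) :
    (LieSuperalgebra.Hom.mapAlg L (Ideal.Quotient.mkₐ ℂ m.asIdeal)).toLin (mulRight L e t) =
      (LieSuperalgebra.Hom.mapAlg L (Ideal.Quotient.mkₐ ℂ m.asIdeal)).toLin t := by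
  change TensorProduct.map LinearMap.id (Ideal.Quotient.mkₐ ℂ m.asIdeal).toLinearMap
    (mulRight L e t) = TensorProduct.map LinearMap.id (Ideal.Quotient.mkₐ ℂ m.asIdeal).toLinearMap t
  have h0 : Ideal.Quotient.mk m.asIdeal e = 1 := by
    rw [← map_one (Ideal.Quotient.mk m.asIdeal)]
    exact Ideal.Quotient.mk_eq_mk_iff_sub_mem e 1 |>.2 he
  induction t using TensorProduct.induction_on with
  | zero => simp
  | add a b ha hb => rw [map_add, map_add, ha, hb, map_add]
  | tmul x a => simp [mulRight, h0]

lemma evHom_mulRight_of_mem {e : A} : ∀ l : List (MaximalSpectrum A),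
    (∀ m ∈ l, e ∈ m.asIdeal) → ∀ t : L ⊗[ℂ] A, (evHom L l).toLin (mulRight L e t) = 0
  | [], _, _ => rfl
  | [m], h, t => mapAlg_mk_mulRight_of_mem L (h m (by simp)) t
  | m :: m' :: l, h, t => Prod.ext
      (evHom_mulRight_of_mem (m' :: l) (fun m'' hm'' => h m'' (List.mem_cons_of_mem _ hm'')) t)
      (mapAlg_mk_mulRight_of_mem L (h m (by simp)) t)

lemma mapAlg_mk_surjective (m : MaximalSpectrum A) : Function.Surjective
    (LieSuperalgebra.Hom.mapAlg L (Ideal.Quotient.mkₐ ℂ m.asIdeal)).toLin :=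
  TensorProduct.map_surjective (g := (LinearMap.id : L →ₗ[ℂ] L)) Function.surjective_id
    (Ideal.Quotient.mkₐ_surjective ℂ m.asIdeal)

/-- The Chinese remainder theorem for map superalgebras. -/
lemma evHom_surjective : ∀ l : List (MaximalSpectrum A), l.Nodup →
    Function.Surjective (evHom L l).toLin
  | [], _ => fun y => ⟨0, (rfl : (PUnit.unit : PUnit) = y)⟩
  | [m], _ => mapAlg_mk_surjective L m
  | m :: m' :: l, h => by
    rintro ⟨y, z⟩
    rw [List.nodup_cons] at h
    obtain ⟨e, he, he1⟩ := exists_sub_one_mem_of_notMem m _ h.1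
    obtain ⟨s, rfl⟩ := evHom_surjective (m' :: l) h.2 y
    obtain ⟨t, ht⟩ := mapAlg_mk_surjective L m
      (z - (LieSuperalgebra.Hom.mapAlg L (Ideal.Quotient.mkₐ ℂ m.asIdeal)).toLin s)
    -- `s` is right at the points of the tail; the multiple of `t` by `e` corrects the value at `m`
    -- and vanishes at the tail.
    refine ⟨s + mulRight L e t, Prod.ext ?_ ?_⟩
    · change (evHom L (m' :: l)).toLin (s + mulRight L e t) = _
      rw [map_add, evHom_mulRight_of_mem L _ he, add_zero]
    · change (LieSuperalgebra.Hom.mapAlg L (Ideal.Quotient.mkₐ ℂ m.asIdeal)).toLin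
        (s + mulRight L e t) = _
      rw [map_add, mapAlg_mk_mulRight_of_sub_one_mem L he1, ht, add_sub_cancel]

variable {L} [Algebra.FiniteType ℂ A]

open SuperRep

lemma contract_residue_surjective (m : MaximalSpectrum A) : Function.Surjective
    (LieSuperalgebra.Hom.contract L (residueEquiv m : (A ⧸ m.asIdeal) →ₐ[ℂ] ℂ)).toLin := fun x =>
  ⟨x ⊗ₜ 1, by
    change TensorProduct.rid ℂ L (TensorProduct.map LinearMap.id
      (residueEquiv m : (A ⧸ m.asIdeal) →ₐ[ℂ] ℂ).toLinearMap (x ⊗ₜ 1)) = x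
    simp⟩

lemma pointRep_isIrredFD (m : MaximalSpectrum A) {V : SuperRep L} (hV : V.IsIrredFD) :
    (pointRep m V).IsIrredFD :=
  hV.pullback (contract_residue_surjective m)

/-- The evaluation module at a single point. -/
noncomputable def evPoint (m : MaximalSpectrum A) (V : SuperRep L) : SuperRep (L.mapAlg A) :=
  (pointRep m V).pullback (LieSuperalgebra.Hom.mapAlg L (Ideal.Quotient.mkₐ ℂ m.asIdeal))

lemma evPoint_isIrredFD (m : MaximalSpectrum A) {V : SuperRep L} (hV : V.IsIrredFD) :
    (evPoint m V).IsIrredFD :=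
  (pointRep_isIrredFD m hV).pullback (mapAlg_mk_surjective L m)

lemma triv_isIrredFD (M : LieSuperalgebra.{u}) : (triv M).IsIrredFD := by
  refine ⟨⟨inferInstanceAs (Nontrivial ℂ), fun W _ => ?_⟩,
    inferInstanceAs (FiniteDimensional ℂ ℂ)⟩
  exact eq_bot_or_eq_top (α := Submodule ℂ ℂ) W

lemma lid_isHom {M N : LieSuperalgebra.{u}} (f : LieSuperalgebra.Hom M N) (E : SuperRep M) :
    (((triv N).pullback f).itensor E).IsHom E (TensorProduct.lid ℂ E).toLinearMap := by
  refine isHom_itensor_of (V := (triv N).pullback f) fun i x _ a (c : ℂ) hc w => ?_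
  have hc' : c ∈ (if a = 0 then (⊤ : Submodule ℂ ℂ) else ⊥) := hc
  change TensorProduct.lid ℂ E ((0 : ℂ) ⊗ₜ w) + sgn i a • TensorProduct.lid ℂ E (c ⊗ₜ E.act x w) =
    E.act x (TensorProduct.lid ℂ E (c ⊗ₜ w))
  rw [TensorProduct.lid_tmul, TensorProduct.lid_tmul, TensorProduct.lid_tmul, zero_smul, zero_add,
    map_smul]
  rcases parity_cases a with rfl | rfl
  · rw [sgn_zero_right, one_smul]
  · have h0 : c = 0 := by simpa using hc'
    rw [h0, zero_smul, smul_zero]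

/-- The trivial module is a unit for the tensor product. This lets the empty list serve as the start
of the recursion although evaluation at a single point is defined without a product. -/
lemma SuperRep.IsIrredFD.isIrrPart_triv_itensor {M N : LieSuperalgebra.{u}}
    {E : SuperRep M} (hE : E.IsIrredFD) (f : LieSuperalgebra.Hom M N) :
    (((triv N).pullback f).itensor E).IsIrrPart E :=
  hE.isIrrPart_self.of_equiv (T' := ((triv N).pullback f).itensor E) (TensorProduct.lid ℂ E).symm
    (IsHom.symm (lid_isHom f E))

variable {ρ : MaximalSpectrum A → SuperRep L}

lemma pointsRep_isIrredFD : ∀ l : List (MaximalSpectrum A), (∀ m ∈ l, (ρ m).IsIrredFD) →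
    (pointsRep ρ l).IsIrredFD
  | [], _ => triv_isIrredFD _
  | [m], h => pointRep_isIrredFD m (h m (by simp))
  | m :: m' :: l, h => ((pointsRep_isIrredFD (m' :: l) fun m'' hm'' =>
      h m'' (List.mem_cons_of_mem _ hm'')).isIrrPart_irrProd
        (pointRep_isIrredFD m (h m (by simp)))).irrFD

lemma evModule_isIrredFD {l : List (MaximalSpectrum A)} (hl : l.Nodup)
    (h : ∀ m ∈ l, (ρ m).IsIrredFD) : (evModule ρ l).IsIrredFD :=
  (pointsRep_isIrredFD l h).pullback (evHom_surjective L l hl)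

/-- The evaluation module of `m :: l` is an irreducible summand of the tensor product of those of
`l` and of `m`. -/
lemma isIrrPart_evModule_cons {m : MaximalSpectrum A} : ∀ {l : List (MaximalSpectrum A)},
    (m :: l).Nodup → (∀ m' ∈ m :: l, (ρ m').IsIrredFD) →
      ((evModule ρ l).itensor (evPoint m (ρ m))).IsIrrPart (evModule ρ (m :: l))
  | [], _, h => by
    exact (evPoint_isIrredFD m (h m (by simp))).isIrrPart_triv_itensor _
  -- Here the module of the longer list is by definition an irreducible product, and pulling back
  -- along the surjective evaluation map keeps it an irreducible part.
  | m' :: l, hl, h => by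
    have hP := pointsRep_isIrredFD (ρ := ρ) (m' :: l) fun m'' hm'' =>
      h m'' (List.mem_cons_of_mem _ hm'')
    exact IsIrrPart.of_pullback_pair ((hP.isIrrPart_irrProd
      (pointRep_isIrredFD m (h m (by simp)))).pullback (evHom_surjective L (m :: m' :: l) hl))

end Evaluation

/-! ### Uniqueness of the irreducible constituent of a tensor product -/

namespace SuperRep

variable {L : LieSuperalgebra.{u}}

/-- An irreducible module receiving a nonzero homomorphism from `T` is isomorphic to the
irreducible constituent of `T`. -/
lemma IsIrrPart.iso_of_ne_zero {T N X : SuperRep L} (h : T.IsIrrPart N) (hX : X.IsIrreducible)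
    {f : T →ₗ[ℂ] X} (hf : T.IsHom X f) (h0 : f ≠ 0) : N.Iso X := by
  by_contra hn
  apply h0
  rw [← LinearMap.ker_eq_top]
  -- If `N` and `X` were not isomorphic, Schur's lemma would kill every composite `N → T → X`, and
  -- the images of `N` generate `T`.
  refine h.generates _ fun g hg n => ?_
  by_contra hne
  exact hn (h.irrFD.1.iso_of_ne_zero hX (hf.comp hg) fun h' =>
    hne (LinearMap.congr_fun h' n))

lemma ne_zero_of_surjective {V W : Type*} [AddCommGroup V] [Module ℂ V] [AddCommGroup W]
    [Module ℂ W] [Nontrivial W] {f : V →ₗ[ℂ] W} (hf : Function.Surjective f) : f ≠ 0 := by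
  rintro rfl
  obtain ⟨w, hw⟩ := exists_ne (0 : W)
  obtain ⟨v, hv⟩ := hf w
  exact hw hv.symm

/-- If `N ≅ N'` are irreducible, there is a surjective homomorphism `N ⊗ E → N' ⊗ E`. -/
lemma Iso.exists_surjective_map_left {N N' : SuperRep L} (hN : N.IsIrreducible)
    (hN' : N'.IsIrreducible) (h : N.Iso N') (E : SuperRep L) :
    ∃ g : N ⊗[ℂ] E →ₗ[ℂ] N' ⊗[ℂ] E,
      (N.itensor E).IsHom (N'.itensor E) g ∧ Function.Surjective g := by
  obtain ⟨e, he⟩ := h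
  have := hN'.1
  -- The given isomorphism may be inhomogeneous, and only homogeneous maps can be tensored with `E`;
  -- Schur's lemma supplies a homogeneous replacement.
  obtain ⟨f, ε, hε, hf, hp⟩ := hN.exists_equiv hN' (f := (e : N →ₗ[ℂ] N')) he
    (ne_zero_of_surjective e.surjective)
  obtain ⟨σ, hσ, hh⟩ := hf.exists_map_left hε hp E
  exact ⟨_, hh, TensorProduct.map_surjective f.surjective hσ⟩

/-- The irreducible constituent of a tensor product only depends on the classes of the factors. -/
lemma IsIrrPart.iso_congr {N N' E E' X X' : SuperRep L} (hN : N.IsIrreducible)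
    (hN' : N'.IsIrreducible) (h : N.Iso N') (hE : E.Iso E') (hX : (N.itensor E).IsIrrPart X)
    (hX' : (N'.itensor E').IsIrrPart X') : X.Iso X' := by
  obtain ⟨g, hg, hgs⟩ := Iso.exists_surjective_map_left hN hN' h E
  obtain ⟨e, he⟩ := hE
  have hr : (N'.itensor E).IsHom (N'.itensor E')
    (TensorProduct.map LinearMap.id (e : E →ₗ[ℂ] E')) := IsHom.map_right (f := (e : E →ₗ[ℂ] E')) he
  have hrs : Function.Surjective
      (TensorProduct.map (LinearMap.id : N' →ₗ[ℂ] N') (e : E →ₗ[ℂ] E')) :=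
    TensorProduct.map_surjective Function.surjective_id e.surjective
  obtain ⟨p, hp, hps⟩ := hX'.exists_surj
  have := hX'.irrFD.1.1
  exact hX.iso_of_ne_zero hX'.irrFD.1 (hp.comp (hr.comp hg))
    (ne_zero_of_surjective (hps.comp (hrs.comp hgs)))

/-- Adjoining two factors in either order gives isomorphic irreducible constituents. -/
lemma IsIrrPart.iso_swap {N E E' X X' Y Y' : SuperRep L} (hX : (N.itensor E).IsIrrPart X)
    (hX' : (N.itensor E').IsIrrPart X') (hY : (X.itensor E').IsIrrPart Y)
    (hY' : (X'.itensor E).IsIrrPart Y') : Y.Iso Y' := by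
  have := hY'.irrFD.1.1
  obtain ⟨p, hp, hps⟩ := hY'.exists_surj
  obtain ⟨p', hp', hps'⟩ := hX'.exists_surj
  -- A nonzero homogeneous component of the projection onto `X'` is still surjective, because its
  -- image is a graded submodule.
  obtain ⟨g, ε, hε, hg, hgh, hg0⟩ := hp'.exists_homog (have := hX'.irrFD.1.1
    ne_zero_of_surjective hps')
  have hgs : Function.Surjective g := by
    rcases hX'.irrFD.1.2 _ (range_isSubmodule hg hgh) with h | h
    · exact absurd (LinearMap.range_eq_bot.1 h) hg0
    · exact LinearMap.range_eq_top.1 h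
  obtain ⟨σ, hσ, hh⟩ := hg.exists_map_left hε hgh E
  -- The composite `(N ⊗ E) ⊗ E' → (N ⊗ E') ⊗ E → X' ⊗ E → Y'` is a surjective homomorphism.
  have hF := hp.comp (hh.comp (braidRight_isHom N E E'))
  have hFs := hps.comp ((TensorProduct.map_surjective hgs hσ).comp
    (braidRight_surjective N.toSuperSpace E.toSuperSpace E'.toSuperSpace))
  set F := p ∘ₗ (TensorProduct.map g σ ∘ₗ
    braidRight N.toSuperSpace E.toSuperSpace E'.toSuperSpace) with hFd
  have hF0 : F ≠ 0 := ne_zero_of_surjective hFs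
  by_contra hn
  apply hF0
  -- If `Y` and `Y'` were not isomorphic, `F` would vanish on the image of `X ⊗ E'` for each
  -- homogeneous `X → N ⊗ E`. Those images generate, so `U` would be everything and `F` zero.
  let U : Submodule ℂ (N.itensor E) :=
    { carrier := {t | ∀ e' : E', F (t ⊗ₜ e') = 0}
      zero_mem' := fun e' => by rw [TensorProduct.zero_tmul, map_zero]
      add_mem' := fun ha hb e' => by rw [TensorProduct.add_tmul, map_add, ha, hb, add_zero]
      smul_mem' := fun c a ha e' => by
        rw [← TensorProduct.smul_tmul', map_smul, ha, smul_zero] }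
  have hU : U = ⊤ := by
    refine hX.generates U fun f hf => hf.mem_of_homog fun f ε hε hf hfh n e' => ?_
    obtain ⟨σ', hσ', hh'⟩ := hf.exists_map_left hε hfh E'
    obtain ⟨e, rfl⟩ := hσ' e'
    by_contra hne
    exact hn (hY.iso_of_ne_zero hY'.irrFD.1 (hF.comp hh') fun h' =>
      hne (LinearMap.congr_fun h' (n ⊗ₜ e)))
  exact TensorProduct.ext' fun t e' => (show t ∈ U by rw [hU]; trivial) e'

end SuperRep

namespace SuperRep

lemma cls_eq_iff {L : LieSuperalgebra.{u}} {V W : SuperRep L} : V.cls = W.cls ↔ V.Iso W :=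
  ⟨fun h => Quotient.exact h, fun h => Quotient.sound h⟩

lemma Iso.refl {L : LieSuperalgebra.{u}} (V : SuperRep L) : V.Iso V :=
  (isoSetoid L).iseqv.refl V

lemma Iso.trans {L : LieSuperalgebra.{u}} {U V W : SuperRep L} (h : U.Iso V) (h' : V.Iso W) :
    U.Iso W := (isoSetoid L).iseqv.trans h h'

end SuperRep

open SuperRep

/-! ### Independence of the order of the points and of the representatives -/

section Evaluation

variable {A : Type v} [CommRing A] [Algebra ℂ A] [Algebra.FiniteType ℂ A]
  {L : LieSuperalgebra.{0}} {ρ ρ' : MaximalSpectrum A → SuperRep L}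

lemma evPoint_congr (m : MaximalSpectrum A) {V W : SuperRep L} (h : V.Iso W) :
    (evPoint m V).Iso (evPoint m W) := by
  obtain ⟨e, he⟩ := h
  exact ⟨e, fun _ v => he _ v⟩

/-- By induction on the list: each new point adds one irreducible constituent of a tensor product,
which depends only on the classes of the two factors. -/
lemma evModule_congr : ∀ {l : List (MaximalSpectrum A)}, l.Nodup → (∀ m ∈ l, (ρ m).IsIrredFD) →
    (∀ m ∈ l, (ρ' m).IsIrredFD) → (∀ m ∈ l, (ρ m).Iso (ρ' m)) →
    (evModule ρ l).Iso (evModule ρ' l)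
  | [], _, _, _, _ => Iso.refl _
  | m :: l, hl, h, h', hi => by
    have ih := evModule_congr (l := l) (List.nodup_cons.1 hl).2
      (fun m' hm' => h m' (List.mem_cons_of_mem _ hm'))
      (fun m' hm' => h' m' (List.mem_cons_of_mem _ hm'))
      (fun m' hm' => hi m' (List.mem_cons_of_mem _ hm'))
    exact IsIrrPart.iso_congr
      (evModule_isIrredFD (List.nodup_cons.1 hl).2
        fun m' hm' => h m' (List.mem_cons_of_mem _ hm')).1
      (evModule_isIrredFD (List.nodup_cons.1 hl).2
        fun m' hm' => h' m' (List.mem_cons_of_mem _ hm')).1 ih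
      (evPoint_congr m (hi m List.mem_cons_self))
      (isIrrPart_evModule_cons hl h) (isIrrPart_evModule_cons hl h')

/-- Permutations are generated by exchanges of the two leading points, which `IsIrrPart.iso_swap`
handles, and by permutations of the tail. -/
lemma evModule_perm {l l' : List (MaximalSpectrum A)} (hp : l.Perm l') :
    l.Nodup → (∀ m ∈ l, (ρ m).IsIrredFD) → (evModule ρ l).Iso (evModule ρ l') := by
  induction hp with
  | nil => exact fun _ _ => Iso.refl _
  | @cons m l l' hp ih =>
    intro hl h
    have h' : ∀ m' ∈ l, (ρ m').IsIrredFD := fun m' hm' => h m' (List.mem_cons_of_mem _ hm')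
    have hl' := (hp.cons m).nodup_iff.1 hl
    exact IsIrrPart.iso_congr (evModule_isIrredFD (List.nodup_cons.1 hl).2 h').1
      (evModule_isIrredFD (List.nodup_cons.1 hl').2 fun m' hm' => h' m' (hp.mem_iff.2 hm')).1
      (ih (List.nodup_cons.1 hl).2 h') (Iso.refl _) (isIrrPart_evModule_cons hl h)
      (isIrrPart_evModule_cons hl' fun m' hm' => h m' ((hp.cons m).mem_iff.2 hm'))
  | swap m m' l =>
    intro hl h
    have hp := List.Perm.swap m m' l
    have hl' := hp.nodup_iff.1 hl
    have h1 : ∀ m'' ∈ m :: l, (ρ m'').IsIrredFD := fun _ hm => h _ (List.mem_cons_of_mem _ hm)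
    have h' : ∀ m'' ∈ m :: m' :: l, (ρ m'').IsIrredFD := fun _ hm => h _ (hp.mem_iff.2 hm)
    have h2 : ∀ m'' ∈ m' :: l, (ρ m'').IsIrredFD := fun _ hm => h' _ (List.mem_cons_of_mem _ hm)
    exact IsIrrPart.iso_swap (isIrrPart_evModule_cons (List.nodup_cons.1 hl).2 h1)
      (isIrrPart_evModule_cons (List.nodup_cons.1 hl').2 h2)
      (isIrrPart_evModule_cons hl h) (isIrrPart_evModule_cons hl' h')
  | trans hp hp' ih ih' =>
    intro hl h
    exact (ih hl h).trans (ih' (hp.nodup_iff.1 hl) fun m hm => h m (hp.mem_iff.2 hm))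

end Evaluation

/-! ### Recovering the factors of an evaluation module -/

section Isotypic

variable {A : Type v} [CommRing A] [Algebra ℂ A] {L : LieSuperalgebra.{0}}

/-- Through the operators `x ⊗ a`, the `L ⊗ A`-module `T` is generated by homomorphic images of the
`L`-module `V`, and its homomorphisms to `V` separate points. -/
structure IsIsotypic (a : A) (V : SuperRep L) (T : SuperRep (L.mapAlg A)) : Prop where
  generates : ∀ U : Submodule ℂ T, (∀ f : V →ₗ[ℂ] T,
    (∀ x v, f (V.act x v) = T.act (x ⊗ₜ a) (f v)) → ∀ v, f v ∈ U) → U = ⊤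
  separates : ∀ t : T, (∀ f : T →ₗ[ℂ] V,
    (∀ x t, f (T.act (x ⊗ₜ a) t) = V.act x (f t)) → f t = 0) → t = 0

variable {a : A} {V V' : SuperRep L} {T T' N E : SuperRep (L.mapAlg A)}

/-- Generation passes to quotients and separation of points to submodules; a direct summand inherits
both. -/
lemma IsIsotypic.of_surjective_of_injective (h : IsIsotypic a V T) {p : T →ₗ[ℂ] T'}
    (hp : T.IsHom T' p) (hps : Function.Surjective p) {i : T' →ₗ[ℂ] T} (hi : T'.IsHom T i)
    (hii : Function.Injective i) : IsIsotypic a V T' where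
  generates U hU := by
    have := h.generates (U.comap p) fun f hf v =>
      hU (p ∘ₗ f) (fun x v => by simp only [LinearMap.comp_apply, hf x v, hp (x ⊗ₜ a) (f v)]) v
    rw [eq_top_iff]
    intro t _
    obtain ⟨s, rfl⟩ := hps t
    exact (show s ∈ U.comap p by rw [this]; trivial)
  separates t ht := hii (by
    rw [map_zero]
    exact h.separates _ fun f hf => ht (f ∘ₗ i) fun x t => by
      simp only [LinearMap.comp_apply, hi (x ⊗ₜ a) t, hf])

lemma IsIsotypic.of_isIrrPart (h : IsIsotypic a V T) (hN : T.IsIrrPart N) : IsIsotypic a V N := by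
  obtain ⟨p, hp, hps⟩ := hN.exists_surj
  obtain ⟨i, hi, hii⟩ := hN.exists_inj
  exact h.of_surjective_of_injective hp hps hi hii

lemma IsIsotypic.congr (h : IsIsotypic a V T) (e : V.Iso V') : IsIsotypic a V' T := by
  obtain ⟨e, he⟩ := e
  refine ⟨fun U hU => h.generates U fun f hf v => ?_, fun t ht => h.separates t fun f hf => ?_⟩
  · have := hU (f ∘ₗ e.symm.toLinearMap) (fun x v => by
      simp only [LinearMap.comp_apply, LinearEquiv.coe_coe]
      rw [← hf, ← e.symm_apply_apply (V.act x (e.symm v)), he, e.apply_symm_apply]) (e v)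
    simpa using this
  · have := ht (e.toLinearMap ∘ₗ f) fun x t => by
      simp only [LinearMap.comp_apply, LinearEquiv.coe_coe, hf, he]
    simpa using this

/-- Isomorphic modules that are isotypic of irreducible types have isomorphic types. -/
lemma IsIsotypic.iso [Nontrivial T] (h : IsIsotypic a V T) (h' : IsIsotypic a V' T')
    (hV : V.IsIrreducible) (hV' : V'.IsIrreducible) (e : T.Iso T') : V.Iso V' := by
  obtain ⟨e, he⟩ := e
  by_contra hn
  -- If the types differ, every composite `V → T → T' → V'` is zero. Separation in `T'` then makes
  -- every map `V → T` zero, and generation forces `T = 0`.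
  refine bot_ne_top (h.generates ⊥ fun f hf v => ?_)
  rw [Submodule.mem_bot, ← e.map_eq_zero_iff]
  refine h'.separates _ fun g hg => ?_
  by_contra h0
  refine hn (hV.iso_of_ne_zero hV' (f := g ∘ₗ e.toLinearMap ∘ₗ f) (fun x v => ?_)
    fun h' => h0 (LinearMap.congr_fun h' v))
  simp only [LinearMap.comp_apply, LinearEquiv.coe_coe]
  rw [hf, he, hg]

/-- When these operators vanish, every linear map to or from `ℂ` is compatible with them. This
treats points outside the support on the same footing as the others. -/
lemma isIsotypic_triv (hT : ∀ x t, T.act (x ⊗ₜ a) t = 0) : IsIsotypic a (triv L) T := by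
  refine ⟨fun U hU => ?_, fun t ht => ?_⟩
  · rw [eq_top_iff]
    intro t _
    have := hU (LinearMap.toSpanSingleton ℂ T t) (fun x v => by
      rw [hT]; exact map_zero (LinearMap.toSpanSingleton ℂ T t)) (1 : ℂ)
    simpa using this
  · refine (Module.forall_dual_apply_eq_zero_iff ℂ t).1 fun f => ht f fun x t => ?_
    rw [hT, map_zero]
    rfl

lemma tmul_mem_mapGr {i : ZMod 2} {x : L} (hx : x ∈ L.gr i) (a : A) :
    (x ⊗ₜ a : L ⊗[ℂ] A) ∈ (L.mapAlg A).gr i := Submodule.subset_span ⟨x, hx, a, rfl⟩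

lemma itensor_act_of_act_right_eq_zero (hE : ∀ x e, E.act (x ⊗ₜ a) e = 0) (x : L) (n : N) (e : E) :
    (N.itensor E).act (x ⊗ₜ a) (n ⊗ₜ e) = N.act (x ⊗ₜ a) n ⊗ₜ e := by
  refine L.hom_induction (p := fun x : L => (N.itensor E).act (x ⊗ₜ a) (n ⊗ₜ e) =
    N.act (x ⊗ₜ a) n ⊗ₜ e) x (fun i x hx => ?_) (fun x y hx hy => ?_)
  · refine N.hom_induction (p := fun n => (N.itensor E).act (x ⊗ₜ a) (n ⊗ₜ e) =
      N.act (x ⊗ₜ a) n ⊗ₜ e) n (fun j n hn => ?_) (fun n n' hn hn' => ?_)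
    · refine (itensor_act_tmul N E (tmul_mem_mapGr hx a) hn e).trans ?_
      rw [hE, TensorProduct.tmul_zero, smul_zero, add_zero]
    · rw [TensorProduct.add_tmul, map_add, map_add, TensorProduct.add_tmul]
      exact congrArg₂ (· + ·) hn hn'
  · rw [TensorProduct.add_tmul]
    refine (LinearMap.congr_fun (map_add (N.itensor E).act (x ⊗ₜ a) (y ⊗ₜ a)) (n ⊗ₜ e)).trans ?_
    refine (congrArg₂ (· + ·) hx hy).trans ?_
    rw [← TensorProduct.add_tmul]
    exact congrArg (· ⊗ₜ e) (LinearMap.congr_fun (map_add N.act (x ⊗ₜ a) (y ⊗ₜ a)) n).symm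

/-- The operators `x ⊗ a` act on `N` alone, so the maps `n ↦ n ⊗ e` give generation, and contraction
of `E` by linear functionals gives separation. -/
lemma IsIsotypic.itensor_left (h : IsIsotypic a V N) (hE : ∀ x e, E.act (x ⊗ₜ a) e = 0) :
    IsIsotypic a V (N.itensor E) := by
  have hact := itensor_act_of_act_right_eq_zero (N := N) hE
  refine ⟨fun U hU => ?_, fun t ht => ?_⟩
  · have key : ∀ n e, n ⊗ₜ e ∈ U := by
      intro n e
      let φ : N →ₗ[ℂ] N ⊗[ℂ] E := (TensorProduct.mk ℂ N E).flip e
      have hφ : U.comap φ = ⊤ := h.generates _ fun f hf v =>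
        hU (φ ∘ₗ f) (fun x v => (congrArg φ (hf x v)).trans (hact x (f v) e).symm) v
      exact (show n ∈ U.comap φ by rw [hφ]; trivial)
    rw [eq_top_iff]
    intro t _
    induction t using TensorProduct.induction_on with
    | zero => exact zero_mem _
    | add a b ha hb => exact add_mem (ha trivial) (hb trivial)
    | tmul n e => exact key n e
  · refine eq_zero_of_forall_dual_right fun g => h.separates _ fun f hf => ?_
    let F : N ⊗[ℂ] E →ₗ[ℂ] V :=
      f ∘ₗ (TensorProduct.rid ℂ N).toLinearMap ∘ₗ TensorProduct.map LinearMap.id g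
    have hF : ∀ n e, F (n ⊗ₜ e) = g e • f n := fun n e => by simp [F]
    refine ht F fun x t => ?_
    refine LinearMap.congr_fun (f := F ∘ₗ (N.itensor E).act (x ⊗ₜ a)) (g := V.act x ∘ₗ F) ?_ t
    refine TensorProduct.ext' fun n e => ?_
    refine (congrArg F (hact x n e)).trans ?_
    rw [hF, hf, LinearMap.comp_apply, hF, map_smul]

lemma braiding_isHom (V W : SuperRep (L.mapAlg A)) :
    (W.itensor V).IsHom (V.itensor W) (braiding V.toSuperSpace W.toSuperSpace) :=
  isHom_of_homogeneous fun _ _ hx t => braiding_act V W hx hx t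

/-- The braiding is an isomorphism of modules, which moves the factor acted on to the left. -/
lemma IsIsotypic.itensor_right (h : IsIsotypic a V E) (hN : ∀ x n, N.act (x ⊗ₜ a) n = 0) :
    IsIsotypic a V (N.itensor E) :=
  (h.itensor_left hN).of_surjective_of_injective (braiding_isHom N E) (braiding_surjective _ _)
    (braiding_isHom E N) (braiding_injective _ _)

variable [Algebra.FiniteType ℂ A] {m : MaximalSpectrum A} {ρ : MaximalSpectrum A → SuperRep L}

lemma evModule_act_of_mem {l : List (MaximalSpectrum A)} (ha : ∀ m ∈ l, a ∈ m.asIdeal) (x : L)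
    (t : evModule ρ l) : (evModule ρ l).act (x ⊗ₜ a) t = 0 := by
  change (pointsRep ρ l).act ((evHom L l).toLin (x ⊗ₜ a)) t = 0
  have e : (x ⊗ₜ a : L ⊗[ℂ] A) = mulRight L a (x ⊗ₜ 1) := by simp [mulRight]
  rw [e, evHom_mulRight_of_mem L l ha, map_zero]
  rfl

lemma evPoint_act_of_sub_one_mem (ha : a - 1 ∈ m.asIdeal) (x : L) (v : V) :
    (evPoint m V).act (x ⊗ₜ a) v = V.act x v := by
  have h0 : Ideal.Quotient.mk m.asIdeal a = 1 := by
    rw [← map_one (Ideal.Quotient.mk m.asIdeal)]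
    exact (Ideal.Quotient.mk_eq_mk_iff_sub_mem a 1).2 ha
  change V.act (TensorProduct.rid ℂ L (TensorProduct.map LinearMap.id
    (residueEquiv m : (A ⧸ m.asIdeal) →ₐ[ℂ] ℂ).toLinearMap (TensorProduct.map LinearMap.id
      (Ideal.Quotient.mkₐ ℂ m.asIdeal).toLinearMap (x ⊗ₜ a)))) v = V.act x v
  simp [h0]

lemma isIsotypic_evPoint (ha : a - 1 ∈ m.asIdeal) (V : SuperRep L) :
    IsIsotypic a V (evPoint m V) := by
  refine ⟨fun U hU => ?_, fun t ht => ?_⟩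
  · rw [eq_top_iff]
    intro t _
    exact hU (LinearMap.id : V →ₗ[ℂ] V) (fun x v => (evPoint_act_of_sub_one_mem ha x v).symm) t
  · exact ht (LinearMap.id : V →ₗ[ℂ] V) (fun x v => evPoint_act_of_sub_one_mem ha x v)

/-- At each stage the operators `x ⊗ a` annihilate one of the two factors: the tail if the head is
`m`, the head otherwise. Isotypicity of the other factor passes to the tensor product and then to
its irreducible part. -/
lemma isIsotypic_evModule (ha : a - 1 ∈ m.asIdeal) : ∀ {l : List (MaximalSpectrum A)}, l.Nodup →
    (∀ m' ∈ l, (ρ m').IsIrredFD) → (∀ m' ∈ l, m' ≠ m → a ∈ m'.asIdeal) → m ∈ l →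
      IsIsotypic a (ρ m) (evModule ρ l)
  | [], _, _, _, hm => by simp at hm
  | m₀ :: l, hl, h, ha', hm => by
    refine IsIsotypic.of_isIrrPart ?_ (isIrrPart_evModule_cons hl h)
    by_cases h0 : m₀ = m
    · subst h0
      exact (isIsotypic_evPoint ha _).itensor_right (evModule_act_of_mem fun m' hm' =>
        ha' m' (List.mem_cons_of_mem _ hm') fun h' => (List.nodup_cons.1 hl).1 (h' ▸ hm'))
    · have hm' : m ∈ l := (List.mem_cons.1 hm).resolve_left (Ne.symm h0)
      refine (isIsotypic_evModule ha (List.nodup_cons.1 hl).2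
        (fun m' hm' => h m' (List.mem_cons_of_mem _ hm'))
        (fun m' hm' => ha' m' (List.mem_cons_of_mem _ hm')) hm').itensor_left ?_
      -- The evaluation module at one point is by definition that of the singleton list.
      refine evModule_act_of_mem (ρ := ρ) (l := [m₀]) fun m' hm' => ?_
      rw [List.mem_singleton.1 hm']
      exact ha' m₀ List.mem_cons_self h0

end Isotypic

/-! ### Independence of choices, irreducibility and injectivity for finitely supported maps -/

section FinSupp

variable {A : Type v} [CommRing A] {L : LieSuperalgebra.{0}}

lemma IrrClass.rep_spec {L : LieSuperalgebra.{u}} (c : IrrClass L) :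
    c.rep.IsIrredFD ∧ c.rep.cls = c.1 := c.2.choose_spec

variable [Algebra ℂ A] [Algebra.FiniteType ℂ A]

lemma evHat_eq (Ψ : FinSuppMap L A) (l : List (MaximalSpectrum A))
    (ρ : MaximalSpectrum A → SuperRep L) (hl : l.Nodup) (hm : ∀ m, m ∈ l ↔ m ∈ suppSet Ψ.1)
    (hρ : ∀ m ∈ l, (ρ m).IsIrredFD ∧ (ρ m).cls = (Ψ.1 m).1) :
    evHat Ψ = (evModule ρ l).cls := by
  refine cls_eq_iff.2 (Iso.trans
    (evModule_perm ((List.perm_ext_iff_of_nodup (Finset.nodup_toList _) hl).2 fun m => ?_)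
      (Finset.nodup_toList _) fun m _ => (Ψ.1 m).rep_spec.1)
    (evModule_congr hl (fun m _ => (Ψ.1 m).rep_spec.1) (fun m hm => (hρ m hm).1)
      fun m hm => cls_eq_iff.1 ((Ψ.1 m).rep_spec.2.trans (hρ m hm).2.symm)))
  rw [hm, Finset.mem_toList, Set.Finite.mem_toFinset]

lemma evHat_isIrredFD (Ψ : FinSuppMap L A) :
    ∃ V : SuperRep (L.mapAlg A), V.IsIrredFD ∧ V.cls = evHat Ψ :=
  ⟨_, evModule_isIrredFD (Finset.nodup_toList _) fun m _ => (Ψ.1 m).rep_spec.1, rfl⟩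

/-- For `m` in the support this is the isotypicity of evaluation modules; outside it, `a` lies in
all the maximal ideals involved, so the operators vanish and the type is trivial, which is the value
of `Ψ` at `m`. -/
lemma isIsotypic_evHat (Ψ : FinSuppMap L A) {a : A} {m : MaximalSpectrum A}
    (ha : a - 1 ∈ m.asIdeal) (ha' : ∀ m' ∈ Ψ.2.toFinset.toList, m' ≠ m → a ∈ m'.asIdeal) :
    IsIsotypic a (Ψ.1 m).rep (evModule (fun m => (Ψ.1 m).rep) Ψ.2.toFinset.toList) := by
  by_cases hm : m ∈ Ψ.2.toFinset.toList
  · exact isIsotypic_evModule (ρ := fun m => (Ψ.1 m).rep) ha (Finset.nodup_toList _)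
      (fun m _ => (Ψ.1 m).rep_spec.1) ha' hm
  · have ht : (Ψ.1 m).1 = (triv L).cls := by
      by_contra h
      exact hm (by rw [Finset.mem_toList, Set.Finite.mem_toFinset]; exact h)
    exact (isIsotypic_triv (evModule_act_of_mem fun m' hm' =>
      ha' m' hm' fun h => hm (h ▸ hm'))).congr
        (cls_eq_iff.1 (ht.symm.trans (Ψ.1 m).rep_spec.2.symm))

lemma evHat_injective : Function.Injective (evHat : FinSuppMap L A → RepClass (L.mapAlg A)) := by
  classical
  intro Ψ Ψ' h
  refine Subtype.ext (funext fun m => Subtype.ext ?_)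
  -- One element `a` has to serve both maps, so it is made to vanish at every point other than `m`
  -- of either support.
  obtain ⟨a, ha, ha1⟩ := exists_sub_one_mem_of_notMem m
    ((Ψ.2.toFinset.toList ++ Ψ'.2.toFinset.toList).filter (· ≠ m)) (by simp)
  have h1 := isIsotypic_evHat Ψ ha1 fun m' hm' hne =>
    ha m' (List.mem_filter.2 ⟨List.mem_append_left _ hm', by simpa using hne⟩)
  have h2 := isIsotypic_evHat Ψ' ha1 fun m' hm' hne =>
    ha m' (List.mem_filter.2 ⟨List.mem_append_right _ hm', by simpa using hne⟩)
  have := (evModule_isIrredFD (ρ := fun m => (Ψ.1 m).rep) (Finset.nodup_toList Ψ.2.toFinset)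
    fun m _ => (Ψ.1 m).rep_spec.1).1.1
  rw [← (Ψ.1 m).rep_spec.2, ← (Ψ'.1 m).rep_spec.2]
  exact cls_eq_iff.2 (h1.iso h2 (Ψ.1 m).rep_spec.1.1 (Ψ'.1 m).rep_spec.1.1 (cls_eq_iff.1 h))

end FinSupp

end Queer

/-- Let `n ≥ 2` and let `A` be a finitely generated commutative complex algebra. The class `êv_Ψ`
does not depend on the enumeration of the support of `Ψ` nor on the representatives of the classes
`Ψ m`, it is the class of an irreducible finite-dimensional representation of `q(n) ⊗ A`, and the
map `Ψ ↦ êv_Ψ` from finitely supported maps `MaxSpec(A) → R(q(n))` to `R(q(n) ⊗ A)` is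
injective. -/
theorem proposition6p8 (n : ℕ) (hn : 2 ≤ n) (A : Type*) [CommRing A] [Algebra ℂ A]
    [Algebra.FiniteType ℂ A] :
    (∀ (Ψ : Queer.FinSuppMap (Queer.q n) A) (l : List (MaximalSpectrum A))
        (ρ : MaximalSpectrum A → Queer.SuperRep (Queer.q n)),
        l.Nodup → (∀ m, m ∈ l ↔ m ∈ Queer.suppSet Ψ.1) →
        (∀ m ∈ l, (ρ m).IsIrredFD ∧ (ρ m).cls = (Ψ.1 m).1) →
        Queer.evHat Ψ = (Queer.evModule ρ l).cls) ∧
    ∃ h : ∀ Ψ : Queer.FinSuppMap (Queer.q n) A,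
        ∃ V : Queer.SuperRep ((Queer.q n).mapAlg A), V.IsIrredFD ∧ V.cls = Queer.evHat Ψ,
      Function.Injective
        (fun Ψ : Queer.FinSuppMap (Queer.q n) A =>
          (⟨Queer.evHat Ψ, h Ψ⟩ : Queer.IrrClass ((Queer.q n).mapAlg A))) := by
  refine ⟨Queer.evHat_eq, Queer.evHat_isIrredFD, fun Ψ Ψ' h => ?_⟩
  exact Queer.evHat_injective (congrArg Subtype.val h)
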